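/- Let $a'<b'<a<b$ be real, $I'=[a',b']$, $I=[a,b]$, and in $L^2(\mathbb R)$ (with $\langle f,g\rangle=\int f\overline g$) put $$\phi=\chi_I,\qquad \psi(x)=\chi_{I'}(x)\Big(\int_I\frac{dt}{t-x}\Big)^{-1}.$$ Let $A$ be the operator $(Af)(x)=xf(x)+\langle f,\phi\rangle\psi(x)$ with domain consisting of all $f\in L^2(\mathbb R)$ such that $xf\in L^2(\mathbb R)$ and $\lim_{R\to\infty}\int_{-R}^Rf(x)\,dx$ exists and is $0$; let $\widetilde A$ be the same operator with $\phi$ and $\psi$ interchanged. For $u$ in $D(\widetilde A^*)=D(A^*)$ let $\Gamma_1u=\lim_{R\to\infty}\int_{-R}^Ru(x)\,dx$ and let $\Gamma_2u$ be the unique constant $c$ with $xu-c\in L^2(\mathbb R)$. Let $B\in\mathbb C$, $A_B=\widetilde A^*|_{\ker(\Gamma_1-B\Gamma_2)}$ and $\widetilde A_{B^*}=A^*|_{\ker(\Gamma_1-\overline B\Gamma_2)}$. For $\lambda\in\rho(A_B)$, the number $M_B(\lambda)$ is defined by $M_B(\lambda)(\Gamma_1-B\Gamma_2)u=\Gamma_2u$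 for all $u\in\ker(\widetilde A^*-\lambda)$, and $S_{\lambda,B}=\big((\Gamma_1-B\Gamma_2)|_{\ker(\widetilde A^*-\lambda)}\big)^{-1}$. For $\mu_0\in\rho(A_B)$, the detectable subspace $\overline{\mathcal S}$ is the closed linear span of the ranges of $(A_B-\delta)^{-1}S_{\mu_0,B}$, $\delta\in\rho(A_B)$; the dual detectable subspace $\overline{\widetilde{\mathcal S}}$ is defined in the same way from $A^*$, $\widetilde A_{B^*}$ and a point $\mu_1\in\rho(\widetilde A_{B^*})$. Orthogonal projections are denoted by $P$. For a function $f$ on $\mathbb C\setminus\mathbb R$ and $k\in\mathbb R$ write $f(k\pm i0)=\lim_{\varepsilon\downarrow0}f(k\pm i\varepsilon)$ and $[f(k)]=\lim_{\varepsilon\downarrow0}\big(f(k+i\varepsilon)-f(k-i\varepsilon)\big)$, when these limits exist, and write $\widehat\psi(k)=\int_{I'}\frac{\psi(t)}{t-k}\,dt$ for $k\notin I'$. For every $B\in\mathbb C$ the sets $\rho(A_B)$ and $\rho(\widetilde A_{B^*})$ are non-empty, and for all $\mu_0\in\rho(A_B)$, $\mu_1\in\rho(\widetilde A_{B^*})$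 the following hold. 1. $\overline{\mathcal S}\ne L^2(\mathbb R)$ and $\dim\mathcal S^\perp=\infty$, while $\overline{\widetilde{\mathcal S}}=L^2(\mathbb R)$. 2. $M_B$ is well defined and without zeros on $\rho(A_B)$. For each real $k\notin\{a',b',a,b\}$ the points $k\pm i\varepsilon$ lie in $\rho(A_B)$ for all sufficiently small $\varepsilon>0$, and $$[M_B^{-1}(k)]=\begin{cases}2\pi i,& k\in\mathbb R\setminus(I\cup I'),\\ 2\pi i\,(1-\widehat\psi(k)),& k\in(a,b),\\ 0,& k\in(a',b').\end{cases}$$ 3. For almost every $k\in\mathbb R$ the finite boundary values $M_B(k\pm i0)$ exist. Whenever they exist and $k\notin\{a',b',a,b\}$, one has $M_B(k+i0)\ne M_B(k-i0)$ if and only if $k\notin I'$. 4. The bordered resolvent $F(\lambda)=P_{\overline{\widetilde{\mathcal S}}}(A_B-\lambda)^{-1}P_{\overline{\mathcal S}}$ jumps at $k$ exactly when $k\notin I'$, in the following sense. If $k\in(a',b')$ and the finite boundary values $M_B(k\pm i0)$ exist, then $[\langle F(k)v,w\rangle]=0$ for all $v,w\in L^2(\mathbb R)$. If $k\in\mathbb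 R\setminus I'$, then it is not true that $[\langle F(k)v,w\rangle]$ exists and is $0$ for all $v,w\in L^2(\mathbb R)$; if moreover the finite boundary values $M_B(k\pm i0)$ exist, then there are $v,w\in L^2(\mathbb R)$ for which $[\langle F(k)v,w\rangle]$ exists and is not $0$. -/

import Mathlib

open MeasureTheory Filter Topology
open scoped LinearPMap

namespace Friedrichs

/-- The Hilbert space `L²(ℝ)` of complex-valued functions. Mathlib's `inner ℂ f g` is linear in the
second argument, so the pairing `⟨f, g⟩ = ∫ f * conj g` is `inner ℂ g f`. -/
abbrev L2 : Type := Lp ℂ 2 (volume : Measure ℝ)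

/-- `Γ₁ u = l`: the symmetric integrals of `u` over `[-R, R]` converge to `l`. -/
def HasTrace₁ (u : L2) (l : ℂ) : Prop :=
  Tendsto (fun R : ℝ => ∫ x in (-R)..R, u x) atTop (𝓝 l)

/-- `Γ₂ u = c`: `c` is the (unique) constant with `x u(x) - c ∈ L²(ℝ)`. -/
def HasTrace₂ (u : L2) (c : ℂ) : Prop :=
  MemLp (fun x : ℝ => (x : ℂ) * u x - c) 2 volume

theorem intervalIntegrable_coe (u : L2) (p q : ℝ) :
    IntervalIntegrable (fun x => u x) volume p q := by
  rw [intervalIntegrable_iff']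
  have : IsFiniteMeasure ((volume : Measure ℝ).restrict (Set.uIcc p q)) :=
    isFiniteMeasure_restrict.2 isCompact_uIcc.measure_lt_top.ne
  exact ((Lp.memLp u).restrict _).integrable (by norm_num)

theorem HasTrace₁.zero : HasTrace₁ 0 0 := by
  have h : ∀ R : ℝ, ∫ x in (-R)..R, (0 : L2) x = 0 := fun R => by
    rw [intervalIntegral.integral_congr_ae (g := fun _ => (0 : ℂ))]
    · simp
    · filter_upwards [Lp.coeFn_zero ℂ 2 (volume : Measure ℝ)] with x hx _
      rw [hx, Pi.zero_apply]
  simp only [HasTrace₁, h]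
  exact tendsto_const_nhds

theorem HasTrace₁.add {u v : L2} {l m : ℂ} (hu : HasTrace₁ u l) (hv : HasTrace₁ v m) :
    HasTrace₁ (u + v) (l + m) := by
  refine (Tendsto.add hu hv).congr fun R => ?_
  rw [← intervalIntegral.integral_add (intervalIntegrable_coe u _ _)
    (intervalIntegrable_coe v _ _)]
  refine intervalIntegral.integral_congr_ae ?_
  filter_upwards [Lp.coeFn_add u v] with x hx _
  rw [hx, Pi.add_apply]

theorem HasTrace₁.smul {u : L2} {l : ℂ} (z : ℂ) (hu : HasTrace₁ u l) :
    HasTrace₁ (z • u) (z * l) := by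
  refine (Tendsto.const_mul z hu).congr fun R => ?_
  rw [← intervalIntegral.integral_const_mul]
  refine intervalIntegral.integral_congr_ae ?_
  filter_upwards [Lp.coeFn_smul z u] with x hx _
  rw [hx, Pi.smul_apply, smul_eq_mul]

theorem HasTrace₂.zero : HasTrace₂ 0 0 := by
  refine (MemLp.zero' (ε := ℂ)).ae_eq ?_
  filter_upwards [Lp.coeFn_zero ℂ 2 (volume : Measure ℝ)] with x hx
  rw [hx]
  simp

theorem HasTrace₂.add {u v : L2} {l m : ℂ} (hu : HasTrace₂ u l) (hv : HasTrace₂ v m) :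
    HasTrace₂ (u + v) (l + m) := by
  refine (MemLp.add hu hv).ae_eq ?_
  filter_upwards [Lp.coeFn_add u v] with x hx
  simp only [Pi.add_apply, hx]
  ring

theorem HasTrace₂.smul {u : L2} {l : ℂ} (z : ℂ) (hu : HasTrace₂ u l) :
    HasTrace₂ (z • u) (z * l) := by
  refine (MemLp.const_mul hu z).ae_eq ?_
  filter_upwards [Lp.coeFn_smul z u] with x hx
  simp only [Pi.smul_apply, smul_eq_mul, hx]
  ring

/-- The domain of the minimal operator: all `f ∈ L²` with `x f(x) ∈ L²` such that
`lim_{R → ∞} ∫_{-R}^{R} f` exists and is zero. -/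
def minimalDomain : Submodule ℂ L2 where
  carrier := {f | HasTrace₂ f 0 ∧ HasTrace₁ f 0}
  zero_mem' := ⟨HasTrace₂.zero, HasTrace₁.zero⟩
  add_mem' hf hg := ⟨by simpa using hf.1.add hg.1, by simpa using hf.2.add hg.2⟩
  smul_mem' z _ hf := ⟨by simpa using hf.1.smul z, by simpa using hf.2.smul z⟩

theorem memLp_mul {f : L2} (hf : f ∈ minimalDomain) :
    MemLp (fun x : ℝ => (x : ℂ) * f x) 2 volume := by
  simpa [HasTrace₂] using hf.1

/-- The Friedrichs operator `(A f)(x) = x f(x) + ⟨f, φ⟩ ψ(x)` on the minimal domain. -/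
noncomputable def friedrichs (φ ψ : L2) : L2 →ₗ.[ℂ] L2 where
  domain := minimalDomain
  toFun :=
    { toFun := fun f => (memLp_mul f.2).toLp _ + inner ℂ φ (f : L2) • ψ
      map_add' := fun f g => by
        have h : (memLp_mul (f + g).2).toLp _
            = (memLp_mul f.2).toLp _ + (memLp_mul g.2).toLp _ := by
          rw [← MemLp.toLp_add]
          refine MemLp.toLp_congr _ _ ?_
          filter_upwards [Lp.coeFn_add (f : L2) (g : L2)] with x hx
          simp only [Submodule.coe_add, hx, Pi.add_apply]
          ring
        rw [h, Submodule.coe_add, inner_add_right, add_smul]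
        abel
      map_smul' := fun z f => by
        have h : (memLp_mul (z • f).2).toLp _ = z • (memLp_mul f.2).toLp _ := by
          rw [← MemLp.toLp_const_smul]
          refine MemLp.toLp_congr _ _ ?_
          filter_upwards [Lp.coeFn_smul z (f : L2)] with x hx
          simp only [Submodule.coe_smul, hx, Pi.smul_apply, smul_eq_mul]
          ring
        rw [h, Submodule.coe_smul, inner_smul_right, RingHom.id_apply, smul_add, mul_smul] }

/-- The maximal operator `Ã*`, where `Ã` is the Friedrichs operator with the roles of `φ` and `ψ`
swapped. Consequently `maximalOp ψ φ` is `A*`, and in all definitions below the objects of the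
formally adjoint problem (those with a tilde) are obtained by swapping `φ` and `ψ`. -/
noncomputable def maximalOp (φ ψ : L2) : L2 →ₗ.[ℂ] L2 :=
  (friedrichs ψ φ)†

/-- The boundary condition `Γ₁ u = B Γ₂ u`. -/
def boundaryCondition (B : ℂ) : Submodule ℂ L2 where
  carrier := {u | ∃ l c : ℂ, HasTrace₁ u l ∧ HasTrace₂ u c ∧ l - B * c = 0}
  zero_mem' := ⟨0, 0, HasTrace₁.zero, HasTrace₂.zero, by simp⟩
  add_mem' := by
    rintro u v ⟨l, c, h₁, h₂, h⟩ ⟨l', c', h₁', h₂', h'⟩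
    exact ⟨l + l', c + c', h₁.add h₁', h₂.add h₂', by linear_combination h + h'⟩
  smul_mem' := by
    rintro z u ⟨l, c, h₁, h₂, h⟩
    exact ⟨z * l, z * c, h₁.smul z, h₂.smul z, by linear_combination z * h⟩

/-- `A_B`, the restriction of `Ã*` to `ker (Γ₁ - B Γ₂)`. The operator `Ã_{B*}` of the formally
adjoint problem is `extensionOp ψ φ (conj B)`. -/
noncomputable def extensionOp (φ ψ : L2) (B : ℂ) : L2 →ₗ.[ℂ] L2 :=
  (maximalOp φ ψ).domRestrict (boundaryCondition B)

/-- The bounded operator `R` is the inverse of `T - z`. -/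
def IsResolvent (T : L2 →ₗ.[ℂ] L2) (z : ℂ) (R : L2 →L[ℂ] L2) : Prop :=
  (∀ g : L2, ∃ h : R g ∈ T.domain, T ⟨R g, h⟩ - z • R g = g) ∧
    ∀ u : T.domain, R (T u - z • (u : L2)) = u

/-- The resolvent set `ρ(T)` of an unbounded operator. -/
def rho (T : L2 →ₗ.[ℂ] L2) : Set ℂ := {z | ∃ R, IsResolvent T z R}

open scoped Classical in
/-- The resolvent `(T - z)⁻¹` for `z ∈ ρ(T)` (and `0` otherwise). -/
noncomputable def resolventOp (T : L2 →ₗ.[ℂ] L2) (z : ℂ) : L2 →L[ℂ] L2 :=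
  if h : ∃ R, IsResolvent T z R then h.choose else 0

/-- `u ∈ ker (Ã* - z)`. -/
def InKernel (φ ψ : L2) (z : ℂ) (u : L2) : Prop :=
  ∃ h : u ∈ (maximalOp φ ψ).domain, maximalOp φ ψ ⟨u, h⟩ = z • u

/-- The range of the solution operator `S_{z,B}`: all `u ∈ ker (Ã* - z)` that solve
`(Γ₁ - B Γ₂) u = f` for some `f ∈ ℂ`. -/
def solutionRange (φ ψ : L2) (B z : ℂ) : Set L2 :=
  {u | InKernel φ ψ z u ∧ ∃ f l c : ℂ, HasTrace₁ u l ∧ HasTrace₂ u c ∧ l - B * c = f}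

/-- The space `S_B`, the span over `δ ∈ ρ(A_B)` of `(A_B - δ)⁻¹ Ran S_{μ₀,B}`. -/
noncomputable def detectableSpan (φ ψ : L2) (B μ₀ : ℂ) : Submodule ℂ L2 :=
  Submodule.span ℂ (⋃ δ ∈ rho (extensionOp φ ψ B),
    resolventOp (extensionOp φ ψ B) δ '' solutionRange φ ψ B μ₀)

/-- The detectable subspace, the closure of `S_B`. The dual one is
`detectableSubspace ψ φ (conj B) μ₁`. -/
noncomputable def detectableSubspace (φ ψ : L2) (B μ₀ : ℂ) : Submodule ℂ L2 :=
  (detectableSpan φ ψ B μ₀).topologicalClosure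

noncomputable instance (φ ψ : L2) (B μ₀ : ℂ) : CompleteSpace (detectableSubspace φ ψ B μ₀) :=
  inferInstanceAs (CompleteSpace (detectableSpan φ ψ B μ₀).topologicalClosure)

/-- `m` satisfies the defining relation of `M_B(z)`:
`m (Γ₁ - B Γ₂) u = Γ₂ u` for all `u ∈ ker (Ã* - z)`. -/
def IsMValue (φ ψ : L2) (B z m : ℂ) : Prop :=
  ∀ u : L2, InKernel φ ψ z u → ∀ l c : ℂ, HasTrace₁ u l → HasTrace₂ u c → m * (l - B * c) = c

/-- The `M`-function `M_B(z)`, for `z ∈ ρ(A_B)`. -/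
noncomputable def mFunction (φ ψ : L2) (B z : ℂ) : ℂ :=
  Classical.epsilon (IsMValue φ ψ B z)

/-- The bordered resolvent `P (A_B - z)⁻¹ Q`, with `P`, `Q` the orthogonal projections onto the dual
detectable subspace and onto the detectable subspace. -/
noncomputable def borderedResolvent (φ ψ : L2) (B μ₀ μ₁ z : ℂ) : L2 →L[ℂ] L2 :=
  (detectableSubspace ψ φ (starRingEnd ℂ B) μ₁).starProjection ∘L
    resolventOp (extensionOp φ ψ B) z ∘L (detectableSubspace φ ψ B μ₀).starProjection

/-- `f̂(z) = ∫ f(x) / (x - z) dx`. -/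
noncomputable def cauchyTransform (f : L2) (z : ℂ) : ℂ := ∫ x : ℝ, f x / ((x : ℂ) - z)

/-- `f(k + i0) = p`. -/
def HasUpperValue (f : ℂ → ℂ) (k : ℝ) (p : ℂ) : Prop :=
  Tendsto (fun ε : ℝ => f (k + ε * Complex.I)) (𝓝[>] 0) (𝓝 p)

/-- `f(k - i0) = q`. -/
def HasLowerValue (f : ℂ → ℂ) (k : ℝ) (q : ℂ) : Prop :=
  Tendsto (fun ε : ℝ => f (k - ε * Complex.I)) (𝓝[>] 0) (𝓝 q)

/-- Both boundary values `f(k ± i0)` exist in `ℂ`. -/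
def HasBoundaryValues (f : ℂ → ℂ) (k : ℝ) : Prop :=
  (∃ p, HasUpperValue f k p) ∧ ∃ q, HasLowerValue f k q

/-- The jump `[f](k) = lim_{ε ↓ 0} (f(k + iε) - f(k - iε))` exists and equals `J`. -/
def HasJump (f : ℂ → ℂ) (k : ℝ) (J : ℂ) : Prop :=
  Tendsto (fun ε : ℝ => f (k + ε * Complex.I) - f (k - ε * Complex.I)) (𝓝[>] 0) (𝓝 J)

/-- The jump at `k` of an operator family exists weakly and is zero. -/
def JumpVanishes (F : ℂ → L2 →L[ℂ] L2) (k : ℝ) : Prop :=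
  ∀ v w : L2, HasJump (fun z => inner ℂ w (F z v)) k 0

/-- Some matrix element of the operator family has a nonzero jump at `k`. -/
def HasNonzeroJump (F : ℂ → L2 →L[ℂ] L2) (k : ℝ) : Prop :=
  ∃ v w : L2, ∃ J : ℂ, J ≠ 0 ∧ HasJump (fun z => inner ℂ w (F z v)) k J

end Friedrichs

namespace Friedrichs

/-! Write `f̂(z) = ∫ f(x)/(x - z) dx`; here `φ` and `ψ` are real with disjoint supports. For
non-real `z` the kernel of `Ã* - z` is the line spanned by `u_z = (1 - φ̂(z) ψ)/(x - z)`, because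
`φψ = 0` decouples the equation. It has `Γ₂ u_z = 1` and `Γ₁ u_z = ±πi - φ̂(z) ψ̂(z)`, with sign
that of `Im z`. So `1/M_B` is the explicit function `D = ±πi - B - φ̂ψ̂` (`weylDenom`), the
resolvent set consists of the non-real points with `D ≠ 0`, and the resolvent is given by a Krein
formula (`DisjointSupport.isResolvent`, `DisjointSupport.mem_rho_iff`).

The decisive identity is `f̂ ĥ = (f ĥ)^ + (h f̂)^` for functions with separated supports
(`Apart.cauchyInt_mul_cauchyInt`). Since `ψ` is chosen with `ψ φ̂ = χ_{I'}`, it gives `φ̂ψ̂ = (φψ̂)^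
+ (χ_{I'})^`, and the jump `2πi` of the last term across `I'` cancels the jump of `±πi`. On `I` only
`φ̂` jumps, which leaves `2πi(1 - ψ̂)`. This is not zero because `ψ̂ < 0` to the right of `I'`.
Outside both intervals the full jump `2πi` remains.

A vector is orthogonal to the detectable subspace exactly when it is orthogonal to every `u_z`
(`Nondegenerate.mem_orthogonal_iff`). A function is determined by its Cauchy transform
(`CauchyIntegrable.ae_eq_zero`), so this is a pointwise equation for `w = conj v`, namely `w = φ
(wψ)^ + χ_{I'} w`. Here `w` is free on `I'`, determined by it on `I`, and zero elsewhere. Hence the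
complement is infinite dimensional. For the dual problem the equation is `w = φ w ψ̂ + ψ (φw)^`,
which forces `w = 0` on `I` since `ψ̂ ≠ 1` there, and then everywhere.

Dually, a detectable `g` satisfies `g = ψ (φg)^` on `I'` (`Model.ae_eq_of_mem_detectableSubspace`).
With it, every term of Krein's formula becomes a Cauchy transform of a function vanishing on `I'`,
so the bordered resolvent has no jump there. Off `I'`, away from the endpoints of `I`, the resolvent
identity applied to `u_{μ₀}` expresses a matrix element through `M_B` and continuous factors, so the
jump of `M_B` is visible (`Model.hasNonzeroJump_of_notMem_endpoints`). At an endpoint of `I` the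
logarithmic singularity of `D` is compared with that of an indicator function of an adjacent
interval (`Model.hasNonzeroJump_of_adjacent`). -/

/-! ### Cauchy transforms off the real line: integrability, analyticity, decay. -/

/-- The Cauchy transform `z ↦ ∫ f(x) / (x - z) dx` of a function on the line. -/
noncomputable def cauchyInt (f : ℝ → ℂ) (z : ℂ) : ℂ := ∫ x : ℝ, f x / ((x : ℂ) - z)

/-- The functions whose Cauchy transform converges absolutely off the real line. -/
def CauchyIntegrable (f : ℝ → ℂ) : Prop :=
  Integrable (fun x : ℝ => f x / ((x : ℂ) + Complex.I))

/-- The point `z` has distance at least `δ` from the support of `f`. -/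
def AwayFrom (f : ℝ → ℂ) (z : ℂ) (δ : ℝ) : Prop :=
  ∀ᵐ x : ℝ, f x = 0 ∨ δ ≤ ‖(x : ℂ) - z‖

theorem ofReal_add_I_ne_zero (x : ℝ) : (x : ℂ) + Complex.I ≠ 0 := fun h => by
  simpa using congrArg Complex.im h

theorem ofReal_sub_ne_zero {z : ℂ} (hz : z.im ≠ 0) (x : ℝ) : (x : ℂ) - z ≠ 0 := fun h => hz <| by
  simpa using congrArg Complex.im h

theorem abs_im_le_norm_ofReal_sub (z : ℂ) (x : ℝ) : |z.im| ≤ ‖(x : ℂ) - z‖ := by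
  simpa using Complex.abs_im_le_norm ((x : ℂ) - z)

theorem awayFrom_of_im (f : ℝ → ℂ) (z : ℂ) : AwayFrom f z |z.im| :=
  Eventually.of_forall fun x => Or.inr (abs_im_le_norm_ofReal_sub z x)

theorem norm_ofReal_add_I_le {x δ : ℝ} {z : ℂ} (hδ : 0 < δ) (h : δ ≤ ‖(x : ℂ) - z‖) :
    ‖(x : ℂ) + Complex.I‖ ≤ (1 + ‖z + Complex.I‖ / δ) * ‖(x : ℂ) - z‖ := by
  calc ‖(x : ℂ) + Complex.I‖ = ‖((x : ℂ) - z) + (z + Complex.I)‖ := by ring_nf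
    _ ≤ ‖(x : ℂ) - z‖ + ‖z + Complex.I‖ := norm_add_le _ _
    _ = ‖(x : ℂ) - z‖ + ‖z + Complex.I‖ / δ * δ := by field_simp
    _ ≤ ‖(x : ℂ) - z‖ + ‖z + Complex.I‖ / δ * ‖(x : ℂ) - z‖ := by gcongr
    _ = _ := by ring

/-- Since `|x + i| ≤ |x - z| + |z + i|`, moving the pole from `-i` to `z` costs a factor that
depends only on `|z + i|` and `δ`. Integrability at every admissible `z` thus reduces to the single
condition at `-i`, with locally uniform majorants. -/
theorem norm_div_sub_le {f : ℝ → ℂ} {x δ : ℝ} {z : ℂ} (hδ : 0 < δ)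
    (h : f x = 0 ∨ δ ≤ ‖(x : ℂ) - z‖) :
    ‖f x / ((x : ℂ) - z)‖ ≤ (1 + ‖z + Complex.I‖ / δ) * ‖f x / ((x : ℂ) + Complex.I)‖ := by
  rcases h with h | h
  · simp [h]
  have h1 := norm_ofReal_add_I_le hδ h
  have h2 : 0 < ‖(x : ℂ) + Complex.I‖ := norm_pos_iff.2 (ofReal_add_I_ne_zero x)
  have h3 : 0 < ‖(x : ℂ) - z‖ := hδ.trans_le h
  rw [norm_div, norm_div, ← mul_div_assoc, div_le_div_iff₀ h3 h2]
  nlinarith [norm_nonneg (f x)]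

theorem CauchyIntegrable.aestronglyMeasurable {f : ℝ → ℂ} (hf : CauchyIntegrable f) :
    AEStronglyMeasurable f volume := by
  have h : f = fun x : ℝ => f x / ((x : ℂ) + Complex.I) * ((x : ℂ) + Complex.I) := by
    funext x
    rw [div_mul_cancel₀ _ (ofReal_add_I_ne_zero x)]
  rw [h]
  exact AEStronglyMeasurable.fun_mul (Integrable.aestronglyMeasurable hf)
    (Continuous.aestronglyMeasurable (by fun_prop))

theorem cauchyInt_congr {f g : ℝ → ℂ} (h : f =ᵐ[volume] g) (z : ℂ) :
    cauchyInt f z = cauchyInt g z := by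
  refine integral_congr_ae ?_
  filter_upwards [h] with x hx
  rw [hx]

theorem CauchyIntegrable.integrable_div {f : ℝ → ℂ} (hf : CauchyIntegrable f) {z : ℂ} {δ : ℝ}
    (hδ : 0 < δ) (h : AwayFrom f z δ) : Integrable (fun x : ℝ => f x / ((x : ℂ) - z)) := by
  refine Integrable.mono' (hf.norm.const_mul (1 + ‖z + Complex.I‖ / δ)) ?_ ?_
  · refine hf.aestronglyMeasurable.mul (Measurable.aestronglyMeasurable ?_)
    fun_prop
  · filter_upwards [h] with x hx
    exact norm_div_sub_le hδ hx

theorem CauchyIntegrable.integrable_div_of_im {f : ℝ → ℂ} (hf : CauchyIntegrable f) {z : ℂ}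
    (hz : z.im ≠ 0) : Integrable (fun x : ℝ => f x / ((x : ℂ) - z)) :=
  hf.integrable_div (abs_pos.2 hz) (awayFrom_of_im f z)

theorem CauchyIntegrable.add {f g : ℝ → ℂ} (hf : CauchyIntegrable f) (hg : CauchyIntegrable g) :
    CauchyIntegrable fun x => f x + g x := by
  simpa only [CauchyIntegrable, add_div] using Integrable.fun_add hf hg

theorem CauchyIntegrable.sub {f g : ℝ → ℂ} (hf : CauchyIntegrable f) (hg : CauchyIntegrable g) :
    CauchyIntegrable fun x => f x - g x := by
  refine (Integrable.sub hf hg).congr (Eventually.of_forall fun x => ?_)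
  simp [sub_div]

theorem cauchyInt_add {f g : ℝ → ℂ} (hf : CauchyIntegrable f) (hg : CauchyIntegrable g) {z : ℂ}
    (hz : z.im ≠ 0) :
    cauchyInt (fun x => f x + g x) z = cauchyInt f z + cauchyInt g z := by
  simp only [cauchyInt, add_div]
  exact integral_add (hf.integrable_div_of_im hz) (hg.integrable_div_of_im hz)

theorem cauchyInt_sub {f g : ℝ → ℂ} (hf : CauchyIntegrable f) (hg : CauchyIntegrable g) {z : ℂ}
    (hz : z.im ≠ 0) :
    cauchyInt (fun x => f x - g x) z = cauchyInt f z - cauchyInt g z := by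
  simp only [cauchyInt, sub_div]
  exact integral_sub (hf.integrable_div_of_im hz) (hg.integrable_div_of_im hz)

theorem AwayFrom.half {f : ℝ → ℂ} {z w : ℂ} {δ : ℝ} (h : AwayFrom f z δ) (hw : ‖w - z‖ ≤ δ / 2) :
    AwayFrom f w (δ / 2) := by
  filter_upwards [h] with x hx
  refine hx.imp_right fun hx => ?_
  have : ‖(x : ℂ) - z‖ ≤ ‖(x : ℂ) - w‖ + ‖w - z‖ := norm_sub_le_norm_sub_add_norm_sub _ _ _
  linarith

/-- Differentiation under the integral sign: on the ball of radius `δ/2` about `z` the distance to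
the support stays at least `δ/2`, so one majorant serves for the whole ball. -/
theorem CauchyIntegrable.hasDerivAt {f : ℝ → ℂ} (hf : CauchyIntegrable f) {z : ℂ} {δ : ℝ}
    (hδ : 0 < δ) (h : AwayFrom f z δ) :
    HasDerivAt (cauchyInt f) (∫ x : ℝ, f x / ((x : ℂ) - z) ^ 2) z := by
  have hδ2 : 0 < δ / 2 := half_pos hδ
  have hmeas : ∀ w : ℂ, AEStronglyMeasurable (fun x : ℝ => f x / ((x : ℂ) - w)) volume := fun w =>
    hf.aestronglyMeasurable.mul (Measurable.aestronglyMeasurable (by fun_prop))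
  refine (hasDerivAt_integral_of_dominated_loc_of_deriv_le (𝕜 := ℂ)
    (F := fun w (x : ℝ) => f x / ((x : ℂ) - w)) (F' := fun w (x : ℝ) => f x / ((x : ℂ) - w) ^ 2)
    (s := Metric.closedBall z (δ / 2))
    (bound := fun x => (δ / 2)⁻¹ * ((1 + (‖z + Complex.I‖ + δ / 2) / (δ / 2))
      * ‖f x / ((x : ℂ) + Complex.I)‖))
    (Metric.closedBall_mem_nhds z hδ2) (Eventually.of_forall hmeas) (hf.integrable_div hδ h)
    ?_ ?_ ?_ ?_).2
  · exact hf.aestronglyMeasurable.mul (Measurable.aestronglyMeasurable (by fun_prop))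
  · filter_upwards [h] with x hx w hw
    rw [Metric.mem_closedBall, dist_eq_norm] at hw
    have hx' : f x = 0 ∨ δ / 2 ≤ ‖(x : ℂ) - w‖ := hx.imp_right fun hx => by
      have : ‖(x : ℂ) - z‖ ≤ ‖(x : ℂ) - w‖ + ‖w - z‖ := norm_sub_le_norm_sub_add_norm_sub _ _ _
      linarith
    have h1 := norm_div_sub_le hδ2 hx'
    have h2 : ‖w + Complex.I‖ ≤ ‖z + Complex.I‖ + δ / 2 := by
      calc ‖w + Complex.I‖ = ‖(z + Complex.I) + (w - z)‖ := by ring_nf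
        _ ≤ _ := (norm_add_le _ _).trans (by gcongr)
    have h3 : ‖f x / ((x : ℂ) - w) ^ 2‖ ≤ (δ / 2)⁻¹ * ‖f x / ((x : ℂ) - w)‖ := by
      rcases hx' with h0 | h0
      · simp [h0]
      · rw [pow_two, ← div_div, norm_div, div_eq_inv_mul]
        gcongr
    refine h3.trans ?_
    gcongr
    refine h1.trans ?_
    gcongr
  · exact (hf.norm.const_mul _).const_mul _
  · filter_upwards [h] with x hx w hw
    rw [Metric.mem_closedBall, dist_eq_norm] at hw
    rcases hx with h0 | h0
    · simpa [h0] using hasDerivAt_const w (0 : ℂ)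
    have hne : (x : ℂ) - w ≠ 0 := by
      have : ‖(x : ℂ) - z‖ ≤ ‖(x : ℂ) - w‖ + ‖w - z‖ := norm_sub_le_norm_sub_add_norm_sub _ _ _
      exact norm_pos_iff.1 (by linarith)
    have := (((hasDerivAt_id w).const_sub (x : ℂ)).fun_inv hne).const_mul (f x)
    simpa [div_eq_mul_inv] using this

theorem CauchyIntegrable.analyticAt {f : ℝ → ℂ} (hf : CauchyIntegrable f) {z : ℂ} {δ : ℝ}
    (hδ : 0 < δ) (h : AwayFrom f z δ) : AnalyticAt ℂ (cauchyInt f) z := by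
  refine DifferentiableOn.analyticAt (s := Metric.closedBall z (δ / 2)) (fun w hw => ?_)
    (Metric.closedBall_mem_nhds z (half_pos hδ))
  rw [Metric.mem_closedBall, dist_eq_norm] at hw
  exact (hf.hasDerivAt (half_pos hδ) (h.half hw)).differentiableAt.differentiableWithinAt

theorem CauchyIntegrable.analyticAt_of_im {f : ℝ → ℂ} (hf : CauchyIntegrable f) {z : ℂ}
    (hz : z.im ≠ 0) : AnalyticAt ℂ (cauchyInt f) z :=
  hf.analyticAt (abs_pos.2 hz) (awayFrom_of_im f z)

/-- Dominated convergence: `|x - yω| ≥ |x + i|` once `y ≥ 1`. This decay at infinity is what later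
fixes the constants left open by the resolvent identity. -/
theorem CauchyIntegrable.tendsto_atTop {f : ℝ → ℂ} (hf : CauchyIntegrable f) {ω : ℂ}
    (hω : ω = Complex.I ∨ ω = -Complex.I) :
    Tendsto (fun y : ℝ => cauchyInt f (y * ω)) atTop (𝓝 0) := by
  have him : ∀ y : ℝ, |((y : ℂ) * ω).im| = |y| := fun y => by
    rcases hω with rfl | rfl <;> simp
  have hre : ∀ y : ℝ, ((y : ℂ) * ω).re = 0 := fun y => by
    rcases hω with rfl | rfl <;> simp
  have h0 : (0 : ℂ) = ∫ _ : ℝ, (0 : ℂ) := by simp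
  rw [h0]
  refine tendsto_integral_filter_of_dominated_convergence
    (fun x => ‖f x / ((x : ℂ) + Complex.I)‖) (Eventually.of_forall fun y => ?_) ?_ hf.norm ?_
  · exact hf.aestronglyMeasurable.mul (Measurable.aestronglyMeasurable (by fun_prop))
  · filter_upwards [eventually_ge_atTop (1 : ℝ)] with y hy
    refine Eventually.of_forall fun x => ?_
    rw [norm_div, norm_div]
    refine div_le_div_of_nonneg_left (norm_nonneg _)
      (norm_pos_iff.2 (ofReal_add_I_ne_zero x)) ?_
    rw [← sq_le_sq₀ (norm_nonneg _) (norm_nonneg _), Complex.sq_norm, Complex.sq_norm,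
      Complex.normSq_apply, Complex.normSq_apply]
    have h1 := him y
    have h2 : ((y : ℂ) * ω).im ^ 2 = y ^ 2 := by rw [← sq_abs, h1, sq_abs]
    simp only [Complex.sub_re, Complex.sub_im, Complex.add_re, Complex.add_im, Complex.ofReal_re,
      Complex.ofReal_im, Complex.I_re, Complex.I_im, hre]
    nlinarith
  · refine Eventually.of_forall fun x => ?_
    refine squeeze_zero_norm' (a := fun y : ℝ => ‖f x‖ * y⁻¹) ?_ ?_
    · filter_upwards [eventually_gt_atTop (0 : ℝ)] with y hy
      rw [norm_div, div_eq_mul_inv]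
      gcongr
      have := abs_im_le_norm_ofReal_sub ((y : ℂ) * ω) x
      rwa [him, abs_of_pos hy] at this
    · simpa using tendsto_inv_atTop_zero.const_mul ‖f x‖

theorem integrable_inv_normSq_ofReal_add_I :
    Integrable (fun x : ℝ => ‖((x : ℂ) + Complex.I)⁻¹‖ ^ 2) := by
  refine integrable_inv_one_add_sq.congr (Eventually.of_forall fun x => ?_)
  simp only [norm_inv, inv_pow]
  rw [Complex.sq_norm, Complex.normSq_apply]
  simp only [Complex.add_re, Complex.ofReal_re, Complex.I_re, Complex.add_im, Complex.ofReal_im,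
    Complex.I_im]
  ring_nf

theorem memLp_inv_ofReal_add_I : MemLp (fun x : ℝ => ((x : ℂ) + Complex.I)⁻¹) 2 volume :=
  (memLp_two_iff_integrable_sq_norm (Measurable.aestronglyMeasurable (by fun_prop))).2
    integrable_inv_normSq_ofReal_add_I

theorem cauchyIntegrable_of_memLp {f : ℝ → ℂ} (hf : MemLp f 2 volume) : CauchyIntegrable f :=
  hf.integrable_mul memLp_inv_ofReal_add_I

theorem cauchyIntegrable_of_integrable {f : ℝ → ℂ} (hf : Integrable f) : CauchyIntegrable f := by
  refine hf.mono (hf.aestronglyMeasurable.mul (Measurable.aestronglyMeasurable (by fun_prop)))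
    (Eventually.of_forall fun x => ?_)
  rw [norm_div]
  refine div_le_self (norm_nonneg _) ?_
  simpa using Complex.abs_im_le_norm ((x : ℂ) + Complex.I)

/-! ### Products of Cauchy transforms with separated supports. -/

/-- The supports of `f` and `h` have distance at least `δ`. -/
def Apart (f h : ℝ → ℂ) (δ : ℝ) : Prop := ∀ t x : ℝ, f t ≠ 0 → h x ≠ 0 → δ ≤ |x - t|

theorem Apart.symm {f h : ℝ → ℂ} {δ : ℝ} (H : Apart f h δ) : Apart h f δ := fun t x ht hx => by
  rw [abs_sub_comm]
  exact H x t hx ht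

theorem Apart.awayFrom {f h : ℝ → ℂ} {δ t : ℝ} (H : Apart f h δ) (ht : f t ≠ 0) :
    AwayFrom h t δ :=
  Eventually.of_forall fun x => or_iff_not_imp_left.2 fun hx => by
    have := H t x ht hx
    rwa [← Complex.ofReal_sub, Complex.norm_real]

theorem Apart.integrable_prod {f h : ℝ → ℂ} {δ : ℝ} (hδ : 0 < δ) (H : Apart f h δ)
    (hf : Integrable f) (hh : Integrable h) :
    Integrable (fun p : ℝ × ℝ => f p.1 * (h p.2 / ((p.2 : ℂ) - (p.1 : ℂ))))
      (volume.prod volume) := by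
  refine Integrable.mono' ((hf.norm.mul_prod hh.norm).const_mul δ⁻¹) ?_ ?_
  · refine (hf.aestronglyMeasurable.comp_fst).mul ((hh.aestronglyMeasurable.comp_snd).mul
      (Measurable.aestronglyMeasurable (by fun_prop)))
  · refine Eventually.of_forall fun p => ?_
    by_cases h1 : f p.1 = 0
    · simp [h1]
    by_cases h2 : h p.2 = 0
    · simp [h2]
    have h3 := H p.1 p.2 h1 h2
    rw [norm_mul, norm_div, ← Complex.ofReal_sub, Complex.norm_real, Real.norm_eq_abs,
      div_eq_mul_inv]
    calc ‖f p.1‖ * (‖h p.2‖ * |p.2 - p.1|⁻¹) ≤ ‖f p.1‖ * (‖h p.2‖ * δ⁻¹) := by gcongr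
      _ = _ := by ring

theorem Apart.integrable_mul_cauchyInt {f h : ℝ → ℂ} {δ : ℝ} (hδ : 0 < δ) (H : Apart f h δ)
    (hf : Integrable f) (hh : Integrable h) :
    Integrable (fun t : ℝ => f t * cauchyInt h t) := by
  refine (H.integrable_prod hδ hf hh).integral_prod_left.congr (Eventually.of_forall fun t => ?_)
  simp only [cauchyInt, integral_const_mul]

/-- Fubini, with the sign coming from the antisymmetry of the kernel `1/(x - t)`. -/
theorem Apart.integral_mul_cauchyInt {f h : ℝ → ℂ} {δ : ℝ} (hδ : 0 < δ) (H : Apart f h δ)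
    (hf : Integrable f) (hh : Integrable h) :
    ∫ t : ℝ, f t * cauchyInt h t = -∫ x : ℝ, h x * cauchyInt f x := by
  have h1 := integral_integral_swap
    (f := fun t x : ℝ => f t * (h x / ((x : ℂ) - (t : ℂ)))) (H.integrable_prod hδ hf hh)
  simp only [integral_const_mul] at h1
  rw [show (∫ t : ℝ, f t * cauchyInt h t)
    = ∫ t : ℝ, f t * ∫ x : ℝ, h x / ((x : ℂ) - (t : ℂ)) from rfl, h1, ← integral_neg]
  congr 1
  funext x
  rw [cauchyInt, ← integral_const_mul, ← integral_neg]
  congr 1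
  funext t
  rw [← neg_sub (t : ℂ) (x : ℂ), div_neg]
  ring

theorem Apart.div {f h : ℝ → ℂ} {δ : ℝ} (H : Apart f h δ) (z : ℂ) :
    Apart f (fun x => h x / ((x : ℂ) - z)) δ := fun t x ht hx =>
  H t x ht fun h0 => hx (by simp [h0])

theorem integrable_div_of_im {h : ℝ → ℂ} (hh : Integrable h) {z : ℂ} (hz : z.im ≠ 0) :
    Integrable (fun x : ℝ => h x / ((x : ℂ) - z)) :=
  (cauchyIntegrable_of_integrable hh).integrable_div_of_im hz

/-- The product of the Cauchy transforms of functions with separated supports is again a Cauchy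
transform. -/
theorem Apart.cauchyInt_mul_cauchyInt {f h : ℝ → ℂ} {δ : ℝ} (hδ : 0 < δ) (H : Apart f h δ)
    (hf : Integrable f) (hh : Integrable h) {z : ℂ} (hz : z.im ≠ 0) :
    cauchyInt f z * cauchyInt h z =
      cauchyInt (fun t => f t * cauchyInt h t) z + cauchyInt (fun x => h x * cauchyInt f x) z := by
  have hh' := integrable_div_of_im hh hz
  -- Partial fractions: `1/((t - z)(x - z)) = (1/(t - z) - 1/(x - z)) / (x - t)`, legitimate because
  -- `x - t` stays away from zero on the supports.
  have key : ∀ t : ℝ, f t / ((t : ℂ) - z) * cauchyInt h z = f t * cauchyInt h t / ((t : ℂ) - z)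
      - f t * cauchyInt (fun x => h x / ((x : ℂ) - z)) t := fun t => by
    by_cases ht : f t = 0
    · simp [ht]
    have haway := H.awayFrom ht
    have haway' := (H.div z).awayFrom ht
    have i1 := ((cauchyIntegrable_of_integrable hh).integrable_div hδ haway).const_mul
      (f t / ((t : ℂ) - z))
    have i2 := ((cauchyIntegrable_of_integrable hh').integrable_div hδ haway').const_mul (f t)
    have e1 : f t * cauchyInt h t / ((t : ℂ) - z) = f t / ((t : ℂ) - z) * cauchyInt h t := by ring
    rw [e1, cauchyInt, cauchyInt, cauchyInt, ← integral_const_mul, ← integral_const_mul,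
      ← integral_const_mul, ← integral_sub i1 i2]
    congr 1
    funext x
    by_cases hx : h x = 0
    · simp [hx]
    have h1 : (x : ℂ) - t ≠ 0 := by
      have := H t x ht hx
      rw [← Complex.ofReal_sub]
      exact Complex.ofReal_ne_zero.2 (abs_pos.1 (hδ.trans_le this))
    have h2 := ofReal_sub_ne_zero hz x
    have h3 := ofReal_sub_ne_zero hz t
    field_simp
    ring
  have e2 : cauchyInt f z * cauchyInt h z = ∫ t : ℝ, f t / ((t : ℂ) - z) * cauchyInt h z := by
    rw [integral_mul_const, cauchyInt]
  have i3 := integrable_div_of_im (H.integrable_mul_cauchyInt hδ hf hh) hz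
  have i4 := (H.div z).integrable_mul_cauchyInt hδ hf hh'
  have e3 : cauchyInt (fun x => h x * cauchyInt f x) z
      = ∫ x : ℝ, h x / ((x : ℂ) - z) * cauchyInt f x := by
    rw [cauchyInt]
    congr 1
    funext x
    ring
  rw [e2, e3]
  simp only [key]
  rw [integral_sub i3 i4, (H.div z).integral_mul_cauchyInt hδ hf hh', sub_neg_eq_add]
  rfl

/-! ### The Poisson kernel and uniqueness for Cauchy transforms. -/

/-- The Poisson kernel of the half plane at height `c⁻¹`. -/
noncomputable def poissonKernel (c t : ℝ) : ℝ := c * (Real.pi⁻¹ * (1 + (c * t) ^ 2)⁻¹)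

theorem poissonKernel_nonneg {c : ℝ} (hc : 0 < c) (t : ℝ) : 0 ≤ poissonKernel c t := by
  unfold poissonKernel
  positivity

theorem poissonKernel_le {c : ℝ} (hc : 0 < c) (t : ℝ) : poissonKernel c t ≤ c := by
  unfold poissonKernel
  have h1 : Real.pi⁻¹ ≤ 1 := inv_le_one_of_one_le₀ (by linarith [Real.pi_gt_three])
  have h2 : (1 + (c * t) ^ 2)⁻¹ ≤ 1 := inv_le_one_of_one_le₀ (by nlinarith [sq_nonneg (c * t)])
  have h3 : Real.pi⁻¹ * (1 + (c * t) ^ 2)⁻¹ ≤ 1 := mul_le_one₀ h1 (by positivity) h2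
  nlinarith

/-- From `2c|t| ≤ 1 + (ct)²`. The bound is uniform in `c` and absorbs the weight `|x + i|`, which is
needed because `f` itself need not be integrable. -/
theorem abs_mul_poissonKernel_le {c : ℝ} (hc : 0 < c) (t : ℝ) : |t| * poissonKernel c t ≤ 1 := by
  unfold poissonKernel
  have h1 : Real.pi⁻¹ ≤ 1 := inv_le_one_of_one_le₀ (by linarith [Real.pi_gt_three])
  have h2 : c * |t| * (1 + (c * t) ^ 2)⁻¹ ≤ 1 := by
    rw [← div_eq_mul_inv, div_le_one (by positivity), ← sq_abs (c * t), abs_mul, abs_of_pos hc]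
    nlinarith [sq_nonneg (c * |t| - 1)]
  calc |t| * (c * (Real.pi⁻¹ * (1 + (c * t) ^ 2)⁻¹))
      = Real.pi⁻¹ * (c * |t| * (1 + (c * t) ^ 2)⁻¹) := by ring
    _ ≤ 1 * 1 := by gcongr
    _ = 1 := one_mul 1

theorem integral_inv_pi_mul : ∫ t : ℝ, Real.pi⁻¹ * (1 + t ^ 2)⁻¹ = 1 := by
  rw [integral_const_mul, integral_univ_inv_one_add_sq, inv_mul_cancel₀ Real.pi_ne_zero]

theorem integrable_poissonKernel {c : ℝ} (hc : 0 < c) (x : ℝ) :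
    Integrable fun k => poissonKernel c (k - x) := by
  have h := (integrable_inv_one_add_sq.const_mul Real.pi⁻¹).comp_mul_left' hc.ne'
  exact (h.const_mul c).comp_sub_right x

theorem integral_poissonKernel {c : ℝ} (hc : 0 < c) (x : ℝ) :
    ∫ k, poissonKernel c (k - x) = 1 := by
  rw [integral_sub_right_eq_self (fun k => poissonKernel c k)]
  unfold poissonKernel
  rw [integral_const_mul,
    Measure.integral_comp_mul_left (fun t : ℝ => Real.pi⁻¹ * (1 + t ^ 2)⁻¹), integral_inv_pi_mul,
    abs_of_pos (inv_pos.2 hc), smul_eq_mul, mul_one, mul_inv_cancel₀ hc.ne']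

theorem continuous_poissonKernel (c : ℝ) : Continuous (poissonKernel c) := by
  unfold poissonKernel
  refine continuous_const.mul (continuous_const.mul (Continuous.inv₀ (by fun_prop) fun t => ?_))
  positivity

/-- The kernels form an approximate identity as `c → ∞`; the decay `o(1/|t|)` of the profile is what
the peak-function theorem asks for. -/
theorem tendsto_integral_poissonKernel {g : ℝ → ℝ} (hg : Continuous g) (hgi : Integrable g)
    (x : ℝ) :
    Tendsto (fun c : ℝ => ∫ k, poissonKernel c (k - x) * g k) atTop (𝓝 (g x)) := by
  have hdecay : Tendsto (fun t : ℝ => ‖t‖ ^ Module.finrank ℝ ℝ * (Real.pi⁻¹ * (1 + t ^ 2)⁻¹))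
      (Bornology.cobounded ℝ) (𝓝 0) := by
    have h : Tendsto (fun t : ℝ => ‖t‖⁻¹) (Bornology.cobounded ℝ) (𝓝 0) :=
      tendsto_inv_atTop_zero.comp tendsto_norm_cobounded_atTop
    refine squeeze_zero (fun t => by positivity) (fun t => ?_) h
    rw [Module.finrank_self, pow_one]
    have h1 : Real.pi⁻¹ ≤ 1 := inv_le_one_of_one_le₀ (by linarith [Real.pi_gt_three])
    rcases eq_or_ne t 0 with rfl | ht
    · simp
    have ht' : 0 < ‖t‖ := norm_pos_iff.2 ht
    have h2 : ‖t‖ * (1 + t ^ 2)⁻¹ ≤ ‖t‖⁻¹ := by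
      rw [← div_eq_mul_inv, inv_eq_one_div, div_le_div_iff₀ (by positivity) ht',
        Real.norm_eq_abs, abs_mul_abs_self]
      nlinarith
    calc ‖t‖ * (Real.pi⁻¹ * (1 + t ^ 2)⁻¹) = Real.pi⁻¹ * (‖t‖ * (1 + t ^ 2)⁻¹) := by ring
      _ ≤ 1 * ‖t‖⁻¹ := by gcongr
      _ = ‖t‖⁻¹ := one_mul _
  have h := tendsto_integral_comp_smul_smul_of_integrable (μ := (volume : Measure ℝ))
    (φ := fun t : ℝ => Real.pi⁻¹ * (1 + t ^ 2)⁻¹) (fun t => by positivity) integral_inv_pi_mul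
    hdecay (g := fun t => g (t + x)) (hgi.comp_add_right x) (by fun_prop)
  simp only [zero_add, Module.finrank_self, pow_one, smul_eq_mul] at h
  refine h.congr fun c => ?_
  rw [← integral_add_right_eq_self (fun k => poissonKernel c (k - x) * g k) x]
  simp [poissonKernel]

/-- The Poisson kernel is `1/(2πi)` times the difference of the Cauchy kernels with poles `k ± i/c`,
since the product of their denominators is `(k - x)² + c⁻²`. -/
theorem integral_mul_poissonKernel {f : ℝ → ℂ} (hf : CauchyIntegrable f)
    (h : ∀ z : ℂ, z.im ≠ 0 → cauchyInt f z = 0) {c : ℝ} (hc : 0 < c) (k : ℝ) :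
    ∫ x, f x * (poissonKernel c (k - x) : ℂ) = 0 := by
  have him : ((k : ℂ) + (c⁻¹ : ℝ) * Complex.I).im ≠ 0 := by simp [hc.ne']
  have him' : ((k : ℂ) - (c⁻¹ : ℝ) * Complex.I).im ≠ 0 := by simp [hc.ne']
  have h1 : ∀ x : ℝ, f x * (poissonKernel c (k - x) : ℂ) = (2 * Real.pi * Complex.I)⁻¹ *
      (f x / ((x : ℂ) - (k + (c⁻¹ : ℝ) * Complex.I))
        - f x / ((x : ℂ) - (k - (c⁻¹ : ℝ) * Complex.I))) := fun x => by
    have n1 := ofReal_sub_ne_zero him x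
    have n2 := ofReal_sub_ne_zero him' x
    have hc' : (c : ℂ) ≠ 0 := Complex.ofReal_ne_zero.2 hc.ne'
    have hpi : (Real.pi : ℂ) ≠ 0 := Complex.ofReal_ne_zero.2 Real.pi_ne_zero
    have n3 : (1 : ℂ) + (c * (k - x)) ^ 2 ≠ 0 := by
      have : (1 : ℝ) + (c * (k - x)) ^ 2 ≠ 0 := by positivity
      exact_mod_cast this
    have n4 : ((x : ℂ) - (k + (c⁻¹ : ℝ) * Complex.I)) * ((x : ℂ) - (k - (c⁻¹ : ℝ) * Complex.I))
        = (1 + (c * (k - x)) ^ 2) / c ^ 2 := by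
      push_cast
      field_simp
      linear_combination (-1 : ℂ) * Complex.I_sq
    rw [div_sub_div _ _ n1 n2, n4]
    simp only [poissonKernel]
    push_cast
    field_simp
    ring
  simp only [h1]
  rw [integral_const_mul, integral_sub (hf.integrable_div_of_im him)
    (hf.integrable_div_of_im him')]
  have e1 := h _ him
  have e2 := h _ him'
  rw [cauchyInt] at e1 e2
  rw [e1, e2]
  simp

theorem CauchyIntegrable.locallyIntegrable {f : ℝ → ℂ} (hf : CauchyIntegrable f) :
    LocallyIntegrable f := by
  have h := LocallyIntegrableOn.continuousOn_mul (s := Set.univ)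
    (f := fun x : ℝ => f x / ((x : ℂ) + Complex.I)) (g := fun x : ℝ => (x : ℂ) + Complex.I)
    (locallyIntegrableOn_univ.2 (Integrable.locallyIntegrable hf)) (by fun_prop)
    isOpen_univ.isLocallyClosed
  rw [locallyIntegrableOn_univ] at h
  refine h.congr (Eventually.of_forall fun x => ?_)
  exact mul_div_cancel₀ _ (ofReal_add_I_ne_zero x)

/-- A function is determined by its Cauchy transform off the real line. -/
theorem CauchyIntegrable.ae_eq_zero {f : ℝ → ℂ} (hf : CauchyIntegrable f)
    (h : ∀ z : ℂ, z.im ≠ 0 → cauchyInt f z = 0) : f =ᵐ[volume] 0 := by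
  -- For a test function `g`, Fubini gives `∫ f (P_c * g) = 0` for every `c > 0`, and `P_c * g → g`
  -- pointwise. What remains is to justify the interchange and the limit with the weight `|x + i|`.
  refine ae_eq_zero_of_integral_contDiff_smul_eq_zero hf.locallyIntegrable fun g hg hgc => ?_
  have hgcont : Continuous g := hg.continuous
  have hgi : Integrable g := hgcont.integrable_of_hasCompactSupport hgc
  obtain ⟨M, hM⟩ := hgc.exists_bound_of_continuous hgcont
  obtain ⟨r, hr⟩ : ∃ r : ℝ, ∀ k, g k ≠ 0 → |k| ≤ r := by
    obtain ⟨r, hr⟩ := hgc.isCompact.isBounded.exists_norm_le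
    exact ⟨r, fun k hk => hr k (subset_tsupport _ hk)⟩
  have hM0 : 0 ≤ M := (norm_nonneg _).trans (hM 0)
  have hadd : ∀ x k : ℝ, g k ≠ 0 → ‖(x : ℂ) + Complex.I‖ ≤ |k - x| + (r + 1) := fun x k hk => by
    calc ‖(x : ℂ) + Complex.I‖ = ‖((x - k : ℝ) : ℂ) + ((k : ℂ) + Complex.I)‖ := by
          push_cast; ring_nf
      _ ≤ |x - k| + (|k| + 1) := (norm_add_le _ _).trans (by
          rw [Complex.norm_real, Real.norm_eq_abs]
          gcongr
          refine (norm_add_le _ _).trans ?_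
          simp)
      _ ≤ _ := by rw [abs_sub_comm]; gcongr; exact hr k hk
  -- On the support of `g` one has `|x + i| ≤ |k - x| + r + 1`. The integral in `k` of the right
  -- side does not depend on `c`, which gives the majorant for the limit.
  have hbound : ∀ c : ℝ, 0 < c → ∀ x k : ℝ, ‖(x : ℂ) + Complex.I‖ * |poissonKernel c (k - x) * g k|
      ≤ |g k| + (|r + 1| * M) * poissonKernel c (k - x) := fun c hc x k => by
    have hp := poissonKernel_nonneg hc (k - x)
    by_cases hk : g k = 0
    · rw [hk]; simp only [mul_zero, abs_zero]; positivity
    rw [abs_mul, abs_of_nonneg hp]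
    calc ‖(x : ℂ) + Complex.I‖ * (poissonKernel c (k - x) * |g k|)
        ≤ (|k - x| + |r + 1|) * (poissonKernel c (k - x) * |g k|) := by
          gcongr
          exact (hadd x k hk).trans (by gcongr; exact le_abs_self _)
      _ = (|k - x| * poissonKernel c (k - x)) * |g k|
          + |r + 1| * |g k| * poissonKernel c (k - x) := by ring
      _ ≤ 1 * |g k| + |r + 1| * M * poissonKernel c (k - x) := by
          gcongr
          · exact abs_mul_poissonKernel_le hc _
          · exact hM k
      _ = _ := by rw [one_mul]
  have hprod : ∀ c : ℝ, 0 < c → Integrable (fun p : ℝ × ℝ =>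
      f p.1 * ((poissonKernel c (p.2 - p.1) * g p.2 : ℝ) : ℂ)) (volume.prod volume) := fun c hc => by
    refine Integrable.mono' (g := fun p : ℝ × ℝ => (1 + |r + 1| * c) *
      (‖f p.1 / ((p.1 : ℂ) + Complex.I)‖ * ‖g p.2‖)) ?_ ?_ ?_
    · exact ((Integrable.norm hf).mul_prod hgi.norm).const_mul _
    · refine hf.aestronglyMeasurable.comp_fst.mul (Continuous.aestronglyMeasurable ?_)
      have := continuous_poissonKernel c
      fun_prop
    · refine Eventually.of_forall fun p => ?_
      have hp := poissonKernel_nonneg hc (p.2 - p.1)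
      have hI : 0 < ‖(p.1 : ℂ) + Complex.I‖ := norm_pos_iff.2 (ofReal_add_I_ne_zero p.1)
      by_cases hk : g p.2 = 0
      · simp [hk]
      rw [norm_mul, Complex.norm_real, Real.norm_eq_abs, Real.norm_eq_abs, abs_mul,
        abs_of_nonneg hp, norm_div]
      have : ‖(p.1 : ℂ) + Complex.I‖ * poissonKernel c (p.2 - p.1) ≤ 1 + |r + 1| * c := by
        calc ‖(p.1 : ℂ) + Complex.I‖ * poissonKernel c (p.2 - p.1)
            ≤ (|p.2 - p.1| + |r + 1|) * poissonKernel c (p.2 - p.1) := by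
              gcongr
              exact (hadd _ _ hk).trans (by gcongr; exact le_abs_self _)
          _ = |p.2 - p.1| * poissonKernel c (p.2 - p.1)
              + |r + 1| * poissonKernel c (p.2 - p.1) := by ring
          _ ≤ _ := by
              gcongr
              · exact abs_mul_poissonKernel_le hc _
              · exact poissonKernel_le hc _
      calc ‖f p.1‖ * (poissonKernel c (p.2 - p.1) * |g p.2|)
          = (‖(p.1 : ℂ) + Complex.I‖ * poissonKernel c (p.2 - p.1))
            * (‖f p.1‖ / ‖(p.1 : ℂ) + Complex.I‖ * |g p.2|) := by field_simp
        _ ≤ _ := by gcongr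
  have hzero : ∀ c : ℝ, 0 < c →
      ∫ x, f x * ((∫ k, poissonKernel c (k - x) * g k : ℝ) : ℂ) = 0 := fun c hc => by
    have h1 := integral_integral_swap
      (f := fun x k : ℝ => f x * ((poissonKernel c (k - x) * g k : ℝ) : ℂ)) (hprod c hc)
    have h2 : ∀ x : ℝ, ∫ k, f x * ((poissonKernel c (k - x) * g k : ℝ) : ℂ)
        = f x * ((∫ k, poissonKernel c (k - x) * g k : ℝ) : ℂ) := fun x => by
      rw [integral_const_mul, integral_complex_ofReal]
    have h3 : ∀ k : ℝ, ∫ x, f x * ((poissonKernel c (k - x) * g k : ℝ) : ℂ) = 0 := fun k => by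
      have : ∀ x, f x * ((poissonKernel c (k - x) * g k : ℝ) : ℂ)
          = f x * (poissonKernel c (k - x) : ℂ) * (g k : ℂ) := fun x => by push_cast; ring
      simp only [this]
      rw [integral_mul_const, integral_mul_poissonKernel hf h hc k, zero_mul]
    simp only [h2, h3, integral_zero] at h1
    exact h1
  have hlim : Tendsto (fun c : ℝ => ∫ x, f x * ((∫ k, poissonKernel c (k - x) * g k : ℝ) : ℂ)) atTop
      (𝓝 (∫ x, f x * (g x : ℂ))) := by
    refine tendsto_integral_filter_of_dominated_convergence
      (fun x => ‖f x / ((x : ℂ) + Complex.I)‖ * ((∫ k, |g k|) + |r + 1| * M)) ?_ ?_ ?_ ?_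
    · filter_upwards [eventually_gt_atTop (0 : ℝ)] with c hc
      refine (hprod c hc).integral_prod_left.aestronglyMeasurable.congr
        (Eventually.of_forall fun x => ?_)
      simp only [integral_const_mul, integral_complex_ofReal]
    · filter_upwards [eventually_gt_atTop (0 : ℝ)] with c hc
      refine Eventually.of_forall fun x => ?_
      have hI : 0 < ‖(x : ℂ) + Complex.I‖ := norm_pos_iff.2 (ofReal_add_I_ne_zero x)
      have h1 : ‖(x : ℂ) + Complex.I‖ * |∫ k, poissonKernel c (k - x) * g k|
          ≤ (∫ k, |g k|) + |r + 1| * M := by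
        calc ‖(x : ℂ) + Complex.I‖ * |∫ k, poissonKernel c (k - x) * g k|
            ≤ ‖(x : ℂ) + Complex.I‖ * ∫ k, |poissonKernel c (k - x) * g k| := by
              gcongr
              exact abs_integral_le_integral_abs
          _ = ∫ k, ‖(x : ℂ) + Complex.I‖ * |poissonKernel c (k - x) * g k| :=
              (integral_const_mul _ _).symm
          _ ≤ ∫ k, (|g k| + (|r + 1| * M) * poissonKernel c (k - x)) := by
              refine integral_mono_of_nonneg (Eventually.of_forall fun k => by positivity)
                (hgi.abs.add ((integrable_poissonKernel hc x).const_mul _))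
                (Eventually.of_forall fun k => hbound c hc x k)
          _ = _ := by
              rw [integral_add hgi.abs ((integrable_poissonKernel hc x).const_mul _),
                integral_const_mul, integral_poissonKernel hc, mul_one]
      rw [norm_mul, Complex.norm_real, Real.norm_eq_abs, norm_div]
      calc ‖f x‖ * |∫ k, poissonKernel c (k - x) * g k|
          = ‖f x‖ / ‖(x : ℂ) + Complex.I‖
            * (‖(x : ℂ) + Complex.I‖ * |∫ k, poissonKernel c (k - x) * g k|) := by field_simp
        _ ≤ _ := by gcongr
    · exact (Integrable.norm hf).mul_const _
    · refine Eventually.of_forall fun x => ?_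
      exact ((Complex.continuous_ofReal.tendsto _).comp
        (tendsto_integral_poissonKernel hgcont hgi x)).const_mul _
  have h0 : ∫ x, f x * (g x : ℂ) = 0 := by
    refine tendsto_nhds_unique hlim (tendsto_const_nhds.congr' ?_)
    filter_upwards [eventually_gt_atTop (0 : ℝ)] with c hc
    exact (hzero c hc).symm
  rw [← h0]
  congr 1
  funext x
  rw [Complex.real_smul, mul_comm]

-- The multiplication operator by `1/(x - z)`, the vector `1/(x - z)`, and their traces.

local notation "conj" => starRingEnd ℂ

theorem inner_eq_integral (v f : L2) : inner ℂ v f = ∫ x : ℝ, conj (v x) * f x := by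
  rw [L2.inner_def]
  simp only [RCLike.inner_apply, mul_comm]

theorem integrable_conj_mul (v f : L2) : Integrable (fun x : ℝ => conj (v x) * f x) := by
  have h := L2.integrable_inner (𝕜 := ℂ) v f
  simpa only [RCLike.inner_apply, mul_comm] using h

theorem memLp_div_sub {f : ℝ → ℂ} (hf : MemLp f 2 volume) {z : ℂ} (hz : z.im ≠ 0) :
    MemLp (fun x : ℝ => f x / ((x : ℂ) - z)) 2 volume := by
  refine hf.of_le_mul (c := |z.im|⁻¹)
    (hf.aestronglyMeasurable.mul (Measurable.aestronglyMeasurable (by fun_prop)))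
    (Eventually.of_forall fun x => ?_)
  rw [norm_div, div_eq_inv_mul]
  gcongr
  exact abs_im_le_norm_ofReal_sub z x

/-- Multiplication by `(x - z)⁻¹`. -/
noncomputable def cauchyOp (z : ℂ) (hz : z.im ≠ 0) : L2 →L[ℂ] L2 :=
  LinearMap.mkContinuous
    { toFun := fun f => (memLp_div_sub (Lp.memLp f) hz).toLp _
      map_add' := fun f g => by
        rw [← MemLp.toLp_add]
        refine MemLp.toLp_congr _ _ ?_
        filter_upwards [Lp.coeFn_add f g] with x hx
        simp only [hx, Pi.add_apply]
        ring
      map_smul' := fun c f => by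
        rw [RingHom.id_apply, ← MemLp.toLp_const_smul]
        refine MemLp.toLp_congr _ _ ?_
        filter_upwards [Lp.coeFn_smul c f] with x hx
        simp only [hx, Pi.smul_apply, smul_eq_mul]
        ring }
    |z.im|⁻¹ fun f => by
      refine Lp.norm_le_mul_norm_of_ae_le_mul ?_
      filter_upwards [(memLp_div_sub (Lp.memLp f) hz).coeFn_toLp] with x hx
      simp only [LinearMap.coe_mk, AddHom.coe_mk, hx]
      rw [norm_div, div_eq_inv_mul]
      gcongr
      exact abs_im_le_norm_ofReal_sub z x

theorem cauchyOp_coe {z : ℂ} (hz : z.im ≠ 0) (f : L2) :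
    cauchyOp z hz f =ᵐ[volume] fun x : ℝ => f x / ((x : ℂ) - z) :=
  (memLp_div_sub (Lp.memLp f) hz).coeFn_toLp

theorem memLp_inv_sub {z : ℂ} (hz : z.im ≠ 0) :
    MemLp (fun x : ℝ => ((x : ℂ) - z)⁻¹) 2 volume := by
  refine memLp_inv_ofReal_add_I.of_le_mul (c := 1 + ‖z + Complex.I‖ / |z.im|)
    (Measurable.aestronglyMeasurable (by fun_prop)) (Eventually.of_forall fun x => ?_)
  simpa only [one_div] using norm_div_sub_le (f := fun _ => 1) (abs_pos.2 hz)
    (Or.inr (abs_im_le_norm_ofReal_sub z x))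

/-- The function `(x - z)⁻¹` as an element of `L²`. -/
noncomputable def cauchyVec (z : ℂ) (hz : z.im ≠ 0) : L2 := (memLp_inv_sub hz).toLp _

theorem cauchyVec_coe {z : ℂ} (hz : z.im ≠ 0) :
    cauchyVec z hz =ᵐ[volume] fun x : ℝ => ((x : ℂ) - z)⁻¹ :=
  (memLp_inv_sub hz).coeFn_toLp

theorem cauchyIntegrable_coe (f : L2) : CauchyIntegrable f :=
  cauchyIntegrable_of_memLp (Lp.memLp f)

theorem cauchyIntegrable_conj (f : L2) : CauchyIntegrable fun x => conj (f x) :=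
  cauchyIntegrable_of_memLp (Lp.memLp f).star

theorem inner_cauchyVec {z : ℂ} (hz : z.im ≠ 0) (v : L2) :
    inner ℂ v (cauchyVec z hz) = cauchyInt (fun x => conj (v x)) z := by
  rw [inner_eq_integral]
  refine integral_congr_ae ?_
  filter_upwards [cauchyVec_coe hz] with x hx
  rw [hx, div_eq_mul_inv]

theorem inner_cauchyOp {z : ℂ} (hz : z.im ≠ 0) (v f : L2) :
    inner ℂ v (cauchyOp z hz f) = cauchyInt (fun x => conj (v x) * f x) z := by
  rw [inner_eq_integral]
  refine integral_congr_ae ?_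
  filter_upwards [cauchyOp_coe hz f] with x hx
  rw [hx, mul_div_assoc]

theorem conj_im_ne_zero {z : ℂ} (hz : z.im ≠ 0) : (conj z).im ≠ 0 := by simpa using hz

theorem inner_cauchyOp_left {z : ℂ} (hz : z.im ≠ 0) (v f : L2) :
    inner ℂ (cauchyOp (conj z) (conj_im_ne_zero hz) v) f = inner ℂ v (cauchyOp z hz f) := by
  rw [inner_cauchyOp, inner_eq_integral]
  refine integral_congr_ae ?_
  filter_upwards [cauchyOp_coe (conj_im_ne_zero hz) v] with x hx
  rw [hx]
  simp
  ring

theorem inner_cauchyVec_left {z : ℂ} (hz : z.im ≠ 0) (f : L2) :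
    inner ℂ (cauchyVec (conj z) (conj_im_ne_zero hz)) f = cauchyInt f z := by
  rw [inner_eq_integral]
  refine integral_congr_ae ?_
  filter_upwards [cauchyVec_coe (conj_im_ne_zero hz)] with x hx
  rw [hx]
  simp [div_eq_inv_mul]

theorem hasTrace₁_cauchyOp {z : ℂ} (hz : z.im ≠ 0) (f : L2) :
    HasTrace₁ (cauchyOp z hz f) (cauchyInt f z) := by
  have h1 : cauchyInt f z = ∫ x, cauchyOp z hz f x :=
    integral_congr_ae ((cauchyOp_coe hz f).mono fun x hx => hx.symm)
  rw [h1]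
  exact intervalIntegral_tendsto_integral
    (((cauchyIntegrable_coe f).integrable_div_of_im hz).congr
      ((cauchyOp_coe hz f).mono fun x hx => hx.symm)) tendsto_neg_atTop_atBot tendsto_id

theorem mul_cauchyOp_ae {z : ℂ} (hz : z.im ≠ 0) (f : L2) :
    ∀ᵐ x : ℝ, (x : ℂ) * cauchyOp z hz f x = f x + z * cauchyOp z hz f x := by
  filter_upwards [cauchyOp_coe hz f] with x hx
  have := ofReal_sub_ne_zero hz x
  rw [hx]
  field_simp
  ring

theorem hasTrace₂_cauchyOp {z : ℂ} (hz : z.im ≠ 0) (f : L2) : HasTrace₂ (cauchyOp z hz f) 0 := by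
  refine (MemLp.add (Lp.memLp f) ((Lp.memLp (cauchyOp z hz f)).const_mul z)).ae_eq ?_
  filter_upwards [mul_cauchyOp_ae hz f] with x hx
  simp [hx]

theorem hasTrace₂_cauchyVec {z : ℂ} (hz : z.im ≠ 0) : HasTrace₂ (cauchyVec z hz) 1 := by
  refine ((Lp.memLp (cauchyVec z hz)).const_mul z).ae_eq ?_
  filter_upwards [cauchyVec_coe hz] with x hx
  have := ofReal_sub_ne_zero hz x
  rw [hx]
  field_simp
  ring

theorem eq_zero_of_memLp_const {c : ℂ} (h : MemLp (fun _ : ℝ => c) 2 volume) : c = 0 := by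
  rcases (memLp_const_iff (by norm_num) (by norm_num)).1 h with h | h
  · exact h
  · simp at h

theorem HasTrace₂.unique {u : L2} {c d : ℂ} (hc : HasTrace₂ u c) (hd : HasTrace₂ u d) : c = d := by
  have h : MemLp (fun _ : ℝ => c - d) 2 volume := by
    refine (MemLp.sub hd hc).ae_eq (Eventually.of_forall fun x => ?_)
    simp
  exact sub_eq_zero.1 (eq_zero_of_memLp_const h)

theorem HasTrace₁.unique {u : L2} {l m : ℂ} (hl : HasTrace₁ u l) (hm : HasTrace₁ u m) : l = m :=
  tendsto_nhds_unique hl hm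

theorem HasTrace₂.congr {u : L2} {c d : ℂ} (h : HasTrace₂ u c) (hcd : c = d) : HasTrace₂ u d :=
  hcd ▸ h

theorem HasTrace₁.congr {u : L2} {c d : ℂ} (h : HasTrace₁ u c) (hcd : c = d) : HasTrace₁ u d :=
  hcd ▸ h

/-! ### Adjoints: the graph of the maximal operator. -/

theorem I_im_ne_zero : (Complex.I).im ≠ 0 := by simp

/-- Take `g = (x - i) f`: the condition `Γ₁ f = 0` becomes `ĝ(i) = 0`, that is, orthogonality of `g`
to `1/(x + i)`. The domain is thus the image of a closed hyperplane under a bounded operator. -/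
theorem mem_minimalDomain_iff {f : L2} : f ∈ minimalDomain ↔
    ∃ g : L2, cauchyInt g Complex.I = 0 ∧ f = cauchyOp Complex.I I_im_ne_zero g := by
  constructor
  · intro hf
    have hmem : MemLp (fun x : ℝ => (x : ℂ) * f x - Complex.I * f x) 2 volume :=
      MemLp.sub (memLp_mul hf) ((Lp.memLp f).const_mul Complex.I)
    have hfg : f = cauchyOp Complex.I I_im_ne_zero (hmem.toLp _) := by
      refine Lp.ext ?_
      filter_upwards [cauchyOp_coe I_im_ne_zero (hmem.toLp _), hmem.coeFn_toLp] with x h1 h2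
      rw [h1, h2, ← sub_mul, mul_div_cancel_left₀ _ (ofReal_sub_ne_zero I_im_ne_zero x)]
    refine ⟨hmem.toLp _, ?_, hfg⟩
    have h := hasTrace₁_cauchyOp I_im_ne_zero (hmem.toLp _)
    rw [← hfg] at h
    exact h.unique hf.2
  · rintro ⟨g, hg, rfl⟩
    refine ⟨hasTrace₂_cauchyOp _ g, ?_⟩
    have h := hasTrace₁_cauchyOp I_im_ne_zero g
    rwa [hg] at h

/-- The double orthogonal complement of a line is the line. This is the source of the constant `Γ₂
u` in the adjoint. -/
theorem exists_smul_eq_of_inner {r q : L2} (h : ∀ g, inner ℂ r g = 0 → inner ℂ q g = 0) :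
    ∃ c : ℂ, c • r = q := by
  rw [← Submodule.mem_span_singleton, ← Submodule.orthogonal_orthogonal (Submodule.span ℂ {r}),
    Submodule.mem_orthogonal]
  intro g hg
  rw [Submodule.mem_orthogonal_singleton_iff_inner_right] at hg
  rw [← inner_conj_symm, h g hg, map_zero]

/-- If `v` is orthogonal to the domain, then `v/(x + i)` is a multiple of `1/(x + i)`; so `v` is
constant, and a constant in `L²(ℝ)` is zero. -/
theorem dense_minimalDomain : Dense (minimalDomain : Set L2) := by
  rw [Submodule.dense_iff_topologicalClosure_eq_top, Submodule.topologicalClosure_eq_top_iff,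
    eq_bot_iff]
  intro v hv
  rw [Submodule.mem_orthogonal'] at hv
  obtain ⟨c, hc⟩ := exists_smul_eq_of_inner
    (r := cauchyVec (conj Complex.I) (conj_im_ne_zero I_im_ne_zero))
    (q := cauchyOp (conj Complex.I) (conj_im_ne_zero I_im_ne_zero) v) (fun g hg => by
      rw [inner_cauchyVec_left I_im_ne_zero] at hg
      rw [inner_cauchyOp_left I_im_ne_zero]
      exact hv _ (mem_minimalDomain_iff.2 ⟨g, hg, rfl⟩))
  have hvc : v =ᵐ[volume] fun _ => c := by
    have h1 := Lp.coeFn_smul c (cauchyVec (conj Complex.I) (conj_im_ne_zero I_im_ne_zero))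
    rw [hc] at h1
    filter_upwards [h1, cauchyVec_coe (conj_im_ne_zero I_im_ne_zero),
      cauchyOp_coe (conj_im_ne_zero I_im_ne_zero) v] with x e1 e2 e3
    have := ofReal_sub_ne_zero (conj_im_ne_zero I_im_ne_zero) x
    rw [e3, Pi.smul_apply, e2, smul_eq_mul, ← div_eq_mul_inv, div_left_inj' this] at e1
    exact e1
  have hc0 : c = 0 := eq_zero_of_memLp_const ((Lp.memLp v).ae_eq hvc)
  rw [Submodule.mem_bot]
  refine Lp.ext ?_
  filter_upwards [hvc, Lp.coeFn_zero ℂ 2 (volume : Measure ℝ)] with x h1 h2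
  rw [h1, h2, hc0, Pi.zero_apply]

theorem friedrichs_cauchyOp (φ ψ g : L2)
    (h : cauchyOp Complex.I I_im_ne_zero g ∈ (friedrichs ψ φ).domain) :
    friedrichs ψ φ ⟨cauchyOp Complex.I I_im_ne_zero g, h⟩
      = g + Complex.I • cauchyOp Complex.I I_im_ne_zero g
        + inner ℂ ψ (cauchyOp Complex.I I_im_ne_zero g) • φ := by
  change (memLp_mul h).toLp _ + _ = _
  congr 1
  refine Lp.ext ?_
  filter_upwards [(memLp_mul h).coeFn_toLp, mul_cauchyOp_ae I_im_ne_zero g,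
    Lp.coeFn_add g (Complex.I • cauchyOp Complex.I I_im_ne_zero g),
    Lp.coeFn_smul Complex.I (cauchyOp Complex.I I_im_ne_zero g)] with x h1 h2 h3 h4
  rw [h1, h2, h3, Pi.add_apply, h4, Pi.smul_apply, smul_eq_mul]

/-- The graph of the maximal operator: `u` has a trace `c = Γ₂ u` and
`w = x u - c + ⟨u, φ⟩ ψ`. -/
def MaxGraph (φ ψ u w : L2) (c : ℂ) : Prop :=
  HasTrace₂ u c ∧ w =ᵐ[volume] fun x : ℝ => (x : ℂ) * u x - c + inner ℂ φ u * ψ x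

/-- Testing the adjoint identity on `f = g/(x - i)` with `ĝ(i) = 0` says that `q = (w - xu - ⟨u,
φ⟩ψ)/(x + i)` is orthogonal to each such `g`, hence is a multiple of `1/(x + i)`. That multiple is
`-Γ₂ u`. -/
theorem maximalOp_graph_iff {φ ψ u w : L2} :
    (∃ h : u ∈ (maximalOp φ ψ).domain, maximalOp φ ψ ⟨u, h⟩ = w) ↔ ∃ c, MaxGraph φ ψ u w c := by
  have hdense : Dense ((friedrichs ψ φ).domain : Set L2) := dense_minimalDomain
  have hI := conj_im_ne_zero I_im_ne_zero
  have hadj : (∃ h : u ∈ (maximalOp φ ψ).domain, maximalOp φ ψ ⟨u, h⟩ = w) ↔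
      ∀ f : (friedrichs ψ φ).domain, inner ℂ w (f : L2) = inner ℂ u (friedrichs ψ φ f) := by
    constructor
    · rintro ⟨h, rfl⟩ f
      exact LinearPMap.adjoint_isFormalAdjoint hdense ⟨u, h⟩ f
    · intro hf
      have h := LinearPMap.mem_adjoint_domain_of_exists (T := friedrichs ψ φ) u ⟨w, hf⟩
      exact ⟨h, LinearPMap.adjoint_apply_eq hdense ⟨u, h⟩ hf⟩
  rw [hadj]
  set q : L2 := cauchyOp _ hI w - u + Complex.I • cauchyOp _ hI u
    - inner ℂ φ u • cauchyOp _ hI ψ with hq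
  have hqg : ∀ g : L2, inner ℂ q g = inner ℂ w (cauchyOp Complex.I I_im_ne_zero g)
      - inner ℂ u (g + Complex.I • cauchyOp Complex.I I_im_ne_zero g
        + inner ℂ ψ (cauchyOp Complex.I I_im_ne_zero g) • φ) := fun g => by
    rw [hq, inner_sub_left, inner_add_left, inner_sub_left, inner_smul_left, inner_smul_left,
      inner_cauchyOp_left I_im_ne_zero, inner_cauchyOp_left I_im_ne_zero, inner_cauchyOp_left I_im_ne_zero, inner_add_right,
      inner_add_right, inner_smul_right, inner_smul_right, inner_conj_symm, Complex.conj_I]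
    ring
  have hcoe : q =ᵐ[volume] fun x : ℝ =>
      (w x - (x : ℂ) * u x - inner ℂ φ u * ψ x) / ((x : ℂ) - conj Complex.I) := by
    filter_upwards [Lp.coeFn_sub (cauchyOp _ hI w - u + Complex.I • cauchyOp _ hI u)
      (inner ℂ φ u • cauchyOp _ hI ψ), Lp.coeFn_add (cauchyOp _ hI w - u)
      (Complex.I • cauchyOp _ hI u), Lp.coeFn_sub (cauchyOp _ hI w) u,
      Lp.coeFn_smul Complex.I (cauchyOp _ hI u), Lp.coeFn_smul (inner ℂ φ u) (cauchyOp _ hI ψ),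
      cauchyOp_coe hI w, cauchyOp_coe hI u, cauchyOp_coe hI ψ] with x e1 e2 e3 e4 e5 e6 e7 e8
    have hx := ofReal_sub_ne_zero hI x
    rw [hq, e1, Pi.sub_apply, e2, Pi.add_apply, e3, Pi.sub_apply, e4, e5, Pi.smul_apply,
      Pi.smul_apply, e6, e7, e8, smul_eq_mul, smul_eq_mul]
    field_simp
    rw [Complex.conj_I]
    ring
  have hmem : (∀ f : (friedrichs ψ φ).domain, inner ℂ w (f : L2) = inner ℂ u (friedrichs ψ φ f)) ↔
      ∃ c : ℂ, c • cauchyVec _ hI = q := by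
    constructor
    · intro h
      refine exists_smul_eq_of_inner fun g hg => ?_
      rw [inner_cauchyVec_left I_im_ne_zero] at hg
      have hdom : cauchyOp Complex.I I_im_ne_zero g ∈ (friedrichs ψ φ).domain :=
        mem_minimalDomain_iff.2 ⟨g, hg, rfl⟩
      have h1 := h ⟨_, hdom⟩
      rw [friedrichs_cauchyOp] at h1
      rw [hqg, sub_eq_zero]
      exact h1
    · rintro ⟨c, hc⟩ ⟨f, hf⟩
      obtain ⟨g, hg, rfl⟩ := mem_minimalDomain_iff.1 hf
      rw [friedrichs_cauchyOp, ← sub_eq_zero, ← hqg, ← hc, inner_smul_left, inner_cauchyVec_left I_im_ne_zero,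
        hg, mul_zero]
  rw [hmem]
  constructor
  · rintro ⟨c, hc⟩
    have hw : w =ᵐ[volume] fun x : ℝ => (x : ℂ) * u x - (-c) + inner ℂ φ u * ψ x := by
      have h1 := Lp.coeFn_smul c (cauchyVec _ hI)
      rw [hc] at h1
      filter_upwards [h1, hcoe, cauchyVec_coe hI] with x e1 e2 e3
      rw [e2, Pi.smul_apply, e3, smul_eq_mul, ← div_eq_mul_inv,
        div_left_inj' (ofReal_sub_ne_zero hI x)] at e1
      linear_combination e1
    refine ⟨-c, ?_, hw⟩
    refine (MemLp.sub (Lp.memLp w) ((Lp.memLp ψ).const_mul (inner ℂ φ u))).ae_eq ?_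
    filter_upwards [hw] with x hx
    simp only [Pi.sub_apply, hx]
    ring
  · rintro ⟨c, -, hw⟩
    refine ⟨-c, Lp.ext ?_⟩
    filter_upwards [Lp.coeFn_smul (-c) (cauchyVec _ hI), hcoe, cauchyVec_coe hI, hw]
      with x e1 e2 e3 e4
    rw [e1, e2, Pi.smul_apply, e3, e4, smul_eq_mul]
    ring

/-! ### Resolvents in terms of graphs. -/

/-- The graph of the extension `A_B`. -/
def ExtGraph (φ ψ : L2) (B : ℂ) (u w : L2) : Prop :=
  ∃ c, HasTrace₁ u (B * c) ∧ MaxGraph φ ψ u w c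

theorem extensionOp_graph_iff {φ ψ u w : L2} {B : ℂ} :
    (∃ h : u ∈ (extensionOp φ ψ B).domain, extensionOp φ ψ B ⟨u, h⟩ = w) ↔
      ExtGraph φ ψ B u w := by
  constructor
  · rintro ⟨h, hw⟩
    obtain ⟨hb, hd⟩ := h
    obtain ⟨l, c, h1, h2, h3⟩ := hb
    obtain ⟨d, hd'⟩ := maximalOp_graph_iff.1 ⟨hd, rfl⟩
    obtain rfl : c = d := h2.unique hd'.1
    have hv : extensionOp φ ψ B ⟨u, ⟨⟨l, c, h1, h2, h3⟩, hd⟩⟩ = maximalOp φ ψ ⟨u, hd⟩ :=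
      LinearPMap.domRestrict_apply rfl
    refine ⟨c, h1.congr (sub_eq_zero.1 h3), ?_⟩
    rwa [← hw, hv]
  · rintro ⟨c, h1, h2⟩
    obtain ⟨hd, hv⟩ := maximalOp_graph_iff.2 ⟨c, h2⟩
    exact ⟨⟨⟨_, c, h1, h2.1, sub_self _⟩, hd⟩, (LinearPMap.domRestrict_apply rfl).trans hv⟩

theorem isResolvent_extensionOp_iff {φ ψ : L2} {B z : ℂ} {R : L2 →L[ℂ] L2} :
    IsResolvent (extensionOp φ ψ B) z R ↔
      (∀ g, ExtGraph φ ψ B (R g) (z • R g + g)) ∧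
        ∀ u w, ExtGraph φ ψ B u w → R (w - z • u) = u := by
  constructor
  · rintro ⟨h1, h2⟩
    refine ⟨fun g => ?_, fun u w huw => ?_⟩
    · obtain ⟨h, hg⟩ := h1 g
      exact extensionOp_graph_iff.1 ⟨h, sub_eq_iff_eq_add'.1 hg⟩
    · obtain ⟨h, rfl⟩ := extensionOp_graph_iff.2 huw
      exact h2 ⟨u, h⟩
  · rintro ⟨h1, h2⟩
    refine ⟨fun g => ?_, fun u => ?_⟩
    · obtain ⟨h, hg⟩ := extensionOp_graph_iff.2 (h1 g)
      exact ⟨h, sub_eq_iff_eq_add'.2 hg⟩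
    · exact h2 _ _ (extensionOp_graph_iff.1 ⟨u.2, rfl⟩)

theorem IsResolvent.unique {T : L2 →ₗ.[ℂ] L2} {z : ℂ} {R S : L2 →L[ℂ] L2}
    (hR : IsResolvent T z R) (hS : IsResolvent T z S) : R = S := by
  ext1 g
  obtain ⟨h, hg⟩ := hS.1 g
  have h1 := hR.2 ⟨S g, h⟩
  simp only [hg] at h1
  exact h1

theorem resolventOp_eq {T : L2 →ₗ.[ℂ] L2} {z : ℂ} {R : L2 →L[ℂ] L2} (hR : IsResolvent T z R) :
    resolventOp T z = R := by
  have h : ∃ R, IsResolvent T z R := ⟨R, hR⟩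
  rw [resolventOp, dif_pos h]
  exact h.choose_spec.unique hR

theorem inKernel_iff {φ ψ u : L2} {z : ℂ} :
    InKernel φ ψ z u ↔ ∃ c, MaxGraph φ ψ u (z • u) c :=
  maximalOp_graph_iff

theorem coeFn_sub_smul (u v : L2) (c : ℂ) :
    ∀ᵐ x, (u - c • v : L2) x = u x - c * v x := by
  filter_upwards [Lp.coeFn_sub u (c • v), Lp.coeFn_smul c v] with x h1 h2
  rw [h1, Pi.sub_apply, h2, Pi.smul_apply, smul_eq_mul]

theorem HasTrace₁.sub_smul {u v : L2} {l m : ℂ} (hu : HasTrace₁ u l) (c : ℂ) (hv : HasTrace₁ v m) :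
    HasTrace₁ (u - c • v) (l - c * m) := by
  have h := hu.add (hv.smul (-c))
  rw [neg_smul, ← sub_eq_add_neg] at h
  exact h.congr (by ring)

theorem HasTrace₂.sub_smul {u v : L2} {l m : ℂ} (hu : HasTrace₂ u l) (c : ℂ) (hv : HasTrace₂ v m) :
    HasTrace₂ (u - c • v) (l - c * m) := by
  have h := hu.add (hv.smul (-c))
  rw [neg_smul, ← sub_eq_add_neg] at h
  exact h.congr (by ring)

theorem MaxGraph.sub_smul {φ ψ u w v y : L2} {c d : ℂ} (hu : MaxGraph φ ψ u w c) (a : ℂ)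
    (hv : MaxGraph φ ψ v y d) : MaxGraph φ ψ (u - a • v) (w - a • y) (c - a * d) := by
  refine ⟨hu.1.sub_smul a hv.1, ?_⟩
  filter_upwards [coeFn_sub_smul u v a, coeFn_sub_smul w y a, hu.2, hv.2] with x h1 h2 h3 h4
  rw [h1, h2, h3, h4, inner_sub_right, inner_smul_right]
  ring

theorem ExtGraph.sub_smul {φ ψ u w v y : L2} {B : ℂ} (hu : ExtGraph φ ψ B u w) (a : ℂ)
    (hv : ExtGraph φ ψ B v y) : ExtGraph φ ψ B (u - a • v) (w - a • y) := by
  obtain ⟨c, hc, hu⟩ := hu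
  obtain ⟨d, hd, hv⟩ := hv
  exact ⟨c - a * d, (hc.sub_smul a hd).congr (by ring), hu.sub_smul a hv⟩

/-! ### Real points are never in the resolvent set. -/

/-- The indicator function of `(p, q]` as an element of `L²`. -/
noncomputable def indicatorVec (p q : ℝ) : L2 :=
  indicatorConstLp 2 (measurableSet_Ioc (a := p) (b := q)) measure_Ioc_lt_top.ne 1

theorem indicatorVec_coe (p q : ℝ) :
    indicatorVec p q =ᵐ[volume] (Set.Ioc p q).indicator fun _ => 1 :=
  indicatorConstLp_coeFn

theorem inner_indicatorVec (p q : ℝ) (f : L2) :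
    inner ℂ (indicatorVec p q) f = ∫ x in Set.Ioc p q, f x :=
  L2.inner_indicatorConstLp_one _ _ f

theorem integral_indicatorVec_of_subset {p q r s : ℝ} (h : Set.Ioc r s ⊆ Set.Ioc p q) (hrs : r ≤ s) :
    ∫ x in Set.Ioc p q, indicatorVec r s x = ((s - r : ℝ) : ℂ) := by
  have h1 : ∀ᵐ x ∂(volume.restrict (Set.Ioc p q)),
      indicatorVec r s x = (Set.Ioc r s).indicator (fun _ => (1 : ℂ)) x :=
    ae_restrict_of_ae (indicatorVec_coe r s)
  rw [integral_congr_ae h1, setIntegral_indicator measurableSet_Ioc,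
    Set.inter_eq_right.2 h]
  simp [hrs]

theorem integral_indicatorVec_of_disjoint {p q r s : ℝ}
    (h : Disjoint (Set.Ioc p q) (Set.Ioc r s)) :
    ∫ x in Set.Ioc p q, indicatorVec r s x = 0 := by
  have h1 : ∀ᵐ x ∂(volume.restrict (Set.Ioc p q)),
      indicatorVec r s x = (Set.Ioc r s).indicator (fun _ => (1 : ℂ)) x :=
    ae_restrict_of_ae (indicatorVec_coe r s)
  rw [integral_congr_ae h1, setIntegral_indicator measurableSet_Ioc, h.inter_eq]
  simp

/-- In every interval there is a nonzero function orthogonal to two given functionals. -/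
theorem exists_localized_ne_zero (φ : L2) (k : ℝ) {δ : ℝ} (hδ : 0 < δ) :
    ∃ u : L2, u ≠ 0 ∧ (∀ᵐ x, x ∉ Set.Ioc k (k + δ) → u x = 0) ∧
      inner ℂ (indicatorVec k (k + δ)) u = 0 ∧ inner ℂ φ u = 0 := by
  -- The interval is cut into three equal pieces: their indicators span a three-dimensional space,
  -- on which two linear functionals have a common nonzero zero.
  set e : Fin 3 → L2 := fun j => indicatorVec (k + δ * (j / 3)) (k + δ * ((j + 1) / 3)) with he
  have hle : ∀ j : Fin 3, k + δ * ((j : ℝ) / 3) < k + δ * (((j : ℝ) + 1) / 3) := fun j => by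
    have : δ * ((j : ℝ) / 3) < δ * (((j : ℝ) + 1) / 3) := by gcongr; linarith
    linarith
  have hdisj : ∀ i j : Fin 3, i < j →
      Disjoint (Set.Ioc (k + δ * ((i : ℝ) / 3)) (k + δ * (((i : ℝ) + 1) / 3)))
        (Set.Ioc (k + δ * ((j : ℝ) / 3)) (k + δ * (((j : ℝ) + 1) / 3))) := fun i j hij => by
    refine Set.Ioc_disjoint_Ioc_of_le ?_
    have h1 : ((i : ℕ) : ℝ) + 1 ≤ ((j : ℕ) : ℝ) := by exact_mod_cast hij
    gcongr
  have hli : LinearIndependent ℂ e := by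
    refine linearIndependent_of_ne_zero_of_inner_eq_zero (𝕜 := ℂ) (fun j h0 => ?_) fun i j hij => ?_
    · have h1 : inner ℂ (e j) (e j) = 0 := by rw [h0, inner_zero_left]
      rw [he, inner_indicatorVec, integral_indicatorVec_of_subset subset_rfl (hle j).le,
        Complex.ofReal_eq_zero] at h1
      linarith [hle j]
    · simp only [he]
      rw [inner_indicatorVec]
      refine integral_indicatorVec_of_disjoint ?_
      rcases lt_or_gt_of_ne hij with h | h
      · exact hdisj i j h
      · exact (hdisj j i h).symm
  set E : (Fin 3 → ℂ) →ₗ[ℂ] L2 := Fintype.linearCombination ℂ e with hE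
  obtain ⟨c, hc, hc0⟩ := Submodule.exists_mem_ne_zero_of_ne_bot
    (LinearMap.ker_ne_bot_of_finrank_lt (f := LinearMap.prod
      ((innerSL ℂ (indicatorVec k (k + δ))).toLinearMap ∘ₗ E) ((innerSL ℂ φ).toLinearMap ∘ₗ E))
      (by simp))
  rw [LinearMap.mem_ker, LinearMap.prod_apply] at hc
  obtain ⟨hc1, hc2⟩ := Prod.mk_eq_zero.1 hc
  refine ⟨E c, fun h0 => hc0 ?_, ?_, hc1, hc2⟩
  · have h1 := Fintype.linearIndependent_iff.1 hli c
      (by rwa [hE, Fintype.linearCombination_apply] at h0)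
    exact funext h1
  · have hsub : ∀ j : Fin 3, ∀ᵐ x, x ∉ Set.Ioc k (k + δ) → e j x = 0 := fun j => by
      filter_upwards [indicatorVec_coe (k + δ * ((j : ℝ) / 3)) (k + δ * (((j : ℝ) + 1) / 3))]
        with x hx hxk
      rw [he, hx, Set.indicator_of_notMem]
      refine fun hmem => hxk (Set.Ioc_subset_Ioc ?_ ?_ hmem)
      · have : 0 ≤ δ * ((j : ℝ) / 3) := by positivity
        linarith
      · have h1 : ((j : ℕ) : ℝ) + 1 ≤ 3 := by exact_mod_cast j.2
        have : δ * (((j : ℝ) + 1) / 3) ≤ δ * 1 := by gcongr; linarith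
        linarith
    have hsum : E c = c 0 • e 0 + c 1 • e 1 + c 2 • e 2 := by
      rw [hE, Fintype.linearCombination_apply, Fin.sum_univ_three]
    rw [hsum]
    filter_upwards [Lp.coeFn_add (c 0 • e 0 + c 1 • e 1) (c 2 • e 2),
      Lp.coeFn_add (c 0 • e 0) (c 1 • e 1), Lp.coeFn_smul (c 0) (e 0), Lp.coeFn_smul (c 1) (e 1),
      Lp.coeFn_smul (c 2) (e 2), hsub 0, hsub 1, hsub 2] with x h1 h2 h3 h4 h5 h6 h7 h8 hx
    rw [h1, Pi.add_apply, h2, Pi.add_apply, h3, h4, h5, Pi.smul_apply, Pi.smul_apply,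
      Pi.smul_apply, h6 hx, h7 hx, h8 hx]
    simp

theorem hasTrace₁_of_localized {u : L2} {p q : ℝ} (h : ∀ᵐ x, x ∉ Set.Ioc p q → u x = 0) :
    HasTrace₁ u (inner ℂ (indicatorVec p q) u) := by
  have hae : (fun x => conj (indicatorVec p q x) * u x) =ᵐ[volume] u := by
    filter_upwards [h, indicatorVec_coe p q] with x h1 h2
    by_cases hx : x ∈ Set.Ioc p q
    · simp [h2, hx]
    · simp [h1 hx]
  rw [inner_eq_integral, integral_congr_ae hae]
  exact intervalIntegral_tendsto_integral ((integrable_conj_mul _ _).congr hae)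
    tendsto_neg_atTop_atBot tendsto_id

/-- The resolvent set of every extension is disjoint from the real axis. -/
theorem im_ne_zero_of_mem_rho {φ ψ : L2} {B z : ℂ} (hz : z ∈ rho (extensionOp φ ψ B)) :
    z.im ≠ 0 := by
  intro him
  obtain ⟨R, hR⟩ := hz
  rw [isResolvent_extensionOp_iff] at hR
  obtain ⟨k, rfl⟩ : ∃ k : ℝ, z = k := ⟨z.re, by apply Complex.ext <;> simp [him]⟩
  -- Chosen so that `‖R‖ δ < 1`. A vector `u` supported in `(k, k + δ]` with `Γ₁ u = Γ₂ u = 0` and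
  -- `⟨u, φ⟩ = 0` satisfies `‖(A_B - k)u‖ ≤ δ‖u‖`, which contradicts boundedness of the inverse.
  set δ : ℝ := (2 * (‖R‖ + 1))⁻¹ with hδdef
  have hδ : 0 < δ := by positivity
  obtain ⟨u, hu0, hsupp, h1, h2⟩ := exists_localized_ne_zero φ k hδ
  have ht1 : HasTrace₁ u 0 := by simpa only [h1] using hasTrace₁_of_localized hsupp
  have hsub : ∀ᵐ x : ℝ, ‖((x : ℂ) - k) * u x‖ ≤ δ * ‖u x‖ := by
    filter_upwards [hsupp] with x hx
    by_cases hmem : x ∈ Set.Ioc k (k + δ)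
    · rw [norm_mul, ← Complex.ofReal_sub, Complex.norm_real, Real.norm_eq_abs,
        abs_of_pos (sub_pos.2 hmem.1)]
      gcongr
      linarith [hmem.2]
    · simp [hx hmem]
  have hmeas : AEStronglyMeasurable (fun x : ℝ => ((x : ℂ) - k) * u x) volume :=
    AEStronglyMeasurable.fun_mul (Measurable.aestronglyMeasurable (by fun_prop))
      (Lp.aestronglyMeasurable u)
  have hmem : MemLp (fun x : ℝ => ((x : ℂ) - k) * u x) 2 volume :=
    (Lp.memLp u).of_le_mul hmeas hsub
  set y : L2 := hmem.toLp _ with hy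
  have hgraph : MaxGraph φ ψ u (y + (k : ℂ) • u) 0 := by
    refine ⟨(MemLp.add hmem ((Lp.memLp u).const_mul (k : ℂ))).ae_eq
      (Eventually.of_forall fun x => ?_), ?_⟩
    · simp only [Pi.add_apply]
      ring
    · filter_upwards [Lp.coeFn_add y ((k : ℂ) • u), Lp.coeFn_smul (k : ℂ) u, hmem.coeFn_toLp]
        with x e1 e2 e3
      rw [e1, Pi.add_apply, e2, hy, e3, h2, Pi.smul_apply, smul_eq_mul]
      ring
  have hRy := hR.2 u _ ⟨0, ht1.congr (by simp), hgraph⟩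
  rw [add_sub_cancel_right] at hRy
  have hle : ‖y‖ ≤ δ * ‖u‖ := by
    refine Lp.norm_le_mul_norm_of_ae_le_mul ?_
    filter_upwards [hmem.coeFn_toLp, hsub] with x e1 e2
    rwa [hy, e1]
  have hupos : 0 < ‖u‖ := norm_pos_iff.2 hu0
  have h3 : ‖u‖ ≤ ‖R‖ * (δ * ‖u‖) := by
    calc ‖u‖ = ‖R y‖ := by rw [hRy]
      _ ≤ ‖R‖ * ‖y‖ := R.le_opNorm y
      _ ≤ _ := by gcongr
  have h4 : ‖R‖ * δ < 1 := by
    rw [hδdef, ← div_eq_mul_inv, div_lt_one (by positivity)]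
    linarith [norm_nonneg R]
  nlinarith

/-! ### Logarithms and the trace of `1/(x - z)`. -/

/-- The constant `± π i` in the upper, respectively lower, half plane. -/
noncomputable def halfPlaneConst (z : ℂ) : ℂ :=
  if 0 < z.im then Real.pi * Complex.I else -(Real.pi * Complex.I)

theorem log_neg_eq {w : ℂ} (hw : w.im ≠ 0) :
    Complex.log (-w) = Complex.log w - halfPlaneConst w := by
  rw [halfPlaneConst, Complex.log, Complex.log, norm_neg]
  rcases lt_or_gt_of_ne hw with h | h
  · rw [if_neg h.not_gt, Complex.arg_neg_eq_arg_add_pi_of_im_neg h]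
    push_cast
    ring
  · rw [if_pos h, Complex.arg_neg_eq_arg_sub_pi_of_im_pos h]
    push_cast
    ring

theorem intervalIntegral_inv_sub {z : ℂ} (hz : z.im ≠ 0) (p q : ℝ) :
    ∫ x in p..q, ((x : ℂ) - z)⁻¹ = Complex.log (q - z) - Complex.log (p - z) := by
  refine intervalIntegral.integral_eq_sub_of_hasDerivAt
    (f := fun x : ℝ => Complex.log ((x : ℂ) - z)) (fun x _ => ?_) ?_
  · have h1 : HasDerivAt (fun x : ℝ => (x : ℂ) - z) 1 x :=
      (Complex.ofRealCLM.hasDerivAt (x := x)).sub_const z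
    have h2 := h1.clog_real (Or.inr (by simpa using hz))
    simpa using h2
  · refine ContinuousOn.intervalIntegrable (Continuous.continuousOn ?_)
    exact Continuous.inv₀ (by fun_prop) (ofReal_sub_ne_zero hz)

/-- A positive factor `R` can be taken out of the principal logarithm without a branch correction,
which leaves `log(1 - z/R) - log(1 + z/R)`. -/
theorem tendsto_log_sub_log_add (z : ℂ) :
    Tendsto (fun R : ℝ => Complex.log (R - z) - Complex.log (R + z)) atTop (𝓝 0) := by
  have h0 : Tendsto (fun R : ℝ => z / (R : ℂ)) atTop (𝓝 0) := by
    have := (Complex.continuous_ofReal.tendsto 0).comp tendsto_inv_atTop_zero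
    simpa [div_eq_mul_inv] using this.const_mul z
  have hc : ContinuousAt (fun w : ℂ => Complex.log (1 - w) - Complex.log (1 + w)) 0 := by
    refine ContinuousAt.sub (ContinuousAt.clog (by fun_prop) (by simp))
      (ContinuousAt.clog (by fun_prop) (by simp))
  have h1 := hc.tendsto.comp h0
  simp only [sub_zero, add_zero, sub_self] at h1
  refine h1.congr' ?_
  filter_upwards [eventually_gt_atTop ‖z‖] with R hR
  have hR0 : 0 < R := (norm_nonneg z).trans_lt hR
  have hRc : (R : ℂ) ≠ 0 := Complex.ofReal_ne_zero.2 hR0.ne'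
  have hz1 : ‖z / (R : ℂ)‖ < 1 := by
    rw [norm_div, Complex.norm_real, Real.norm_eq_abs, abs_of_pos hR0, div_lt_one hR0]
    exact hR
  have n1 : 1 - z / (R : ℂ) ≠ 0 := fun h => by
    rw [← sub_eq_zero.1 h, norm_one] at hz1
    exact lt_irrefl _ hz1
  have n2 : 1 + z / (R : ℂ) ≠ 0 := fun h => by
    rw [← neg_eq_of_add_eq_zero_right h, norm_neg, norm_one] at hz1
    exact lt_irrefl _ hz1
  have e1 : (R : ℂ) - z = R * (1 - z / R) := by field_simp
  have e2 : (R : ℂ) + z = R * (1 + z / R) := by field_simp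
  rw [Function.comp_apply, e1, e2, Complex.log_ofReal_mul hR0 n1, Complex.log_ofReal_mul hR0 n2]
  ring

/-- The function is not integrable, so the symmetric limit matters: the integral over `[-R, R]` is
`log(R - z) - log(-(R + z))`, and the sign inside the second logarithm produces `±πi`. -/
theorem hasTrace₁_cauchyVec {z : ℂ} (hz : z.im ≠ 0) :
    HasTrace₁ (cauchyVec z hz) (halfPlaneConst z) := by
  have h := (tendsto_log_sub_log_add z).add_const (halfPlaneConst z)
  rw [zero_add] at h
  refine h.congr fun R => ?_
  have him : ((R : ℂ) + z).im = z.im := by simp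
  have hneg : ((-R : ℝ) : ℂ) - z = -((R : ℂ) + z) := by push_cast; ring
  rw [intervalIntegral.integral_congr_ae (g := fun x : ℝ => ((x : ℂ) - z)⁻¹)
    ((cauchyVec_coe hz).mono fun x hx _ => hx), intervalIntegral_inv_sub hz, hneg,
    log_neg_eq (by rwa [him]), halfPlaneConst, halfPlaneConst, him]
  ring

/-! ### The kernel of `Ã* - z`, Krein's formula and the `M`-function. -/

/-- The denominator `Γ₁ - B Γ₂`, evaluated on the solution `u` of `Ã* u = z u` with `Γ₂ u = 1`. -/
noncomputable def weylDenom (φ ψ : L2) (B z : ℂ) : ℂ :=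
  halfPlaneConst z - B - cauchyInt (fun x => conj (φ x)) z * cauchyInt ψ z

/-- The solution `u` of `Ã* u = z u` with `Γ₂ u = 1`. -/
noncomputable def defectVec (φ ψ : L2) (z : ℂ) (hz : z.im ≠ 0) : L2 :=
  cauchyVec z hz - cauchyInt (fun x => conj (φ x)) z • cauchyOp z hz ψ

/-- The supports of `φ` and `ψ` do not overlap. -/
def DisjointSupport (φ ψ : L2) : Prop := ∀ᵐ x : ℝ, φ x = 0 ∨ ψ x = 0

theorem DisjointSupport.symm {φ ψ : L2} (h : DisjointSupport φ ψ) : DisjointSupport ψ φ :=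
  h.mono fun _ hx => hx.symm

theorem DisjointSupport.inner_cauchyOp {φ ψ : L2} (h : DisjointSupport φ ψ) {z : ℂ}
    (hz : z.im ≠ 0) : inner ℂ φ (cauchyOp z hz ψ) = 0 := by
  have h0 : (fun x => conj (φ x) * ψ x) =ᵐ[volume] fun _ => 0 := by
    filter_upwards [h] with x hx
    rcases hx with hx | hx <;> simp [hx]
  rw [Friedrichs.inner_cauchyOp, cauchyInt_congr h0]
  simp [cauchyInt]

theorem inner_defectVec (φ ψ v : L2) {z : ℂ} (hz : z.im ≠ 0) :
    inner ℂ v (defectVec φ ψ z hz) = cauchyInt (fun x => conj (v x)) z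
      - cauchyInt (fun x => conj (φ x)) z * cauchyInt (fun x => conj (v x) * ψ x) z := by
  rw [defectVec, inner_sub_right, inner_smul_right, inner_cauchyVec, inner_cauchyOp]

section Resolvent

variable {φ ψ : L2} {B z : ℂ}

theorem DisjointSupport.inner_defectVec (h : DisjointSupport φ ψ) (hz : z.im ≠ 0) :
    inner ℂ φ (defectVec φ ψ z hz) = cauchyInt (fun x => conj (φ x)) z := by
  rw [defectVec, inner_sub_right, inner_smul_right, inner_cauchyVec, h.inner_cauchyOp, mul_zero,
    sub_zero]

theorem hasTrace₂_defectVec (hz : z.im ≠ 0) : HasTrace₂ (defectVec φ ψ z hz) 1 :=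
  ((hasTrace₂_cauchyVec hz).sub_smul _ (hasTrace₂_cauchyOp hz ψ)).congr (by simp)

theorem hasTrace₁_defectVec (hz : z.im ≠ 0) (B : ℂ) :
    HasTrace₁ (defectVec φ ψ z hz) (weylDenom φ ψ B z + B) :=
  ((hasTrace₁_cauchyVec hz).sub_smul _ (hasTrace₁_cauchyOp hz ψ)).congr (by
    rw [weylDenom]; ring)

theorem DisjointSupport.maxGraph_defectVec (h : DisjointSupport φ ψ) (hz : z.im ≠ 0) :
    MaxGraph φ ψ (defectVec φ ψ z hz) (z • defectVec φ ψ z hz) 1 := by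
  refine ⟨hasTrace₂_defectVec hz, ?_⟩
  filter_upwards [Lp.coeFn_smul z (defectVec φ ψ z hz),
    coeFn_sub_smul (cauchyVec z hz) (cauchyOp z hz ψ) (cauchyInt (fun x => conj (φ x)) z),
    cauchyVec_coe hz, cauchyOp_coe hz ψ] with x h1 h2 h3 h4
  have := ofReal_sub_ne_zero hz x
  rw [h1, Pi.smul_apply, smul_eq_mul, h.inner_defectVec, defectVec, h2, h3, h4]
  field_simp
  ring

/-- Solving gives `u = (c - ⟨u, φ⟩ψ)/(x - z)`. Pairing with `φ` kills the `ψ` term and yields `⟨u,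
φ⟩ = c φ̂(z)`, so `c` alone determines `u`. -/
theorem DisjointSupport.eq_smul_defectVec (h : DisjointSupport φ ψ) (hz : z.im ≠ 0) {u : L2} {c : ℂ}
    (hu : MaxGraph φ ψ u (z • u) c) : u = c • defectVec φ ψ z hz := by
  have h1 : u = c • cauchyVec z hz - inner ℂ φ u • cauchyOp z hz ψ := by
    refine Lp.ext ?_
    filter_upwards [hu.2, coeFn_sub_smul (c • cauchyVec z hz) (cauchyOp z hz ψ) (inner ℂ φ u),
      Lp.coeFn_smul c (cauchyVec z hz), cauchyVec_coe hz, cauchyOp_coe hz ψ, Lp.coeFn_smul z u]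
      with x e1 e2 e3 e4 e5 e6
    have hx := ofReal_sub_ne_zero hz x
    rw [e2, e3, Pi.smul_apply, e4, e5, smul_eq_mul]
    rw [e6, Pi.smul_apply, smul_eq_mul] at e1
    field_simp
    linear_combination -e1
  have h2 : inner ℂ φ u = c * cauchyInt (fun x => conj (φ x)) z := by
    conv_lhs => rw [h1]
    rw [inner_sub_right, inner_smul_right, inner_smul_right, inner_cauchyVec, h.inner_cauchyOp,
      mul_zero, sub_zero]
  rw [defectVec, smul_sub, smul_smul, ← h2]
  exact h1

/-- The functional `g ↦ (Γ₁ - B Γ₂)` of the decoupled solution of `(Ã* - z) u = g`. -/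
noncomputable def sourceFunctional (φ ψ : L2) (z : ℂ) (hz : z.im ≠ 0) : L2 →L[ℂ] ℂ :=
  innerSL ℂ (cauchyVec (conj z) (conj_im_ne_zero hz))
    - cauchyInt ψ z • (innerSL ℂ φ).comp (cauchyOp z hz)

theorem sourceFunctional_apply (φ ψ : L2) (hz : z.im ≠ 0) (g : L2) :
    sourceFunctional φ ψ z hz g = cauchyInt g z
      - cauchyInt (fun x => conj (φ x) * g x) z * cauchyInt ψ z := by
  rw [← inner_cauchyVec_left hz, ← inner_cauchyOp hz, mul_comm]
  rfl

/-- Krein's formula for the resolvent of `A_B`. -/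
noncomputable def kreinResolvent (φ ψ : L2) (B z : ℂ) (hz : z.im ≠ 0) : L2 →L[ℂ] L2 :=
  cauchyOp z hz - ((innerSL ℂ φ).comp (cauchyOp z hz)).smulRight (cauchyOp z hz ψ)
    - ((weylDenom φ ψ B z)⁻¹ • sourceFunctional φ ψ z hz).smulRight (defectVec φ ψ z hz)

theorem kreinResolvent_apply (φ ψ : L2) (B : ℂ) (hz : z.im ≠ 0) (g : L2) :
    kreinResolvent φ ψ B z hz g = cauchyOp z hz g
      - inner ℂ φ (cauchyOp z hz g) • cauchyOp z hz ψ
      - ((weylDenom φ ψ B z)⁻¹ * sourceFunctional φ ψ z hz g) • defectVec φ ψ z hz := rfl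

/-- The first two terms of the formula solve `(Ã* - z)v = g` with `Γ₂ v = 0`. Subtracting a multiple
of the kernel vector keeps the equation and restores the boundary condition, since `Γ₁ - BΓ₂` of
that vector is the denominator. -/
theorem DisjointSupport.extGraph_kreinResolvent (h : DisjointSupport φ ψ) (hz : z.im ≠ 0)
    (hm : weylDenom φ ψ B z ≠ 0) (g : L2) :
    ExtGraph φ ψ B (kreinResolvent φ ψ B z hz g) (z • kreinResolvent φ ψ B z hz g + g) := by
  rw [kreinResolvent_apply]
  set c : ℂ := (weylDenom φ ψ B z)⁻¹ * sourceFunctional φ ψ z hz g with hc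
  set v : L2 := cauchyOp z hz g - inner ℂ φ (cauchyOp z hz g) • cauchyOp z hz ψ with hv
  have hcm : c * weylDenom φ ψ B z = sourceFunctional φ ψ z hz g := by
    rw [hc]
    field_simp
  have hφv : inner ℂ φ v = inner ℂ φ (cauchyOp z hz g) := by
    rw [hv, inner_sub_right, inner_smul_right, h.inner_cauchyOp, mul_zero, sub_zero]
  have hv1 : HasTrace₁ v (sourceFunctional φ ψ z hz g) :=
    ((hasTrace₁_cauchyOp hz g).sub_smul _ (hasTrace₁_cauchyOp hz ψ)).congr (by
      rw [sourceFunctional_apply, Friedrichs.inner_cauchyOp])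
  have hvg : MaxGraph φ ψ v (z • v + g) 0 := by
    refine ⟨((hasTrace₂_cauchyOp hz g).sub_smul _ (hasTrace₂_cauchyOp hz ψ)).congr (by simp), ?_⟩
    filter_upwards [Lp.coeFn_add (z • v) g, Lp.coeFn_smul z v, cauchyOp_coe hz g,
      cauchyOp_coe hz ψ, coeFn_sub_smul (cauchyOp z hz g) (cauchyOp z hz ψ)
        (inner ℂ φ (cauchyOp z hz g))] with x e1 e2 e3 e4 e5
    have hx := ofReal_sub_ne_zero hz x
    rw [e1, Pi.add_apply, e2, Pi.smul_apply, smul_eq_mul, hφv, hv, e5, e3, e4]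
    field_simp
    ring
  refine ⟨0 - c * 1, (hv1.sub_smul c (hasTrace₁_defectVec hz B)).congr ?_, ?_⟩
  · rw [← hcm]
    ring
  · have := hvg.sub_smul c (h.maxGraph_defectVec hz)
    convert this using 1
    rw [smul_sub, smul_comm z c]
    abel

/-- For the other inverse relation, the difference of two solutions is `c` times the kernel vector.
The boundary condition then reads `c · weylDenom = 0`, so `c = 0`. -/
theorem DisjointSupport.isResolvent (h : DisjointSupport φ ψ) (hz : z.im ≠ 0)
    (hm : weylDenom φ ψ B z ≠ 0) :
    IsResolvent (extensionOp φ ψ B) z (kreinResolvent φ ψ B z hz) := by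
  refine isResolvent_extensionOp_iff.2 ⟨h.extGraph_kreinResolvent hz hm, fun u w huw => ?_⟩
  obtain ⟨c, hc1, hc2⟩ := huw.sub_smul 1 (h.extGraph_kreinResolvent hz hm (w - z • u))
  set v := kreinResolvent φ ψ B z hz (w - z • u)
  have hker : MaxGraph φ ψ (u - (1 : ℂ) • v) (z • (u - (1 : ℂ) • v)) c := by
    convert hc2 using 1
    simp only [one_smul, smul_sub]
    abel
  have h1 := h.eq_smul_defectVec hz hker
  rw [h1] at hc1
  have h2 := hc1.unique ((hasTrace₁_defectVec hz B).smul c)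
  have h3 : c * weylDenom φ ψ B z = 0 := by linear_combination -h2
  rw [(mul_eq_zero.1 h3).resolve_right hm, zero_smul, one_smul, sub_eq_zero] at h1
  exact h1.symm

theorem defectVec_ne_zero (hz : z.im ≠ 0) : defectVec φ ψ z hz ≠ 0 := fun h0 => by
  have h1 := hasTrace₂_defectVec (φ := φ) (ψ := ψ) hz
  rw [h0] at h1
  exact one_ne_zero (h1.unique HasTrace₂.zero)

/-- The resolvent set of `A_B` consists of the non-real points where the denominator of the
`M`-function does not vanish. -/
theorem DisjointSupport.mem_rho_iff (h : DisjointSupport φ ψ) :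
    z ∈ rho (extensionOp φ ψ B) ↔ z.im ≠ 0 ∧ weylDenom φ ψ B z ≠ 0 := by
  refine ⟨fun hmem => ?_, fun hz => ⟨_, h.isResolvent hz.1 hz.2⟩⟩
  have hz := im_ne_zero_of_mem_rho hmem
  refine ⟨hz, fun h0 => ?_⟩
  obtain ⟨R, hR⟩ := hmem
  rw [isResolvent_extensionOp_iff] at hR
  have h1 := hR.2 _ _ ⟨1, (hasTrace₁_defectVec hz B).congr (by rw [h0]; ring),
    h.maxGraph_defectVec hz⟩
  rw [sub_self, map_zero] at h1
  exact defectVec_ne_zero hz h1.symm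

theorem DisjointSupport.resolventOp_eq (h : DisjointSupport φ ψ) (hz : z.im ≠ 0)
    (hm : weylDenom φ ψ B z ≠ 0) :
    resolventOp (extensionOp φ ψ B) z = kreinResolvent φ ψ B z hz :=
  Friedrichs.resolventOp_eq (h.isResolvent hz hm)

theorem DisjointSupport.isMValue_iff (h : DisjointSupport φ ψ) (hz : z.im ≠ 0) {m : ℂ} :
    IsMValue φ ψ B z m ↔ m * weylDenom φ ψ B z = 1 := by
  constructor
  · intro hm
    have h1 := hm _ (inKernel_iff.2 ⟨1, h.maxGraph_defectVec hz⟩) _ _ (hasTrace₁_defectVec hz B)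
      (hasTrace₂_defectVec hz)
    rwa [mul_one, add_sub_cancel_right] at h1
  · intro hm u hu l c hl hc
    obtain ⟨d, hd⟩ := inKernel_iff.1 hu
    obtain rfl := hc.unique hd.1
    have h1 := h.eq_smul_defectVec hz hd
    have h2 := (hasTrace₁_defectVec (φ := φ) (ψ := ψ) hz B).smul c
    rw [← h1] at h2
    rw [hl.unique h2]
    linear_combination c * hm

theorem DisjointSupport.existsUnique_isMValue (h : DisjointSupport φ ψ) (hz : z.im ≠ 0)
    (hm : weylDenom φ ψ B z ≠ 0) : ∃! m : ℂ, IsMValue φ ψ B z m := by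
  simp only [h.isMValue_iff hz]
  exact ⟨_, inv_mul_cancel₀ hm, fun y hy => eq_inv_of_mul_eq_one_left hy⟩

theorem DisjointSupport.mFunction_eq (h : DisjointSupport φ ψ) (hz : z.im ≠ 0)
    (hm : weylDenom φ ψ B z ≠ 0) : mFunction φ ψ B z = (weylDenom φ ψ B z)⁻¹ := by
  have h1 : IsMValue φ ψ B z (mFunction φ ψ B z) :=
    Classical.epsilon_spec (h.existsUnique_isMValue hz hm).exists
  exact eq_inv_of_mul_eq_one_left ((h.isMValue_iff hz).1 h1)

end Resolvent

/-! ### Analytic dependence on `z` and non-empty resolvent sets. -/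

/-- The open half plane (upper or lower) that contains `z`. -/
def sameSide (z : ℂ) : Set ℂ := {w | 0 < w.im * z.im}

theorem mem_sameSide_self {z : ℂ} (hz : z.im ≠ 0) : z ∈ sameSide z := mul_self_pos.2 hz

theorem im_ne_zero_of_mem_sameSide {z w : ℂ} (hw : w ∈ sameSide z) : w.im ≠ 0 :=
  left_ne_zero_of_mul (ne_of_gt hw)

theorem isOpen_sameSide (z : ℂ) : IsOpen (sameSide z) :=
  isOpen_lt continuous_const (by fun_prop)

theorem convex_sameSide (z : ℂ) : Convex ℝ (sameSide z) := by
  intro w hw v hv s t hs ht hst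
  have hw' : 0 < w.im * z.im := hw
  have hv' : 0 < v.im * z.im := hv
  have h1 : (s • w + t • v).im * z.im = s * (w.im * z.im) + t * (v.im * z.im) := by
    simp
    ring
  change 0 < (s • w + t • v).im * z.im
  rw [h1]
  rcases hs.eq_or_lt with rfl | hs
  · have : t = 1 := by linarith
    subst this
    linarith
  · positivity

theorem halfPlaneConst_of_mem_sameSide {z w : ℂ} (hw : w ∈ sameSide z) :
    halfPlaneConst w = halfPlaneConst z := by
  have hw' : 0 < w.im * z.im := hw
  unfold halfPlaneConst
  rcases pos_and_pos_or_neg_and_neg_of_mul_pos hw' with ⟨h1, h2⟩ | ⟨h1, h2⟩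
  · rw [if_pos h1, if_pos h2]
  · rw [if_neg h1.not_gt, if_neg h2.not_gt]

theorem eq_zero_of_eventually_eq_zero {f : ℂ → ℂ} (hf : ∀ z : ℂ, z.im ≠ 0 → AnalyticAt ℂ f z)
    {z w : ℂ} (hz : z.im ≠ 0) (hw : w ∈ sameSide z) (h : ∀ᶠ v in 𝓝 w, f v = 0) : f z = 0 :=
  AnalyticOnNhd.eqOn_zero_of_preconnected_of_eventuallyEq_zero (U := sameSide z)
    (fun v hv => hf v (im_ne_zero_of_mem_sameSide hv)) (convex_sameSide z).isPreconnected hw h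
    (mem_sameSide_self hz)

theorem analyticAt_halfPlaneConst {z : ℂ} (hz : z.im ≠ 0) : AnalyticAt ℂ halfPlaneConst z := by
  refine (analyticAt_const (v := halfPlaneConst z)).congr ?_
  filter_upwards [(isOpen_sameSide z).mem_nhds (mem_sameSide_self hz)] with w hw
  exact (halfPlaneConst_of_mem_sameSide hw).symm

theorem analyticAt_weylDenom (φ ψ : L2) (B : ℂ) {z : ℂ} (hz : z.im ≠ 0) :
    AnalyticAt ℂ (weylDenom φ ψ B) z :=
  ((analyticAt_halfPlaneConst hz).sub analyticAt_const).sub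
    (((cauchyIntegrable_conj φ).analyticAt_of_im hz).mul
      ((cauchyIntegrable_coe ψ).analyticAt_of_im hz))

/-- `φ` and `ψ` have disjoint supports, and their Cauchy transforms have no zeros off the real
line. -/
structure Nondegenerate (φ ψ : L2) : Prop where
  disjointSupport : DisjointSupport φ ψ
  left_ne_zero : ∀ z : ℂ, z.im ≠ 0 → cauchyInt (fun x => conj (φ x)) z ≠ 0
  right_ne_zero : ∀ z : ℂ, z.im ≠ 0 → cauchyInt ψ z ≠ 0

theorem tendsto_weylDenom (φ ψ : L2) (B : ℂ) {ω : ℂ} (hω : ω = Complex.I ∨ ω = -Complex.I) :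
    Tendsto (fun y : ℝ => weylDenom φ ψ B (y * ω)) atTop (𝓝 (halfPlaneConst ω - B)) := by
  have h1 := ((cauchyIntegrable_conj φ).tendsto_atTop hω).mul
    ((cauchyIntegrable_coe ψ).tendsto_atTop hω)
  have h2 := (tendsto_const_nhds (x := halfPlaneConst ω - B)).sub h1
  rw [mul_zero, sub_zero] at h2
  refine h2.congr' ?_
  filter_upwards [eventually_gt_atTop (0 : ℝ)] with y hy
  have h3 : (y : ℂ) * ω ∈ sameSide ω := by
    change 0 < ((y : ℂ) * ω).im * ω.im
    rcases hω with rfl | rfl <;> simpa using hy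
  rw [weylDenom, halfPlaneConst_of_mem_sameSide h3]

/-- `B` cannot equal both `πi` and `-πi`, so along at least one imaginary half-axis the denominator
has a nonzero limit. -/
theorem exists_direction_ne (B : ℂ) :
    ∃ ω : ℂ, (ω = Complex.I ∨ ω = -Complex.I) ∧ halfPlaneConst ω - B ≠ 0 := by
  have h1 : halfPlaneConst Complex.I = Real.pi * Complex.I := by simp [halfPlaneConst]
  have h2 : halfPlaneConst (-Complex.I) = -(Real.pi * Complex.I) := by simp [halfPlaneConst]
  by_cases hB : (Real.pi * Complex.I : ℂ) - B = 0
  · refine ⟨_, Or.inr rfl, fun h => ?_⟩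
    rw [h2] at h
    have h3 : (Real.pi * Complex.I : ℂ) = 0 := by linear_combination (hB - h) / 2
    simp [Real.pi_ne_zero] at h3
  · exact ⟨_, Or.inl rfl, by rwa [h1]⟩

theorem mul_direction_im_ne_zero {ω : ℂ} (hω : ω = Complex.I ∨ ω = -Complex.I) {y : ℝ}
    (hy : 0 < y) : ((y : ℂ) * ω).im ≠ 0 := by
  rcases hω with rfl | rfl <;> simpa using hy.ne'

/-- If `B` differs from the constant `±πi` of this half plane, the limit at infinity is nonzero. In
the exceptional case the denominator is `-φ̂ψ̂`, which has no zeros off the real line by assumption.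
-/
theorem Nondegenerate.exists_weylDenom_ne_zero {φ ψ : L2} (h : Nondegenerate φ ψ) (B : ℂ) {z : ℂ}
    (hz : z.im ≠ 0) : ∃ w ∈ sameSide z, weylDenom φ ψ B w ≠ 0 := by
  by_cases hB : halfPlaneConst z - B = 0
  · refine ⟨z, mem_sameSide_self hz, ?_⟩
    rw [weylDenom, hB, zero_sub]
    exact neg_ne_zero.2 (mul_ne_zero (h.left_ne_zero z hz) (h.right_ne_zero z hz))
  · obtain ⟨ω, hω, hside⟩ : ∃ ω : ℂ, (ω = Complex.I ∨ ω = -Complex.I) ∧ ω ∈ sameSide z := by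
      rcases lt_or_gt_of_ne hz with h1 | h1
      · exact ⟨-Complex.I, Or.inr rfl, by change 0 < (-Complex.I).im * z.im; simpa using h1⟩
      · exact ⟨Complex.I, Or.inl rfl, by change 0 < (Complex.I).im * z.im; simpa using h1⟩
    have hlim := tendsto_weylDenom φ ψ B hω
    rw [halfPlaneConst_of_mem_sameSide hside] at hlim
    obtain ⟨y, hy1, hy2⟩ := ((hlim.eventually_ne hB).and (eventually_gt_atTop (0 : ℝ))).exists
    refine ⟨_, ?_, hy1⟩
    have h2 : 0 < ω.im * z.im := hside
    change 0 < ((y : ℂ) * ω).im * z.im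
    have h3 : ((y : ℂ) * ω).im = y * ω.im := by simp
    rw [h3, mul_assoc]
    positivity

theorem Nondegenerate.rho_nonempty {φ ψ : L2} (h : Nondegenerate φ ψ) (B : ℂ) :
    (rho (extensionOp φ ψ B)).Nonempty := by
  obtain ⟨w, hw, hw'⟩ := h.exists_weylDenom_ne_zero B I_im_ne_zero
  exact ⟨w, h.disjointSupport.mem_rho_iff.2 ⟨im_ne_zero_of_mem_sameSide hw, hw'⟩⟩

/-! ### The detectable subspace and its orthogonal complement. -/

/-- The resolvent identity for the solution operators. -/
theorem DisjointSupport.kreinResolvent_defectVec {φ ψ : L2} (h : DisjointSupport φ ψ) {B z w : ℂ}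
    (hz : z.im ≠ 0) (hw : w.im ≠ 0) (hmz : weylDenom φ ψ B z ≠ 0) (hmw : weylDenom φ ψ B w ≠ 0)
    (hzw : z ≠ w) :
    kreinResolvent φ ψ B z hz (defectVec φ ψ w hw) = (weylDenom φ ψ B w / (z - w)) •
      ((weylDenom φ ψ B z)⁻¹ • defectVec φ ψ z hz
        - (weylDenom φ ψ B w)⁻¹ • defectVec φ ψ w hw) := by
  set p := weylDenom φ ψ B z
  set q := weylDenom φ ψ B w
  have hsub : z - w ≠ 0 := sub_ne_zero.2 hzw
  have h1 : ExtGraph φ ψ B (defectVec φ ψ z hz - (p * q⁻¹) • defectVec φ ψ w hw)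
      (z • defectVec φ ψ z hz - (p * q⁻¹) • (w • defectVec φ ψ w hw)) := by
    refine ⟨1 - (p * q⁻¹) * 1, ?_, (h.maxGraph_defectVec hz).sub_smul _ (h.maxGraph_defectVec hw)⟩
    refine ((hasTrace₁_defectVec hz B).sub_smul _ (hasTrace₁_defectVec hw B)).congr ?_
    change (p + B) - p * q⁻¹ * (q + B) = _
    field_simp
    ring
  have h2 := (isResolvent_extensionOp_iff.1 (h.isResolvent hz hmz)).2 _ _ h1
  have h3 : z • defectVec φ ψ z hz - (p * q⁻¹) • (w • defectVec φ ψ w hw)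
      - z • (defectVec φ ψ z hz - (p * q⁻¹) • defectVec φ ψ w hw)
      = (p * q⁻¹ * (z - w)) • defectVec φ ψ w hw := by
    module
  rw [h3, map_smul] at h2
  have hne : p * q⁻¹ * (z - w) ≠ 0 := mul_ne_zero (mul_ne_zero hmz (inv_ne_zero hmw)) hsub
  rw [← inv_smul_smul₀ hne (kreinResolvent φ ψ B z hz (defectVec φ ψ w hw)), h2, smul_sub,
    smul_sub, smul_smul, smul_smul, smul_smul]
  congr 2
  · field_simp
  · field_simp

theorem DisjointSupport.mem_solutionRange_iff {φ ψ : L2} (h : DisjointSupport φ ψ) {B z : ℂ}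
    (hz : z.im ≠ 0) {u : L2} :
    u ∈ solutionRange φ ψ B z ↔ ∃ c : ℂ, u = c • defectVec φ ψ z hz := by
  constructor
  · rintro ⟨hu, -⟩
    obtain ⟨c, hc⟩ := inKernel_iff.1 hu
    exact ⟨c, h.eq_smul_defectVec hz hc⟩
  · rintro ⟨c, rfl⟩
    have hg := (h.maxGraph_defectVec hz).sub_smul (1 - c) (h.maxGraph_defectVec hz)
    have e1 : defectVec φ ψ z hz - (1 - c) • defectVec φ ψ z hz = c • defectVec φ ψ z hz := by
      module
    have e2 : z • defectVec φ ψ z hz - (1 - c) • (z • defectVec φ ψ z hz)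
        = z • (c • defectVec φ ψ z hz) := by
      module
    rw [e1, e2] at hg
    exact ⟨inKernel_iff.2 ⟨_, hg⟩, _, _, _, (hasTrace₁_defectVec hz B).smul c,
      (hasTrace₂_defectVec hz).smul c, rfl⟩

/-- The pairing `⟨u_z, v⟩` with the solution `u_z` of `Ã* u = z u`, `Γ₂ u = 1`. -/
noncomputable def defectPairing (φ ψ v : L2) (z : ℂ) : ℂ :=
  cauchyInt (fun x => conj (v x)) z
    - cauchyInt (fun x => conj (φ x)) z * cauchyInt (fun x => conj (v x) * ψ x) z

theorem inner_defectVec_eq (φ ψ v : L2) {z : ℂ} (hz : z.im ≠ 0) :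
    inner ℂ v (defectVec φ ψ z hz) = defectPairing φ ψ v z := inner_defectVec φ ψ v hz

theorem cauchyIntegrable_conj_mul (v f : L2) : CauchyIntegrable fun x => conj (v x) * f x :=
  cauchyIntegrable_of_integrable (integrable_conj_mul v f)

theorem analyticAt_defectPairing (φ ψ v : L2) {z : ℂ} (hz : z.im ≠ 0) :
    AnalyticAt ℂ (defectPairing φ ψ v) z :=
  ((cauchyIntegrable_conj v).analyticAt_of_im hz).sub
    (((cauchyIntegrable_conj φ).analyticAt_of_im hz).mul
      ((cauchyIntegrable_conj_mul v ψ).analyticAt_of_im hz))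

theorem tendsto_defectPairing (φ ψ v : L2) {ω : ℂ} (hω : ω = Complex.I ∨ ω = -Complex.I) :
    Tendsto (fun y : ℝ => defectPairing φ ψ v (y * ω)) atTop (𝓝 0) := by
  simpa [defectPairing] using ((cauchyIntegrable_conj v).tendsto_atTop hω).sub
    (((cauchyIntegrable_conj φ).tendsto_atTop hω).mul
      ((cauchyIntegrable_conj_mul v ψ).tendsto_atTop hω))

theorem mem_orthogonal_detectableSubspace {φ ψ : L2} {B μ v : _} :
    v ∈ (detectableSubspace φ ψ B μ)ᗮ ↔ ∀ δ ∈ rho (extensionOp φ ψ B),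
      ∀ u ∈ solutionRange φ ψ B μ, inner ℂ v (resolventOp (extensionOp φ ψ B) δ u) = 0 := by
  rw [detectableSubspace, Submodule.orthogonal_closure, detectableSpan]
  constructor
  · intro hv δ hδ u hu
    exact (Submodule.mem_orthogonal' _ _).1 hv _
      (Submodule.subset_span (Set.mem_biUnion hδ (Set.mem_image_of_mem _ hu)))
  · intro hv
    rw [Submodule.mem_orthogonal']
    intro y hy
    induction hy using Submodule.span_induction with
    | mem y hy =>
      obtain ⟨δ, hδ, u, hu, rfl⟩ := Set.mem_iUnion₂.1 hy
      exact hv δ hδ u hu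
    | zero => exact inner_zero_right _
    | add x y _ _ hx hy => rw [inner_add_right, hx, hy, add_zero]
    | smul c x _ hx => rw [inner_smul_right, hx, mul_zero]

theorem Nondegenerate.defectPairing_eq_zero_of_rho {φ ψ : L2} (h : Nondegenerate φ ψ) {B : ℂ}
    {v : L2} (hv : ∀ z : ℂ, z.im ≠ 0 → weylDenom φ ψ B z ≠ 0 → defectPairing φ ψ v z = 0)
    {z : ℂ} (hz : z.im ≠ 0) : defectPairing φ ψ v z = 0 := by
  obtain ⟨w, hw, hmw⟩ := h.exists_weylDenom_ne_zero B hz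
  refine eq_zero_of_eventually_eq_zero (fun z hz => analyticAt_defectPairing φ ψ v hz) hz hw ?_
  have hwim := im_ne_zero_of_mem_sameSide hw
  filter_upwards [(isOpen_sameSide z).mem_nhds hw,
    (analyticAt_weylDenom φ ψ B hwim).continuousAt.eventually_ne hmw] with x hx1 hx2
  exact hv x (im_ne_zero_of_mem_sameSide hx1) hx2

/-- The orthogonal complement of the detectable subspace consists of the vectors orthogonal to all
solutions of `Ã* u = z u`. -/
theorem Nondegenerate.mem_orthogonal_iff {φ ψ : L2} (h : Nondegenerate φ ψ) {B μ : ℂ}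
    (hμ : μ ∈ rho (extensionOp φ ψ B)) {v : L2} :
    v ∈ (detectableSubspace φ ψ B μ)ᗮ ↔ ∀ z : ℂ, z.im ≠ 0 → defectPairing φ ψ v z = 0 := by
  have hd := h.disjointSupport
  obtain ⟨hμi, hμm⟩ := hd.mem_rho_iff.1 hμ
  rw [mem_orthogonal_detectableSubspace]
  constructor
  · intro hv z hz
    refine h.defectPairing_eq_zero_of_rho (B := B) ?_ hz
    -- Orthogonality to the right side of the resolvent identity says that `⟨u_z, v⟩ / D(z)` is
    -- constant on the resolvent set.
    have h1 : ∀ z : ℂ, z.im ≠ 0 → weylDenom φ ψ B z ≠ 0 → defectPairing φ ψ v z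
        = weylDenom φ ψ B z * ((weylDenom φ ψ B μ)⁻¹ * defectPairing φ ψ v μ) := by
      intro z hz hm
      rcases eq_or_ne z μ with rfl | hzμ
      · field_simp
      have h2 := hv z (hd.mem_rho_iff.2 ⟨hz, hm⟩) (defectVec φ ψ μ hμi)
        ((hd.mem_solutionRange_iff hμi).2 ⟨1, (one_smul _ _).symm⟩)
      rw [hd.resolventOp_eq hz hm, hd.kreinResolvent_defectVec hz hμi hm hμm hzμ,
        inner_smul_right, inner_sub_right, inner_smul_right, inner_smul_right,
        inner_defectVec_eq, inner_defectVec_eq] at h2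
      have h3 := (mul_eq_zero.1 h2).resolve_left (div_ne_zero hμm (sub_ne_zero.2 hzμ))
      rw [← sub_eq_zero.1 h3]
      field_simp
    -- The constant is found at infinity: along `ω` the pairing tends to `0` while the denominator
    -- does not.
    obtain ⟨ω, hω, hne⟩ := exists_direction_ne B
    have hlim1 := tendsto_defectPairing φ ψ v hω
    have hlim2 := tendsto_weylDenom φ ψ B hω
    have hlim3 := hlim2.mul_const ((weylDenom φ ψ B μ)⁻¹ * defectPairing φ ψ v μ)
    have heq := tendsto_nhds_unique hlim1 (hlim3.congr' (by
      filter_upwards [hlim2.eventually_ne hne, eventually_gt_atTop (0 : ℝ)] with y hy1 hy2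
      exact (h1 _ (mul_direction_im_ne_zero hω hy2) hy1).symm))
    have hκ := (mul_eq_zero.1 heq.symm).resolve_left hne
    intro z hz hm
    rw [h1 z hz hm, hκ, mul_zero]
  · intro hv δ hδ u hu
    obtain ⟨hδi, hδm⟩ := hd.mem_rho_iff.1 hδ
    obtain ⟨c, rfl⟩ := (hd.mem_solutionRange_iff hμi).1 hu
    rw [hd.resolventOp_eq hδi hδm, map_smul, inner_smul_right]
    have key : ∀ w : ℂ, ∀ hw : w.im ≠ 0, weylDenom φ ψ B w ≠ 0 → δ ≠ w →
        inner ℂ v (kreinResolvent φ ψ B δ hδi (defectVec φ ψ w hw)) = 0 := by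
      intro w hw hm hne
      rw [hd.kreinResolvent_defectVec hδi hw hδm hm hne, inner_smul_right, inner_sub_right,
        inner_smul_right, inner_smul_right, inner_defectVec_eq, inner_defectVec_eq, hv _ hδi,
        hv _ hw]
      simp
    rcases ne_or_eq δ μ with hne | rfl
    · rw [key μ hμi hμm hne, mul_zero]
    -- At `δ = μ` the resolvent identity would divide by zero. Moving the resolvent onto `v` turns
    -- the matrix element into a pairing analytic in `w`, which vanishes for nearby `w ≠ δ` and so
    -- at `δ` by continuity.
    set y := ContinuousLinearMap.adjoint (kreinResolvent φ ψ B δ hδi) v with hy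
    have hpair : ∀ w : ℂ, ∀ hw : w.im ≠ 0,
        inner ℂ v (kreinResolvent φ ψ B δ hδi (defectVec φ ψ w hw)) = defectPairing φ ψ y w := by
      intro w hw
      rw [← inner_defectVec_eq φ ψ y hw, hy, ContinuousLinearMap.adjoint_inner_left]
    rw [hpair δ hμi]
    have hcont := (analyticAt_defectPairing φ ψ y hμi).continuousAt
    have hlim : Tendsto (defectPairing φ ψ y) (𝓝[≠] δ) (𝓝 (defectPairing φ ψ y δ)) :=
      hcont.tendsto.mono_left nhdsWithin_le_nhds
    have hzero : defectPairing φ ψ y δ = 0 := by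
      refine tendsto_nhds_unique hlim (tendsto_const_nhds.congr' ?_)
      filter_upwards [self_mem_nhdsWithin, mem_nhdsWithin_of_mem_nhds
        ((isOpen_sameSide δ).mem_nhds (mem_sameSide_self hμi)),
        mem_nhdsWithin_of_mem_nhds
          ((analyticAt_weylDenom φ ψ B hμi).continuousAt.eventually_ne hμm)] with w h1 h2 h3
      have hw := im_ne_zero_of_mem_sameSide h2
      rw [← hpair w hw]
      exact (key w hw h3 (Ne.symm h1)).symm
    rw [hzero, mul_zero]

theorem Nondegenerate.defectVec_mem {φ ψ : L2} (h : Nondegenerate φ ψ) {B μ : ℂ}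
    (hμ : μ ∈ rho (extensionOp φ ψ B)) {z : ℂ} (hz : z.im ≠ 0) :
    defectVec φ ψ z hz ∈ detectableSubspace φ ψ B μ := by
  rw [← Submodule.orthogonal_orthogonal (detectableSubspace φ ψ B μ), Submodule.mem_orthogonal]
  intro v hv
  rw [inner_defectVec_eq, (h.mem_orthogonal_iff hμ).1 hv z hz]

/-! ### Indicator functions and the sign of Cauchy transforms. -/

theorem integral_pos_of_pos_on_Ioo {g : ℝ → ℝ} (hg : Integrable g) (h0 : ∀ x, 0 ≤ g x) {p q : ℝ}
    (hpq : p < q) (hpos : ∀ x ∈ Set.Ioo p q, 0 < g x) : 0 < ∫ x, g x := by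
  rw [integral_pos_iff_support_of_nonneg h0 hg]
  refine lt_of_lt_of_le ?_ (measure_mono (show Set.Ioo p q ⊆ Function.support g from
    fun x hx => (hpos x hx).ne'))
  simpa using hpq

/-- The indicator function of `[p, q]`. -/
noncomputable def indC (p q : ℝ) : ℝ → ℂ := (Set.Icc p q).indicator fun _ => 1

theorem indC_of_mem {p q x : ℝ} (h : x ∈ Set.Icc p q) : indC p q x = 1 :=
  Set.indicator_of_mem h _

theorem indC_of_notMem {p q x : ℝ} (h : x ∉ Set.Icc p q) : indC p q x = 0 :=
  Set.indicator_of_notMem h _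

theorem integrable_indC (p q : ℝ) : Integrable (indC p q) :=
  (integrable_indicator_iff measurableSet_Icc).2 (integrableOn_const measure_Icc_lt_top.ne)

theorem memLp_indC (p q : ℝ) : MemLp (indC p q) 2 volume :=
  memLp_indicator_const 2 measurableSet_Icc 1 (Or.inr measure_Icc_lt_top.ne)

theorem indC_eq_ofReal (p q : ℝ) :
    indC p q = fun x => (((Set.Icc p q).indicator (fun _ => (1 : ℝ)) x : ℝ) : ℂ) := by
  funext x
  by_cases hx : x ∈ Set.Icc p q
  · simp [indC, hx]
  · simp [indC, hx]

theorem cauchyInt_indC {p q : ℝ} (hpq : p ≤ q) (z : ℂ) :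
    cauchyInt (indC p q) z = ∫ x in p..q, ((x : ℂ) - z)⁻¹ := by
  rw [intervalIntegral.integral_of_le hpq, ← integral_Icc_eq_integral_Ioc,
    ← integral_indicator measurableSet_Icc, cauchyInt]
  congr 1
  funext x
  by_cases hx : x ∈ Set.Icc p q
  · simp [indC, hx]
  · simp [indC, hx]

theorem cauchyInt_indC_of_im {p q : ℝ} (hpq : p ≤ q) {z : ℂ} (hz : z.im ≠ 0) :
    cauchyInt (indC p q) z = Complex.log (q - z) - Complex.log (p - z) := by
  rw [cauchyInt_indC hpq, intervalIntegral_inv_sub hz]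

theorem cauchyInt_indC_eq_log_add {p q : ℝ} (hpq : p ≤ q) {z : ℂ} (hz : z.im ≠ 0) :
    cauchyInt (indC p q) z
      = Complex.log (q - z) - Complex.log (z - p) + halfPlaneConst z := by
  have h1 : (p : ℂ) - z = -(z - p) := by ring
  have h2 : (z - (p : ℂ)).im = z.im := by simp
  rw [cauchyInt_indC_of_im hpq hz, h1, log_neg_eq (by rwa [h2]), halfPlaneConst, halfPlaneConst,
    h2]
  ring

/-- The Cauchy transform of a real function at a real point. -/
theorem cauchyInt_ofReal (r : ℝ → ℝ) (k : ℝ) :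
    cauchyInt (fun x => (r x : ℂ)) k = ((∫ x, r x / (x - k) : ℝ) : ℂ) := by
  rw [cauchyInt, ← integral_complex_ofReal]
  congr 1
  funext x
  push_cast
  rfl

theorem cauchyInt_ofReal_conj (r : ℝ → ℝ) (z : ℂ) :
    cauchyInt (fun x => (r x : ℂ)) (conj z) = conj (cauchyInt (fun x => (r x : ℂ)) z) := by
  rw [cauchyInt, cauchyInt, ← integral_conj]
  congr 1
  funext x
  simp

/-- The Cauchy transform of a nonnegative function has no zeros off the real line. -/
theorem cauchyInt_ofReal_ne_zero {r : ℝ → ℝ} (hr : Integrable r) (h0 : ∀ x, 0 ≤ r x) {p q : ℝ}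
    (hpq : p < q) (hpos : ∀ x ∈ Set.Ioo p q, 0 < r x) {z : ℂ} (hz : z.im ≠ 0) :
    cauchyInt (fun x => (r x : ℂ)) z ≠ 0 := by
  have hint := integrable_div_of_im (hr.ofReal (𝕜 := ℂ)) hz
  -- The imaginary part of the integrand has the sign of `Im z` wherever `r > 0`, so there is no
  -- cancellation.
  have him : ∀ x : ℝ, ((r x : ℂ) / ((x : ℂ) - z)).im
      = z.im * (r x * (Complex.normSq ((x : ℂ) - z))⁻¹) := fun x => by
    rw [Complex.div_im]
    simp
    ring
  have hint' : Integrable fun x : ℝ => r x * (Complex.normSq ((x : ℂ) - z))⁻¹ := by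
    have h1 := (hint.im).const_mul z.im⁻¹
    refine h1.congr (Eventually.of_forall fun x => ?_)
    change z.im⁻¹ * ((r x : ℂ) / ((x : ℂ) - z)).im = _
    rw [him, inv_mul_cancel_left₀ hz]
  have hpos' : 0 < ∫ x : ℝ, r x * (Complex.normSq ((x : ℂ) - z))⁻¹ := by
    refine integral_pos_of_pos_on_Ioo hint' (fun x => ?_) hpq fun x hx => ?_
    · exact mul_nonneg (h0 x) (inv_nonneg.2 (Complex.normSq_nonneg _))
    · exact mul_pos (hpos x hx) (inv_pos.2 (Complex.normSq_pos.2 (ofReal_sub_ne_zero hz x)))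
  intro hc
  have h2 : (cauchyInt (fun x => (r x : ℂ)) z).im
      = z.im * ∫ x : ℝ, r x * (Complex.normSq ((x : ℂ) - z))⁻¹ := by
    rw [← integral_const_mul]
    simp only [← him]
    exact (integral_im hint).symm
  rw [hc, Complex.zero_im] at h2
  exact mul_ne_zero hz hpos'.ne' h2.symm

/-- To the right of the support the kernel `1/(x - k)` is negative. Applied to `ψ`, this sign keeps
`1 - ψ̂` away from zero on `I`. -/
theorem cauchyInt_ofReal_neg {r : ℝ → ℝ} (hr : Integrable r) (h0 : ∀ x, 0 ≤ r x) {p q k : ℝ}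
    (hpq : p < q) (hpos : ∀ x ∈ Set.Ioo p q, 0 < r x) (hsupp : ∀ x, x ∉ Set.Icc p q → r x = 0)
    (hk : q < k) : ∃ s : ℝ, s < 0 ∧ cauchyInt (fun x => (r x : ℂ)) k = s := by
  refine ⟨_, ?_, cauchyInt_ofReal r k⟩
  have haway : AwayFrom (fun x => (r x : ℂ)) k (k - q) := by
    refine Eventually.of_forall fun x => or_iff_not_imp_left.2 fun hx => ?_
    have hmem : x ∈ Set.Icc p q := by
      by_contra h
      exact hx (by simp [hsupp x h])
    rw [← Complex.ofReal_sub, Complex.norm_real, Real.norm_eq_abs, abs_sub_comm]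
    exact (by linarith [hmem.2] : k - q ≤ k - x).trans (le_abs_self _)
  have hint : Integrable fun x : ℝ => r x / (x - k) := by
    have h1 := ((cauchyIntegrable_of_integrable (hr.ofReal (𝕜 := ℂ))).integrable_div
      (sub_pos.2 hk) haway).re
    refine h1.congr (Eventually.of_forall fun x => ?_)
    change ((r x : ℂ) / ((x : ℂ) - k)).re = _
    rw [← Complex.ofReal_sub, ← Complex.ofReal_div, Complex.ofReal_re]
  rw [← neg_pos, ← integral_neg]
  refine integral_pos_of_pos_on_Ioo hint.neg (fun x => ?_) hpq fun x hx => ?_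
  · by_cases hmem : x ∈ Set.Icc p q
    · rw [← div_neg, neg_sub]
      exact div_nonneg (h0 x) (by linarith [hmem.2])
    · simp [hsupp x hmem]
  · rw [← div_neg, neg_sub]
    exact div_pos (hpos x hx) (by linarith [hx.2])

theorem integral_inv_sub_pos {a b x : ℝ} (hab : a < b) (hx : x < a) :
    0 < ∫ t in a..b, 1 / (t - x) := by
  refine intervalIntegral.intervalIntegral_pos_of_pos_on ?_ (fun t ht => ?_) hab
  · refine ContinuousOn.intervalIntegrable fun t ht => ?_
    rw [Set.uIcc_of_le hab.le] at ht
    refine ContinuousAt.continuousWithinAt (ContinuousAt.div (by fun_prop) (by fun_prop) ?_)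
    linarith [ht.1]
  · exact one_div_pos.2 (by linarith [ht.1])

theorem cauchyInt_indC_ofReal {a b : ℝ} (hab : a ≤ b) (x : ℝ) :
    cauchyInt (indC a b) x = ((∫ t in a..b, 1 / (t - x) : ℝ) : ℂ) := by
  rw [cauchyInt_indC hab, ← intervalIntegral.integral_ofReal]
  refine intervalIntegral.integral_congr fun t _ => ?_
  simp

theorem awayFrom_of_support {f : ℝ → ℂ} {p q k : ℝ} (hf : ∀ x, x ∉ Set.Icc p q → f x = 0)
    (hk : k ∉ Set.Icc p q) : ∃ δ > 0, AwayFrom f k δ := by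
  obtain ⟨δ, hδ, hball⟩ := Metric.isOpen_iff.1 isClosed_Icc.isOpen_compl k hk
  refine ⟨δ, hδ, Eventually.of_forall fun x => or_iff_not_imp_right.2 fun hx => hf x ?_⟩
  refine hball ?_
  rw [not_le, ← Complex.ofReal_sub, Complex.norm_real] at hx
  rwa [Metric.mem_ball, dist_eq_norm]

theorem analyticAt_cauchyInt_of_support {f : ℝ → ℂ} (hf : CauchyIntegrable f) {p q k : ℝ}
    (hsupp : ∀ x, x ∉ Set.Icc p q → f x = 0) (hk : k ∉ Set.Icc p q) :
    AnalyticAt ℂ (cauchyInt f) k := by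
  obtain ⟨δ, hδ, h⟩ := awayFrom_of_support hsupp hk
  exact hf.analyticAt hδ h

theorem apart_of_support {f h : ℝ → ℂ} {a' b' a b : ℝ} (hf : ∀ x, x ∉ Set.Icc a b → f x = 0)
    (hh : ∀ x, x ∉ Set.Icc a' b' → h x = 0) : Apart f h (a - b') := fun t x ht hx => by
  have h1 : t ∈ Set.Icc a b := by
    by_contra h
    exact ht (hf t h)
  have h2 : x ∈ Set.Icc a' b' := by
    by_contra h
    exact hx (hh x h)
  rw [abs_sub_comm]
  exact (by linarith [h1.1, h2.2] : a - b' ≤ t - x).trans (le_abs_self _)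

/-! ### The model functions `φ` and `ψ`. -/

/-- The real-valued weight whose Cauchy transform enters the model. -/
noncomputable def weight (a' b' a b x : ℝ) : ℝ :=
  (Set.Icc a' b').indicator (fun x => (∫ t in a..b, 1 / (t - x))⁻¹) x

/-- The function `ψ` of the model. -/
noncomputable def psiFun (a' b' a b x : ℝ) : ℂ := (weight a' b' a b x : ℂ)

/-- The standing assumptions on the intervals and on `φ`, `ψ`. -/
structure Model (a' b' a b : ℝ) (φ ψ : L2) : Prop where
  lt' : a' < b'
  gap : b' < a
  lt : a < b
  left : φ =ᵐ[volume] indC a b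
  right : ψ =ᵐ[volume] psiFun a' b' a b

section Model

variable {a' b' a b : ℝ} {φ ψ : L2}

theorem weight_support (a' b' a b x : ℝ) (hx : x ∉ Set.Icc a' b') :
    weight a' b' a b x = 0 := Set.indicator_of_notMem hx _

theorem psiFun_support (a' b' a b x : ℝ) (hx : x ∉ Set.Icc a' b') : psiFun a' b' a b x = 0 := by
  rw [psiFun, weight_support _ _ _ _ _ hx, Complex.ofReal_zero]

theorem indC_support (a b x : ℝ) (hx : x ∉ Set.Icc a b) : indC a b x = 0 := indC_of_notMem hx

theorem Model.weight_pos (M : Model a' b' a b φ ψ) {x : ℝ} (hx : x ∈ Set.Icc a' b') :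
    0 < weight a' b' a b x := by
  rw [weight, Set.indicator_of_mem hx]
  exact inv_pos.2 (integral_inv_sub_pos M.lt (hx.2.trans_lt M.gap))

theorem Model.weight_nonneg (M : Model a' b' a b φ ψ) (x : ℝ) : 0 ≤ weight a' b' a b x := by
  by_cases hx : x ∈ Set.Icc a' b'
  · exact (M.weight_pos hx).le
  · rw [weight_support _ _ _ _ _ hx]

/-- The reason for the choice of `ψ`: on `I'` it is the reciprocal of `φ̂`. -/
theorem Model.psiFun_mul (M : Model a' b' a b φ ψ) {x : ℝ} (hx : x ∈ Set.Icc a' b') :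
    psiFun a' b' a b x * cauchyInt (indC a b) x = 1 := by
  rw [psiFun, weight, Set.indicator_of_mem hx, cauchyInt_indC_ofReal M.lt.le,
    ← Complex.ofReal_mul,
    inv_mul_cancel₀ (integral_inv_sub_pos M.lt (hx.2.trans_lt M.gap)).ne', Complex.ofReal_one]

theorem Model.memLp_psiFun (M : Model a' b' a b φ ψ) : MemLp (psiFun a' b' a b) 2 volume :=
  (Lp.memLp ψ).ae_eq M.right

theorem integrable_of_support {f : ℝ → ℂ} (hf : MemLp f 2 volume) {p q : ℝ}
    (hsupp : ∀ x, x ∉ Set.Icc p q → f x = 0) : Integrable f := by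
  refine (hf.integrable_mul (memLp_indC p q)).congr (Eventually.of_forall fun x => ?_)
  by_cases hx : x ∈ Set.Icc p q
  · simp [indC_of_mem hx]
  · simp [hsupp x hx]

theorem Model.integrable_psiFun (M : Model a' b' a b φ ψ) : Integrable (psiFun a' b' a b) :=
  integrable_of_support M.memLp_psiFun (psiFun_support a' b' a b)

theorem Model.integrable_weight (M : Model a' b' a b φ ψ) : Integrable (weight a' b' a b) :=
  M.integrable_psiFun.re

theorem Model.cauchyInt_conj_left (M : Model a' b' a b φ ψ) (z : ℂ) :
    cauchyInt (fun x => conj (φ x)) z = cauchyInt (indC a b) z := by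
  refine cauchyInt_congr ?_ z
  filter_upwards [M.left] with x hx
  rw [hx, indC_eq_ofReal, Complex.conj_ofReal]

theorem Model.cauchyInt_left (M : Model a' b' a b φ ψ) (z : ℂ) :
    cauchyInt φ z = cauchyInt (indC a b) z := cauchyInt_congr M.left z

theorem Model.cauchyInt_conj_right (M : Model a' b' a b φ ψ) (z : ℂ) :
    cauchyInt (fun x => conj (ψ x)) z = cauchyInt (psiFun a' b' a b) z := by
  refine cauchyInt_congr ?_ z
  filter_upwards [M.right] with x hx
  rw [hx, psiFun, Complex.conj_ofReal]

theorem Model.cauchyInt_right (M : Model a' b' a b φ ψ) (z : ℂ) :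
    cauchyInt ψ z = cauchyInt (psiFun a' b' a b) z := cauchyInt_congr M.right z

theorem Model.disjointSupport (M : Model a' b' a b φ ψ) : DisjointSupport φ ψ := by
  filter_upwards [M.left, M.right] with x h1 h2
  by_cases hx : x ∈ Set.Icc a b
  · refine Or.inr ?_
    rw [h2, psiFun_support]
    exact fun h => absurd (hx.1.trans h.2) (not_le.2 M.gap)
  · exact Or.inl (by rw [h1, indC_of_notMem hx])

theorem Model.cauchyInt_indC_ne_zero (M : Model a' b' a b φ ψ) {z : ℂ} (hz : z.im ≠ 0) :
    cauchyInt (indC a b) z ≠ 0 := by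
  rw [indC_eq_ofReal]
  refine cauchyInt_ofReal_ne_zero
    ((integrable_indicator_iff measurableSet_Icc).2 (integrableOn_const measure_Icc_lt_top.ne))
    (fun x => Set.indicator_nonneg (fun _ _ => zero_le_one) x) M.lt (fun x hx => ?_) hz
  rw [Set.indicator_of_mem (Set.Ioo_subset_Icc_self hx)]
  exact zero_lt_one

theorem Model.cauchyInt_psiFun_ne_zero (M : Model a' b' a b φ ψ) {z : ℂ} (hz : z.im ≠ 0) :
    cauchyInt (psiFun a' b' a b) z ≠ 0 :=
  cauchyInt_ofReal_ne_zero M.integrable_weight M.weight_nonneg M.lt'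
    (fun _ hx => M.weight_pos (Set.Ioo_subset_Icc_self hx)) hz

theorem Model.nondegenerate (M : Model a' b' a b φ ψ) : Nondegenerate φ ψ where
  disjointSupport := M.disjointSupport
  left_ne_zero z hz := by rw [M.cauchyInt_conj_left]; exact M.cauchyInt_indC_ne_zero hz
  right_ne_zero z hz := by rw [M.cauchyInt_right]; exact M.cauchyInt_psiFun_ne_zero hz

theorem Model.nondegenerate_swap (M : Model a' b' a b φ ψ) : Nondegenerate ψ φ where
  disjointSupport := M.disjointSupport.symm
  left_ne_zero z hz := by rw [M.cauchyInt_conj_right]; exact M.cauchyInt_psiFun_ne_zero hz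
  right_ne_zero z hz := by rw [M.cauchyInt_left]; exact M.cauchyInt_indC_ne_zero hz

theorem Model.weylDenom_eq (M : Model a' b' a b φ ψ) (B z : ℂ) :
    weylDenom φ ψ B z
      = halfPlaneConst z - B - cauchyInt (indC a b) z * cauchyInt (psiFun a' b' a b) z := by
  rw [weylDenom, M.cauchyInt_conj_left, M.cauchyInt_right]

theorem Model.cauchyInt_psiFun_neg (M : Model a' b' a b φ ψ) {k : ℝ} (hk : b' < k) :
    ∃ s : ℝ, s < 0 ∧ cauchyInt (psiFun a' b' a b) k = s :=
  cauchyInt_ofReal_neg M.integrable_weight M.weight_nonneg M.lt'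
    (fun _ hx => M.weight_pos (Set.Ioo_subset_Icc_self hx))
    (fun x hx => weight_support _ _ _ _ x hx) hk

/-- The product of the Cauchy transforms of a function on `I` and a function on `I'`. -/
theorem Model.cauchyInt_mul (M : Model a' b' a b φ ψ) {f h : ℝ → ℂ} (hf : Integrable f)
    (hh : Integrable h) (hfs : ∀ x, x ∉ Set.Icc a b → f x = 0)
    (hhs : ∀ x, x ∉ Set.Icc a' b' → h x = 0) {z : ℂ} (hz : z.im ≠ 0) :
    cauchyInt f z * cauchyInt h z = cauchyInt (fun t => f t * cauchyInt h t) z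
      + cauchyInt (fun x => h x * cauchyInt f x) z :=
  (apart_of_support hfs hhs).cauchyInt_mul_cauchyInt (sub_pos.2 M.gap) hf hh hz

theorem Model.integrable_mul_cauchyInt (M : Model a' b' a b φ ψ) {f h : ℝ → ℂ} (hf : Integrable f)
    (hh : Integrable h) (hfs : ∀ x, x ∉ Set.Icc a b → f x = 0)
    (hhs : ∀ x, x ∉ Set.Icc a' b' → h x = 0) :
    Integrable (fun t : ℝ => f t * cauchyInt h t) :=
  (apart_of_support hfs hhs).integrable_mul_cauchyInt (sub_pos.2 M.gap) hf hh

theorem Model.integrable_mul_cauchyInt' (M : Model a' b' a b φ ψ) {f h : ℝ → ℂ}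
    (hf : Integrable f) (hh : Integrable h) (hfs : ∀ x, x ∉ Set.Icc a b → f x = 0)
    (hhs : ∀ x, x ∉ Set.Icc a' b' → h x = 0) :
    Integrable (fun t : ℝ => h t * cauchyInt f t) :=
  (apart_of_support hfs hhs).symm.integrable_mul_cauchyInt (sub_pos.2 M.gap) hh hf

/-- The part of the product `φ̂ ψ̂` that is analytic away from `I`. -/
noncomputable def outerDensity (a' b' a b t : ℝ) : ℂ :=
  indC a b t * cauchyInt (psiFun a' b' a b) t

theorem outerDensity_support (a' b' a b t : ℝ) (ht : t ∉ Set.Icc a b) :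
    outerDensity a' b' a b t = 0 := by
  rw [outerDensity, indC_of_notMem ht, zero_mul]

theorem Model.integrable_outerDensity (M : Model a' b' a b φ ψ) :
    Integrable (outerDensity a' b' a b) :=
  M.integrable_mul_cauchyInt (integrable_indC a b) M.integrable_psiFun (indC_support a b)
    (psiFun_support a' b' a b)

/-- Because `ψ φ̂ = χ_{I'}`, the part of the product carried by `I'` is the transform of an
indicator function. Its jump across `I'` is exactly that of `±πi`; the other part is analytic there.
-/
theorem Model.cauchyInt_mul_psiFun (M : Model a' b' a b φ ψ) {z : ℂ} (hz : z.im ≠ 0) :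
    cauchyInt (indC a b) z * cauchyInt (psiFun a' b' a b) z
      = cauchyInt (outerDensity a' b' a b) z + cauchyInt (indC a' b') z := by
  rw [M.cauchyInt_mul (integrable_indC a b) M.integrable_psiFun (indC_support a b)
    (psiFun_support a' b' a b) hz]
  have h1 : (fun x : ℝ => psiFun a' b' a b x * cauchyInt (indC a b) x) = indC a' b' := by
    funext x
    by_cases hx : x ∈ Set.Icc a' b'
    · rw [M.psiFun_mul hx, indC_of_mem hx]
    · rw [psiFun_support _ _ _ _ _ hx, indC_of_notMem hx, zero_mul]
  rw [h1]
  rfl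

end Model

/-! ### One-sided approach to the real axis and analytic continuation across it. -/

section Path

variable {ω : ℂ}

theorem add_mul_mem_sameSide (hω : ω = Complex.I ∨ ω = -Complex.I) (k : ℝ) {ε : ℝ} (hε : 0 < ε) :
    (k : ℂ) + ε * ω ∈ sameSide ω := by
  change 0 < ((k : ℂ) + ε * ω).im * ω.im
  rcases hω with rfl | rfl <;> simpa using hε

theorem add_mul_im_ne_zero (hω : ω = Complex.I ∨ ω = -Complex.I) (k : ℝ) {ε : ℝ} (hε : 0 < ε) :
    ((k : ℂ) + ε * ω).im ≠ 0 :=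
  im_ne_zero_of_mem_sameSide (add_mul_mem_sameSide hω k hε)

theorem tendsto_add_mul (ω : ℂ) (k : ℝ) :
    Tendsto (fun ε : ℝ => (k : ℂ) + ε * ω) (𝓝[>] 0) (𝓝 (k : ℂ)) := by
  have h : Continuous fun ε : ℝ => (k : ℂ) + ε * ω := by fun_prop
  have h1 := h.tendsto 0
  simp only [Complex.ofReal_zero, zero_mul, add_zero] at h1
  exact h1.mono_left nhdsWithin_le_nhds

theorem tendsto_add_mul_punctured (hω : ω = Complex.I ∨ ω = -Complex.I) (k : ℝ) :
    Tendsto (fun ε : ℝ => (k : ℂ) + ε * ω) (𝓝[>] 0) (𝓝[≠] (k : ℂ)) := by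
  refine tendsto_nhdsWithin_iff.2 ⟨tendsto_add_mul ω k, ?_⟩
  filter_upwards [self_mem_nhdsWithin] with ε hε h
  have h1 := add_mul_im_ne_zero hω k (Set.mem_Ioi.1 hε)
  rw [Set.mem_singleton_iff.1 h] at h1
  simp at h1

theorem sub_mul_I (k ε : ℝ) : (k : ℂ) - ε * Complex.I = k + ε * (-Complex.I) := by ring

theorem hasLowerValue_iff {f : ℂ → ℂ} {k : ℝ} {p : ℂ} : HasLowerValue f k p ↔
    Tendsto (fun ε : ℝ => f (k + ε * (-Complex.I))) (𝓝[>] 0) (𝓝 p) := by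
  simp only [HasLowerValue, sub_mul_I]

theorem hasJump_of_tendsto {f : ℂ → ℂ} {k : ℝ} {p q : ℂ}
    (hp : Tendsto (fun ε : ℝ => f (k + ε * Complex.I)) (𝓝[>] 0) (𝓝 p))
    (hq : Tendsto (fun ε : ℝ => f (k + ε * (-Complex.I))) (𝓝[>] 0) (𝓝 q)) :
    HasJump f k (p - q) := by
  simp only [HasJump, sub_mul_I]
  exact hp.sub hq

end Path

/-- From the side of `ω`, the function `f` agrees near `k` with the function `E`, which is analytic
at `k`. -/
def SideExtension (f : ℂ → ℂ) (ω : ℂ) (k : ℝ) (E : ℂ → ℂ) : Prop :=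
  AnalyticAt ℂ E k ∧ ∀ᶠ z in 𝓝 (k : ℂ), z ∈ sameSide ω → f z = E z

section SideExtension

variable {f E : ℂ → ℂ} {ω : ℂ} {k : ℝ}

theorem SideExtension.tendsto (h : SideExtension f ω k E) (hω : ω = Complex.I ∨ ω = -Complex.I) :
    Tendsto (fun ε : ℝ => f (k + ε * ω)) (𝓝[>] 0) (𝓝 (E k)) := by
  refine (h.1.continuousAt.tendsto.comp (tendsto_add_mul ω k)).congr' ?_
  filter_upwards [(tendsto_add_mul ω k).eventually h.2, self_mem_nhdsWithin] with ε h1 hε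
  exact (h1 (add_mul_mem_sameSide hω k hε)).symm

/-- Zeros of the analytic `E` are isolated unless `E` vanishes near `k`. In that case `f` would
vanish on an open piece of the half plane, hence on all of it. -/
theorem SideExtension.eventually_ne_zero (h : SideExtension f ω k E)
    (hω : ω = Complex.I ∨ ω = -Complex.I) (hf : ∀ z : ℂ, z.im ≠ 0 → AnalyticAt ℂ f z)
    (hne : ∃ w ∈ sameSide ω, f w ≠ 0) : ∀ᶠ z in 𝓝[≠] (k : ℂ), E z ≠ 0 := by
  refine h.1.eventually_eq_zero_or_eventually_ne_zero.resolve_left fun h0 => ?_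
  obtain ⟨w, hw, hfw⟩ := hne
  have h1 : ∀ᶠ z in 𝓝 (k : ℂ), z ∈ sameSide ω → f z = 0 := by
    filter_upwards [h.2, h0] with z h2 h3 hz
    rw [h2 hz, h3]
  have h4 := (tendsto_add_mul ω k).eventually (eventually_eventually_nhds.2 h1)
  obtain ⟨ε, h5, hε⟩ := (h4.and self_mem_nhdsWithin).exists
  have hside := add_mul_mem_sameSide hω k hε
  refine hfw (eq_zero_of_eventually_eq_zero hf (im_ne_zero_of_mem_sameSide hw)
    (w := (k : ℂ) + ε * ω) ?_ ?_)
  · have e1 : 0 < w.im * ω.im := hw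
    have e2 : 0 < ((k : ℂ) + ε * ω).im * ω.im := hside
    change 0 < ((k : ℂ) + ε * ω).im * w.im
    by_contra h6
    nlinarith [mul_pos e1 e2, mul_nonneg (sub_nonneg.2 (not_lt.1 h6)) (sq_nonneg ω.im)]
  · filter_upwards [h5, (isOpen_sameSide ω).mem_nhds hside] with z h6 h7
    exact h6 h7

theorem SideExtension.congr_point (h : SideExtension f ω k E) :
    ∀ᶠ x : ℝ in 𝓝 k, SideExtension f ω x E := by
  have h1 : ∀ᶠ z in 𝓝 (k : ℂ), AnalyticAt ℂ E z ∧ ∀ᶠ w in 𝓝 z, w ∈ sameSide ω → f w = E w :=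
    h.1.eventually_analyticAt.and (eventually_eventually_nhds.2 h.2)
  exact (Complex.continuous_ofReal.tendsto k).eventually h1

end SideExtension

/-- The logarithm of `(q - z) / (z - p)`, analytic on the strip `p < Re z < q`. -/
noncomputable def logQuot (p q : ℝ) (z : ℂ) : ℂ := Complex.log (q - z) - Complex.log (z - p)

theorem analyticAt_logQuot {p q k : ℝ} (hk : k ∈ Set.Ioo p q) : AnalyticAt ℂ (logQuot p q) k := by
  refine AnalyticAt.sub (AnalyticAt.clog (by fun_prop) (Or.inl ?_))
    (AnalyticAt.clog (by fun_prop) (Or.inl ?_))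
  · simpa using hk.2
  · simpa using hk.1

theorem cauchyInt_indC_eq_logQuot {p q : ℝ} (hpq : p ≤ q) {z ω : ℂ} (hz : z ∈ sameSide ω) :
    cauchyInt (indC p q) z = logQuot p q z + halfPlaneConst ω := by
  rw [cauchyInt_indC_eq_log_add hpq (im_ne_zero_of_mem_sameSide hz),
    halfPlaneConst_of_mem_sameSide hz, logQuot]

/-! ### Boundary values and jumps of the `M`-function. -/

section Model

variable {a' b' a b : ℝ} {φ ψ : L2} {k : ℝ}

theorem Model.sideExtension_gap (M : Model a' b' a b φ ψ) (B ω : ℂ) (hk : k ∉ Set.Icc a b)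
    (hk' : k ∉ Set.Icc a' b') : SideExtension (weylDenom φ ψ B) ω k (fun z =>
      halfPlaneConst ω - B - cauchyInt (indC a b) z * cauchyInt (psiFun a' b' a b) z) := by
  refine ⟨analyticAt_const.sub ((analyticAt_cauchyInt_of_support
    (cauchyIntegrable_of_integrable (integrable_indC a b)) (indC_support a b) hk).mul
    (analyticAt_cauchyInt_of_support (cauchyIntegrable_of_integrable M.integrable_psiFun)
      (psiFun_support a' b' a b) hk')), Eventually.of_forall fun z hz => ?_⟩
  rw [M.weylDenom_eq, halfPlaneConst_of_mem_sameSide hz]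

/-- On `(a, b)`, seen from one side, `φ̂` is a logarithm analytic across the axis plus the constant
`±πi`; `ψ̂` is analytic there. -/
theorem Model.sideExtension_right (M : Model a' b' a b φ ψ) (B ω : ℂ) (hk : k ∈ Set.Ioo a b) :
    SideExtension (weylDenom φ ψ B) ω k (fun z => halfPlaneConst ω - B
      - (logQuot a b z + halfPlaneConst ω) * cauchyInt (psiFun a' b' a b) z) := by
  have hk' : k ∉ Set.Icc a' b' := fun h => by linarith [hk.1, h.2, M.gap]
  refine ⟨analyticAt_const.sub (((analyticAt_logQuot hk).add analyticAt_const).mul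
    (analyticAt_cauchyInt_of_support (cauchyIntegrable_of_integrable M.integrable_psiFun)
      (psiFun_support a' b' a b) hk')), Eventually.of_forall fun z hz => ?_⟩
  rw [M.weylDenom_eq, halfPlaneConst_of_mem_sameSide hz, cauchyInt_indC_eq_logQuot M.lt.le hz]

/-- The two constants `±πi` cancel, so the continuation is the same from both sides. -/
theorem Model.sideExtension_left (M : Model a' b' a b φ ψ) (B ω : ℂ) (hk : k ∈ Set.Ioo a' b') :
    SideExtension (weylDenom φ ψ B) ω k (fun z => -B
      - (cauchyInt (outerDensity a' b' a b) z + logQuot a' b' z)) := by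
  have hk' : k ∉ Set.Icc a b := fun h => by linarith [hk.2, h.1, M.gap]
  refine ⟨analyticAt_const.sub ((analyticAt_cauchyInt_of_support
    (cauchyIntegrable_of_integrable M.integrable_outerDensity) (outerDensity_support a' b' a b)
      hk').add (analyticAt_logQuot hk)), Eventually.of_forall fun z hz => ?_⟩
  rw [M.weylDenom_eq, halfPlaneConst_of_mem_sameSide hz,
    M.cauchyInt_mul_psiFun (im_ne_zero_of_mem_sameSide hz), cauchyInt_indC_eq_logQuot M.lt'.le hz]
  ring

theorem halfPlaneConst_I : halfPlaneConst Complex.I = Real.pi * Complex.I := by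
  simp [halfPlaneConst]

theorem halfPlaneConst_neg_I : halfPlaneConst (-Complex.I) = -(Real.pi * Complex.I) := by
  simp [halfPlaneConst]

/-- The denominator of the `M`-function extends analytically to the real axis from both sides,
except at the endpoints of the intervals. -/
theorem Model.exists_sideExtension (M : Model a' b' a b φ ψ) (B : ℂ)
    (hk : k ∉ ({a', b', a, b} : Set ℝ)) : ∃ E F : ℂ → ℂ,
      SideExtension (weylDenom φ ψ B) Complex.I k E ∧
      SideExtension (weylDenom φ ψ B) (-Complex.I) k F ∧
      (k ∉ Set.Icc a b ∪ Set.Icc a' b' → E k - F k = 2 * Real.pi * Complex.I) ∧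
      (k ∈ Set.Ioo a b →
        E k - F k = 2 * Real.pi * Complex.I * (1 - cauchyInt (psiFun a' b' a b) k)) ∧
      (k ∈ Set.Ioo a' b' → E k - F k = 0) := by
  simp only [Set.mem_insert_iff, Set.mem_singleton_iff, not_or] at hk
  obtain ⟨h1, h2, h3, h4⟩ := hk
  by_cases hI : k ∈ Set.Icc a b
  · have hI' : k ∈ Set.Ioo a b := ⟨lt_of_le_of_ne hI.1 (Ne.symm h3), lt_of_le_of_ne hI.2 h4⟩
    refine ⟨_, _, M.sideExtension_right B _ hI', M.sideExtension_right B _ hI',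
      fun h => absurd (Or.inl hI) h, fun _ => ?_, fun h => ?_⟩
    · simp only [halfPlaneConst_I, halfPlaneConst_neg_I]
      ring
    · linarith [h.2, hI.1, M.gap]
  by_cases hJ : k ∈ Set.Icc a' b'
  · have hJ' : k ∈ Set.Ioo a' b' := ⟨lt_of_le_of_ne hJ.1 (Ne.symm h1), lt_of_le_of_ne hJ.2 h2⟩
    exact ⟨_, _, M.sideExtension_left B _ hJ', M.sideExtension_left B _ hJ',
      fun h => absurd (Or.inr hJ) h, fun h => absurd (Set.Ioo_subset_Icc_self h) hI,
      fun _ => sub_self _⟩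
  · refine ⟨_, _, M.sideExtension_gap B _ hI hJ, M.sideExtension_gap B _ hI hJ, fun _ => ?_,
      fun h => absurd (Set.Ioo_subset_Icc_self h) hI,
      fun h => absurd (Set.Ioo_subset_Icc_self h) hJ⟩
    simp only [halfPlaneConst_I, halfPlaneConst_neg_I]
    ring

theorem I_sign : Complex.I = Complex.I ∨ Complex.I = -Complex.I := Or.inl rfl

theorem neg_I_sign : -Complex.I = Complex.I ∨ -Complex.I = -Complex.I := Or.inr rfl

theorem Nondegenerate.exists_sameSide_ne (h : Nondegenerate φ ψ) (B : ℂ) {ω : ℂ}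
    (hω : ω = Complex.I ∨ ω = -Complex.I) : ∃ w ∈ sameSide ω, weylDenom φ ψ B w ≠ 0 :=
  h.exists_weylDenom_ne_zero B (by rcases hω with rfl | rfl <;> simp)

theorem SideExtension.eventually_weylDenom_ne_zero {B ω : ℂ} {E : ℂ → ℂ}
    (h : SideExtension (weylDenom φ ψ B) ω k E) (hn : Nondegenerate φ ψ)
    (hω : ω = Complex.I ∨ ω = -Complex.I) :
    ∀ᶠ ε : ℝ in 𝓝[>] 0, weylDenom φ ψ B (k + ε * ω) ≠ 0 := by
  have h1 := h.eventually_ne_zero hω (fun z hz => analyticAt_weylDenom φ ψ B hz)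
    (hn.exists_sameSide_ne B hω)
  filter_upwards [(tendsto_add_mul_punctured hω k).eventually h1,
    (tendsto_add_mul ω k).eventually h.2, self_mem_nhdsWithin] with ε h2 h3 hε
  rwa [h3 (add_mul_mem_sameSide hω k hε)]

theorem SideExtension.eventually_mFunction_eq {B ω : ℂ} {E : ℂ → ℂ}
    (h : SideExtension (weylDenom φ ψ B) ω k E) (hn : Nondegenerate φ ψ)
    (hω : ω = Complex.I ∨ ω = -Complex.I) :
    ∀ᶠ ε : ℝ in 𝓝[>] 0,
      mFunction φ ψ B (k + ε * ω) = (weylDenom φ ψ B (k + ε * ω))⁻¹ := by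
  filter_upwards [h.eventually_weylDenom_ne_zero hn hω, self_mem_nhdsWithin] with ε h1 hε
  exact hn.disjointSupport.mFunction_eq (add_mul_im_ne_zero hω k hε) h1

theorem SideExtension.tendsto_inv_mFunction {B ω : ℂ} {E : ℂ → ℂ}
    (h : SideExtension (weylDenom φ ψ B) ω k E) (hn : Nondegenerate φ ψ)
    (hω : ω = Complex.I ∨ ω = -Complex.I) :
    Tendsto (fun ε : ℝ => (mFunction φ ψ B (k + ε * ω))⁻¹) (𝓝[>] 0) (𝓝 (E k)) := by
  refine (h.tendsto hω).congr' ?_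
  filter_upwards [h.eventually_mFunction_eq hn hω] with ε hε
  rw [hε, inv_inv]

theorem SideExtension.tendsto_mFunction {B ω : ℂ} {E : ℂ → ℂ}
    (h : SideExtension (weylDenom φ ψ B) ω k E) (hn : Nondegenerate φ ψ)
    (hω : ω = Complex.I ∨ ω = -Complex.I) (h0 : E k ≠ 0) :
    Tendsto (fun ε : ℝ => mFunction φ ψ B (k + ε * ω)) (𝓝[>] 0) (𝓝 (E k)⁻¹) := by
  refine ((h.tendsto hω).inv₀ h0).congr' ?_
  filter_upwards [h.eventually_mFunction_eq hn hω] with ε hε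
  rw [hε]

/-- In particular a finite boundary value of `M_B` excludes a zero of the continued denominator, and
is itself nonzero. -/
theorem SideExtension.mul_eq_one {B ω p : ℂ} {E : ℂ → ℂ}
    (h : SideExtension (weylDenom φ ψ B) ω k E) (hn : Nondegenerate φ ψ)
    (hω : ω = Complex.I ∨ ω = -Complex.I)
    (hp : Tendsto (fun ε : ℝ => mFunction φ ψ B (k + ε * ω)) (𝓝[>] 0) (𝓝 p)) : p * E k = 1 := by
  refine tendsto_nhds_unique (hp.mul (h.tendsto hω)) (tendsto_const_nhds.congr' ?_)
  filter_upwards [h.eventually_mFunction_eq hn hω, h.eventually_weylDenom_ne_zero hn hω]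
    with ε h1 h2
  rw [h1, inv_mul_cancel₀ h2]

theorem Model.exists_sideExtension_dir (M : Model a' b' a b φ ψ) (B : ℂ) {ω : ℂ}
    (hω : ω = Complex.I ∨ ω = -Complex.I) (hk : k ∉ ({a', b', a, b} : Set ℝ)) :
    ∃ E, SideExtension (weylDenom φ ψ B) ω k E := by
  obtain ⟨E, F, hE, hF, -⟩ := M.exists_sideExtension B hk
  rcases hω with rfl | rfl
  exacts [⟨E, hE⟩, ⟨F, hF⟩]

/-- Away from the four endpoints, a boundary value can fail to exist only at a zero of the continued
denominator, and these zeros are isolated. -/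
theorem Model.ae_exists_boundaryValue (M : Model a' b' a b φ ψ) (B : ℂ) {ω : ℂ}
    (hω : ω = Complex.I ∨ ω = -Complex.I) : ∀ᵐ k : ℝ, ∃ p,
      Tendsto (fun ε : ℝ => mFunction φ ψ B (k + ε * ω)) (𝓝[>] 0) (𝓝 p) := by
  set good : ℝ → Prop := fun k => ∃ p,
    Tendsto (fun ε : ℝ => mFunction φ ψ B (k + ε * ω)) (𝓝[>] 0) (𝓝 p) with hgood
  have hnull : volume {k : ℝ | k ∉ ({a', b', a, b} : Set ℝ) ∧ ¬ good k} = 0 := by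
    -- Each exceptional point has a neighbourhood that contains no other one, so the exceptional set
    -- is locally a singleton.
    refine measure_null_of_locally_null _ fun k hk => ⟨{k}, ?_, Real.volume_singleton⟩
    obtain ⟨E, hE⟩ := M.exists_sideExtension_dir B hω hk.1
    have h1 := hE.eventually_ne_zero hω (fun z hz => analyticAt_weylDenom φ ψ B hz)
      (M.nondegenerate.exists_sameSide_ne B hω)
    rw [eventually_nhdsWithin_iff] at h1
    have h2 := (Complex.continuous_ofReal.tendsto k).eventually h1
    rw [mem_nhdsWithin_iff_eventually]
    filter_upwards [h2, hE.congr_point] with x hx1 hx2 hx3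
    by_contra hne
    have hne' : (x : ℂ) ∈ ({(k : ℂ)}ᶜ : Set ℂ) := fun h => hne (Complex.ofReal_injective h)
    exact hx3.2 ⟨_, hx2.tendsto_mFunction M.nondegenerate hω (hx1 hne')⟩
  have hfin : ∀ᵐ k : ℝ, k ∉ ({a', b', a, b} : Set ℝ) :=
    measure_eq_zero_iff_ae_notMem.1 (Set.Finite.measure_zero (by simp) _)
  filter_upwards [hfin, measure_eq_zero_iff_ae_notMem.1 hnull] with k h1 h2
  by_contra h3
  exact h2 ⟨h1, h3⟩

theorem Model.ae_hasBoundaryValues (M : Model a' b' a b φ ψ) (B : ℂ) :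
    ∀ᵐ k : ℝ, HasBoundaryValues (mFunction φ ψ B) k := by
  filter_upwards [M.ae_exists_boundaryValue B I_sign, M.ae_exists_boundaryValue B neg_I_sign]
    with k ⟨p, hp⟩ ⟨q, hq⟩
  exact ⟨⟨p, hp⟩, q, hasLowerValue_iff.2 hq⟩

theorem Model.eventually_mem_rho (M : Model a' b' a b φ ψ) (B : ℂ)
    (hk : k ∉ ({a', b', a, b} : Set ℝ)) : ∀ᶠ ε : ℝ in 𝓝[>] 0,
      (k : ℂ) + ε * Complex.I ∈ rho (extensionOp φ ψ B) ∧
      (k : ℂ) - ε * Complex.I ∈ rho (extensionOp φ ψ B) := by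
  obtain ⟨E, F, hE, hF, -⟩ := M.exists_sideExtension B hk
  filter_upwards [hE.eventually_weylDenom_ne_zero M.nondegenerate I_sign,
    hF.eventually_weylDenom_ne_zero M.nondegenerate neg_I_sign, self_mem_nhdsWithin] with ε h1 h2 hε
  rw [sub_mul_I]
  exact ⟨M.disjointSupport.mem_rho_iff.2 ⟨add_mul_im_ne_zero I_sign k hε, h1⟩,
    M.disjointSupport.mem_rho_iff.2 ⟨add_mul_im_ne_zero neg_I_sign k hε, h2⟩⟩

theorem hasJump_inv_mFunction {B : ℂ} {E F : ℂ → ℂ} (hn : Nondegenerate φ ψ)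
    (hE : SideExtension (weylDenom φ ψ B) Complex.I k E)
    (hF : SideExtension (weylDenom φ ψ B) (-Complex.I) k F) :
    HasJump (fun z => (mFunction φ ψ B z)⁻¹) k (E k - F k) :=
  hasJump_of_tendsto (hE.tendsto_inv_mFunction hn I_sign) (hF.tendsto_inv_mFunction hn neg_I_sign)

theorem Model.hasJump_gap (M : Model a' b' a b φ ψ) (B : ℂ)
    (hk : k ∉ Set.Icc a b ∪ Set.Icc a' b') :
    HasJump (fun z => (mFunction φ ψ B z)⁻¹) k (2 * Real.pi * Complex.I) := by
  have hend : k ∉ ({a', b', a, b} : Set ℝ) := by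
    rintro (rfl | rfl | rfl | rfl)
    · exact hk (Or.inr ⟨le_rfl, M.lt'.le⟩)
    · exact hk (Or.inr ⟨M.lt'.le, le_rfl⟩)
    · exact hk (Or.inl ⟨le_rfl, M.lt.le⟩)
    · exact hk (Or.inl ⟨M.lt.le, le_rfl⟩)
  obtain ⟨E, F, hE, hF, h, -⟩ := M.exists_sideExtension B hend
  rw [← h hk]
  exact hasJump_inv_mFunction M.nondegenerate hE hF

theorem Model.notMem_endpoints_right (M : Model a' b' a b φ ψ) (hk : k ∈ Set.Ioo a b) :
    k ∉ ({a', b', a, b} : Set ℝ) := by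
  have h1 := M.lt'
  have h2 := M.gap
  rintro (rfl | rfl | rfl | rfl)
  · linarith [hk.1]
  · linarith [hk.1]
  · exact lt_irrefl _ hk.1
  · exact lt_irrefl _ hk.2

theorem Model.notMem_endpoints_left (M : Model a' b' a b φ ψ) (hk : k ∈ Set.Ioo a' b') :
    k ∉ ({a', b', a, b} : Set ℝ) := by
  have h1 := M.lt
  have h2 := M.gap
  rintro (rfl | rfl | rfl | rfl)
  · exact lt_irrefl _ hk.1
  · exact lt_irrefl _ hk.2
  · linarith [hk.2]
  · linarith [hk.2]

theorem Model.hasJump_right (M : Model a' b' a b φ ψ) (B : ℂ) (hk : k ∈ Set.Ioo a b) :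
    HasJump (fun z => (mFunction φ ψ B z)⁻¹) k
      (2 * Real.pi * Complex.I * (1 - cauchyTransform ψ k)) := by
  obtain ⟨E, F, hE, hF, -, h, -⟩ := M.exists_sideExtension B (M.notMem_endpoints_right hk)
  have h1 : cauchyTransform ψ k = cauchyInt (psiFun a' b' a b) k := M.cauchyInt_right k
  rw [h1, ← h hk]
  exact hasJump_inv_mFunction M.nondegenerate hE hF

theorem Model.hasJump_left (M : Model a' b' a b φ ψ) (B : ℂ) (hk : k ∈ Set.Ioo a' b') :
    HasJump (fun z => (mFunction φ ψ B z)⁻¹) k 0 := by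
  obtain ⟨E, F, hE, hF, -, -, h⟩ := M.exists_sideExtension B (M.notMem_endpoints_left hk)
  rw [← h hk]
  exact hasJump_inv_mFunction M.nondegenerate hE hF

/-- Off `I'`, the boundary values of the denominator of the `M`-function from the two sides
differ. -/
theorem Model.exists_sideExtension_ne (M : Model a' b' a b φ ψ) (B : ℂ)
    (hk : k ∉ ({a', b', a, b} : Set ℝ)) : ∃ E F : ℂ → ℂ,
      SideExtension (weylDenom φ ψ B) Complex.I k E ∧
      SideExtension (weylDenom φ ψ B) (-Complex.I) k F ∧ (E k ≠ F k ↔ k ∉ Set.Icc a' b') := by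
  obtain ⟨E, F, hE, hF, h1, h2, h3⟩ := M.exists_sideExtension B hk
  refine ⟨E, F, hE, hF, ?_⟩
  simp only [Set.mem_insert_iff, Set.mem_singleton_iff, not_or] at hk
  obtain ⟨e1, e2, e3, e4⟩ := hk
  have hpi : (2 * Real.pi * Complex.I : ℂ) ≠ 0 := by simp [Real.pi_ne_zero]
  by_cases hJ : k ∈ Set.Icc a' b'
  · have hJ' : k ∈ Set.Ioo a' b' := ⟨lt_of_le_of_ne hJ.1 (Ne.symm e1), lt_of_le_of_ne hJ.2 e2⟩
    simp [hJ, sub_eq_zero.1 (h3 hJ')]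
  refine iff_of_true (fun heq => ?_) hJ
  by_cases hI : k ∈ Set.Icc a b
  · have hI' : k ∈ Set.Ioo a b := ⟨lt_of_le_of_ne hI.1 (Ne.symm e3), lt_of_le_of_ne hI.2 e4⟩
    have h4 := h2 hI'
    obtain ⟨s, hs, hs'⟩ := M.cauchyInt_psiFun_neg (M.gap.trans hI'.1)
    rw [heq, sub_self, hs'] at h4
    have h5 := (mul_eq_zero.1 h4.symm).resolve_left hpi
    have h6 : (1 : ℝ) - s = 0 := by exact_mod_cast h5
    linarith
  · have h4 := h1 (fun h => h.elim hI hJ)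
    rw [heq, sub_self] at h4
    exact hpi h4.symm

theorem Model.boundaryValues_ne_iff (M : Model a' b' a b φ ψ) (B : ℂ)
    (hk : k ∉ ({a', b', a, b} : Set ℝ)) {p q : ℂ} (hp : HasUpperValue (mFunction φ ψ B) k p)
    (hq : HasLowerValue (mFunction φ ψ B) k q) : p ≠ q ↔ k ∉ Set.Icc a' b' := by
  obtain ⟨E, F, hE, hF, h⟩ := M.exists_sideExtension_ne B hk
  rw [← h]
  have h1 := hE.mul_eq_one M.nondegenerate I_sign hp
  have h2 := hF.mul_eq_one M.nondegenerate neg_I_sign (hasLowerValue_iff.1 hq)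
  refine not_congr ⟨fun hpq => ?_, fun hEF => ?_⟩
  · subst hpq
    exact mul_left_cancel₀ (left_ne_zero_of_mul_eq_one h1) (h1.trans h2.symm)
  · rw [hEF] at h1
    exact mul_right_cancel₀ (right_ne_zero_of_mul_eq_one h1) (h1.trans h2.symm)

end Model

/-! ### The detectable subspaces of the model. -/

theorem Apart.norm_cauchyInt_le {f h : ℝ → ℂ} {δ t : ℝ} (hδ : 0 < δ) (H : Apart f h δ)
    (hh : Integrable h) (ht : f t ≠ 0) : ‖cauchyInt h t‖ ≤ δ⁻¹ * ∫ x, ‖h x‖ := by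
  rw [← integral_const_mul]
  refine norm_integral_le_of_norm_le (hh.norm.const_mul _) (Eventually.of_forall fun x => ?_)
  by_cases hx : h x = 0
  · simp [hx]
  have h1 := H t x ht hx
  rw [norm_div, div_eq_inv_mul, ← Complex.ofReal_sub, Complex.norm_real, Real.norm_eq_abs]
  gcongr

theorem Apart.memLp_mul_cauchyInt {f h : ℝ → ℂ} {δ : ℝ} (hδ : 0 < δ) (H : Apart f h δ)
    (hf : Integrable f) (hf2 : MemLp f 2 volume) (hh : Integrable h) :
    MemLp (fun t : ℝ => f t * cauchyInt h t) 2 volume := by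
  refine hf2.of_le_mul (c := δ⁻¹ * ∫ x, ‖h x‖)
    (H.integrable_mul_cauchyInt hδ hf hh).aestronglyMeasurable (Eventually.of_forall fun t => ?_)
  by_cases ht : f t = 0
  · simp [ht]
  rw [norm_mul, mul_comm]
  gcongr
  exact H.norm_cauchyInt_le hδ hh ht

theorem indC_mul_support (p q : ℝ) (f : ℝ → ℂ) (x : ℝ) (hx : x ∉ Set.Icc p q) :
    indC p q x * f x = 0 := by rw [indC_of_notMem hx, zero_mul]

theorem memLp_indC_mul (p q : ℝ) {f : ℝ → ℂ} (hf : MemLp f 2 volume) :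
    MemLp (fun x => indC p q x * f x) 2 volume := by
  refine hf.of_le_mul (c := 1) ((memLp_indC p q).aestronglyMeasurable.mul hf.aestronglyMeasurable)
    (Eventually.of_forall fun x => ?_)
  by_cases hx : x ∈ Set.Icc p q
  · simp [indC_of_mem hx]
  · simp [indC_of_notMem hx]

theorem integrable_indC_mul (p q : ℝ) {f : ℝ → ℂ} (hf : MemLp f 2 volume) :
    Integrable (fun x => indC p q x * f x) :=
  integrable_of_support (memLp_indC_mul p q hf) (indC_mul_support p q f)

section Model

variable {a' b' a b : ℝ} {φ ψ : L2}

theorem Model.indC_mul_indC (M : Model a' b' a b φ ψ) (x : ℝ) :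
    indC a b x * indC a' b' x = 0 := by
  by_cases hx : x ∈ Set.Icc a b
  · rw [indC_of_notMem (p := a') (q := b') fun h => absurd (hx.1.trans h.2) (not_le.2 M.gap),
      mul_zero]
  · rw [indC_of_notMem hx, zero_mul]

theorem psiFun_mul_indC (a' b' a b x : ℝ) :
    psiFun a' b' a b x * indC a' b' x = psiFun a' b' a b x := by
  by_cases hx : x ∈ Set.Icc a' b'
  · rw [indC_of_mem hx, mul_one]
  · rw [psiFun_support _ _ _ _ _ hx, zero_mul]

theorem Model.indC_mul_psiFun (M : Model a' b' a b φ ψ) (x : ℝ) :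
    indC a b x * psiFun a' b' a b x = 0 := by
  rw [← psiFun_mul_indC, mul_left_comm, M.indC_mul_indC, mul_zero]

theorem Model.psiFun_mul_cauchyInt (M : Model a' b' a b φ ψ) (x : ℝ) :
    psiFun a' b' a b x * cauchyInt (indC a b) x = indC a' b' x := by
  by_cases hx : x ∈ Set.Icc a' b'
  · rw [M.psiFun_mul hx, indC_of_mem hx]
  · rw [psiFun_support _ _ _ _ _ hx, indC_of_notMem hx, zero_mul]

theorem mul_psiFun_support (a' b' a b : ℝ) (f : ℝ → ℂ) (x : ℝ) (hx : x ∉ Set.Icc a' b') :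
    f x * psiFun a' b' a b x = 0 := by rw [psiFun_support _ _ _ _ _ hx, mul_zero]

theorem Model.integrable_mul_psiFun (M : Model a' b' a b φ ψ) {f : ℝ → ℂ}
    (hf : MemLp f 2 volume) : Integrable (fun x => f x * psiFun a' b' a b x) :=
  hf.integrable_mul M.memLp_psiFun

theorem apart_couple (a' b' a b : ℝ) (f g : ℝ → ℂ) :
    Apart (fun x => indC a b x * g x) (fun x => f x * psiFun a' b' a b x) (a - b') :=
  apart_of_support (indC_mul_support a b g) (mul_psiFun_support a' b' a b f)

/-- `φ (f ψ)^`, where `^` is the Cauchy transform. -/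
noncomputable def couple (a' b' a b : ℝ) (f : ℝ → ℂ) (x : ℝ) : ℂ :=
  indC a b x * cauchyInt (fun t => f t * psiFun a' b' a b t) x

/-- `ψ (φ f)^`, where `^` is the Cauchy transform. -/
noncomputable def coupleDual (a' b' a b : ℝ) (f : ℝ → ℂ) (x : ℝ) : ℂ :=
  psiFun a' b' a b x * cauchyInt (fun t => indC a b t * f t) x

theorem couple_support (a' b' a b : ℝ) (f : ℝ → ℂ) (x : ℝ) (hx : x ∉ Set.Icc a b) :
    couple a' b' a b f x = 0 := by rw [couple, indC_of_notMem hx, zero_mul]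

theorem Model.memLp_couple (M : Model a' b' a b φ ψ) {f : ℝ → ℂ} (hf : MemLp f 2 volume) :
    MemLp (couple a' b' a b f) 2 volume :=
  (apart_of_support (indC_support a b)
    (mul_psiFun_support a' b' a b f)).memLp_mul_cauchyInt (sub_pos.2 M.gap)
    (integrable_indC a b) (memLp_indC a b) (M.integrable_mul_psiFun hf)

theorem Model.memLp_coupleDual (M : Model a' b' a b φ ψ) {f : ℝ → ℂ} (hf : MemLp f 2 volume) :
    MemLp (coupleDual a' b' a b f) 2 volume :=
  (apart_of_support (indC_mul_support a b f)
    (psiFun_support a' b' a b)).symm.memLp_mul_cauchyInt (sub_pos.2 M.gap)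
    M.integrable_psiFun M.memLp_psiFun (integrable_indC_mul a b hf)

/-- The product formula with `fψ` in place of `ψ`: the part on `I'` is `f ψ φ̂ = f χ_{I'}`. -/
theorem Model.cauchyInt_mul_couple (M : Model a' b' a b φ ψ) {f : ℝ → ℂ} (hf : MemLp f 2 volume)
    {z : ℂ} (hz : z.im ≠ 0) :
    cauchyInt (indC a b) z * cauchyInt (fun x => f x * psiFun a' b' a b x) z
      = cauchyInt (couple a' b' a b f) z + cauchyInt (fun x => indC a' b' x * f x) z := by
  rw [M.cauchyInt_mul (integrable_indC a b) (M.integrable_mul_psiFun hf) (indC_support a b)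
    (mul_psiFun_support a' b' a b f) hz]
  congr 2
  funext x
  rw [← M.psiFun_mul_cauchyInt]
  ring

/-- The density of the Cauchy transform `z ↦ ⟨u_z, v⟩`. -/
theorem Model.defectPairing_eq (M : Model a' b' a b φ ψ) (v : L2) {z : ℂ} (hz : z.im ≠ 0) :
    defectPairing φ ψ v z = cauchyInt (fun x => conj (v x)
      - (couple a' b' a b (fun x => conj (v x)) x + indC a' b' x * conj (v x))) z := by
  have hw : MemLp (fun x => conj (v x)) 2 volume := (Lp.memLp v).star
  have h1 : cauchyInt (fun x => conj (v x) * ψ x) z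
      = cauchyInt (fun x => conj (v x) * psiFun a' b' a b x) z := by
    refine cauchyInt_congr ?_ z
    filter_upwards [M.right] with x hx
    rw [hx]
  have c1 := cauchyIntegrable_of_memLp (M.memLp_couple hw)
  have c2 := cauchyIntegrable_of_memLp (memLp_indC_mul a' b' hw)
  rw [defectPairing, h1, M.cauchyInt_conj_left, M.cauchyInt_mul_couple hw hz,
    cauchyInt_sub (cauchyIntegrable_of_memLp hw) (c1.add c2) hz, cauchyInt_add c1 c2 hz]

/-- Uniqueness of Cauchy densities turns the vanishing of all pairings into a pointwise equation. It
is void on `I'`, gives `v` on `I` from its values on `I'`, and makes `v` zero elsewhere. -/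
theorem Model.mem_orthogonal_iff_ae (M : Model a' b' a b φ ψ) {B μ : ℂ}
    (hμ : μ ∈ rho (extensionOp φ ψ B)) {v : L2} : v ∈ (detectableSubspace φ ψ B μ)ᗮ ↔
      ∀ᵐ x : ℝ, conj (v x)
        = couple a' b' a b (fun x => conj (v x)) x + indC a' b' x * conj (v x) := by
  have hw : MemLp (fun x => conj (v x)) 2 volume := (Lp.memLp v).star
  rw [M.nondegenerate.mem_orthogonal_iff hμ]
  constructor
  · intro h
    have c1 := cauchyIntegrable_of_memLp (M.memLp_couple hw)
    have c2 := cauchyIntegrable_of_memLp (memLp_indC_mul a' b' hw)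
    have h1 := ((cauchyIntegrable_of_memLp hw).sub (c1.add c2)).ae_eq_zero fun z hz => by
      rw [← M.defectPairing_eq v hz, h z hz]
    filter_upwards [h1] with x hx
    exact sub_eq_zero.1 hx
  · intro h z hz
    rw [M.defectPairing_eq v hz, cauchyInt_congr (g := fun _ => 0) ?_]
    · simp [cauchyInt]
    · filter_upwards [h] with x hx
      exact sub_eq_zero.2 hx

/-- The dual detectable subspace is the whole space. -/
theorem Model.detectableSubspace_swap_eq_top (M : Model a' b' a b φ ψ) {B μ : ℂ}
    (hμ : μ ∈ rho (extensionOp ψ φ B)) : detectableSubspace ψ φ B μ = ⊤ := by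
  rw [← Submodule.orthogonal_eq_bot_iff, eq_bot_iff]
  intro v hv
  rw [M.nondegenerate_swap.mem_orthogonal_iff hμ] at hv
  have hw : MemLp (fun x => conj (v x)) 2 volume := (Lp.memLp v).star
  set w : ℝ → ℂ := fun x => conj (v x) with hwdef
  have i1 := integrable_indC_mul a b hw
  have c1 : CauchyIntegrable fun t => indC a b t * w t * cauchyInt (psiFun a' b' a b) t :=
    cauchyIntegrable_of_integrable (M.integrable_mul_cauchyInt i1 M.integrable_psiFun
      (indC_mul_support a b w) (psiFun_support a' b' a b))
  have c2 : CauchyIntegrable (coupleDual a' b' a b w) :=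
    cauchyIntegrable_of_memLp (M.memLp_coupleDual hw)
  have h1 := ((cauchyIntegrable_of_memLp hw).sub (c1.add c2)).ae_eq_zero fun z hz => by
    have h2 := hv z hz
    have h3 : cauchyInt (fun x => conj (v x) * φ x) z
        = cauchyInt (fun x => indC a b x * w x) z := by
      refine cauchyInt_congr ?_ z
      filter_upwards [M.left] with x hx
      rw [hx, mul_comm]
    rw [defectPairing, h3, M.cauchyInt_conj_right, mul_comm, M.cauchyInt_mul i1
      M.integrable_psiFun (indC_mul_support a b w) (psiFun_support a' b' a b) hz] at h2
    rw [cauchyInt_sub (cauchyIntegrable_of_memLp hw) (c1.add c2) hz, cauchyInt_add c1 c2 hz]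
    exact h2
  -- On `I` the equation reads `w = ψ̂ w` with `ψ̂ < 0`, so `w` vanishes there. Then `φw = 0`, and
  -- the remaining term `ψ (φw)^` vanishes as well.
  have h4 : ∀ᵐ x, indC a b x * w x = 0 := by
    filter_upwards [h1] with x hx
    by_cases hI : x ∈ Set.Icc a b
    · obtain ⟨s, hs, hs'⟩ := M.cauchyInt_psiFun_neg (M.gap.trans_le hI.1)
      have hI' : x ∉ Set.Icc a' b' := fun h => absurd (hI.1.trans h.2) (not_le.2 M.gap)
      rw [hs', coupleDual, psiFun_support _ _ _ _ _ hI', indC_of_mem hI, one_mul, zero_mul,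
        add_zero, Pi.zero_apply] at hx
      have h5 : (1 - (s : ℂ)) * w x = 0 := by linear_combination hx
      have h6 : (1 - (s : ℂ)) ≠ 0 := by
        have : (1 : ℝ) - s ≠ 0 := by linarith
        exact_mod_cast this
      rw [(mul_eq_zero.1 h5).resolve_left h6, mul_zero]
    · rw [indC_of_notMem hI, zero_mul]
  have h7 : ∀ z, cauchyInt (fun t => indC a b t * w t) z = 0 := fun z => by
    rw [cauchyInt_congr (g := fun _ => 0) h4]
    simp [cauchyInt]
  rw [Submodule.mem_bot]
  refine Lp.ext ?_
  filter_upwards [h1, h4, Lp.coeFn_zero ℂ 2 (volume : Measure ℝ)] with x e1 e2 e3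
  rw [coupleDual, h7, e2, Pi.zero_apply] at e1
  rw [e3, Pi.zero_apply]
  have e4 : conj (v x) = 0 := by simpa [hwdef] using e1
  exact (map_eq_zero _).1 e4

/-- Functions vanishing on `I ∪ I'` are detectable. -/
theorem Model.mem_detectableSubspace_of_ae (M : Model a' b' a b φ ψ) {B μ : ℂ}
    (hμ : μ ∈ rho (extensionOp φ ψ B)) {f : L2}
    (hf : ∀ᵐ x, x ∈ Set.Icc a b ∪ Set.Icc a' b' → f x = 0) :
    f ∈ detectableSubspace φ ψ B μ := by
  rw [← Submodule.orthogonal_orthogonal (detectableSubspace φ ψ B μ), Submodule.mem_orthogonal]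
  intro v hv
  rw [M.mem_orthogonal_iff_ae hμ] at hv
  rw [inner_eq_integral]
  refine integral_eq_zero_of_ae ?_
  filter_upwards [hf, hv] with x h1 h2
  by_cases hx : x ∈ Set.Icc a b ∪ Set.Icc a' b'
  · simp [h1 hx]
  · rw [h2, couple_support _ _ _ _ _ _ fun h => hx (Or.inl h),
      indC_of_notMem fun h => hx (Or.inr h)]
    simp

/-- For every `g` on `I'` the conjugate of `g + φ (g ψ)^` is orthogonal to the detectable
subspace. -/
theorem Model.exists_mem_orthogonal (M : Model a' b' a b φ ψ) {B μ : ℂ}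
    (hμ : μ ∈ rho (extensionOp φ ψ B)) {g : ℝ → ℂ} (hg : MemLp g 2 volume)
    (hgs : ∀ x, x ∉ Set.Icc a' b' → g x = 0) : ∃ v ∈ (detectableSubspace φ ψ B μ)ᗮ,
      ∀ᵐ x : ℝ, conj (v x) = g x + couple a' b' a b g x := by
  have hmem : MemLp (fun x => conj (g x + couple a' b' a b g x)) 2 volume :=
    (MemLp.add hg (M.memLp_couple hg)).star
  have hv : ∀ᵐ x : ℝ, conj (hmem.toLp _ x) = g x + couple a' b' a b g x := by
    filter_upwards [hmem.coeFn_toLp] with x hx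
    rw [hx, Complex.conj_conj]
  refine ⟨hmem.toLp _, ?_, hv⟩
  rw [M.mem_orthogonal_iff_ae hμ]
  -- The coupling sees only values on the support of `ψ`, where the added term `φ (gψ)^` is zero.
  have hc : couple a' b' a b (fun x => conj (hmem.toLp _ x)) = couple a' b' a b g := by
    funext y
    rw [couple, couple]
    congr 1
    refine cauchyInt_congr ?_ _
    filter_upwards [hv] with x hx
    rw [hx, add_mul, couple, mul_right_comm, M.indC_mul_psiFun, zero_mul, add_zero]
  filter_upwards [hv] with x hx
  rw [hx, hc]
  have h1 : indC a' b' x * g x = g x := by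
    by_cases h : x ∈ Set.Icc a' b'
    · rw [indC_of_mem h, one_mul]
    · rw [hgs x h, mul_zero]
  have h2 : indC a' b' x * couple a' b' a b g x = 0 := by
    rw [couple, ← mul_assoc, mul_comm (indC a' b' x), M.indC_mul_indC, zero_mul]
  rw [mul_add, h1, h2]
  ring

/-- On `I'` a detectable function `g` equals `ψ (φ g)^`. -/
theorem Model.ae_eq_of_mem_detectableSubspace (M : Model a' b' a b φ ψ) {B μ : ℂ}
    (hμ : μ ∈ rho (extensionOp φ ψ B)) {f : L2} (hf : f ∈ detectableSubspace φ ψ B μ) :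
    ∀ᵐ x, indC a' b' x * f x = coupleDual a' b' a b f x := by
  have m1 := memLp_indC_mul a' b' (Lp.memLp f)
  have m2 := M.memLp_coupleDual (Lp.memLp f)
  -- The defect in the claimed equation is supported in `I'`. Testing `f` against the orthogonal
  -- vector built from `conj d` gives, after Fubini, `‖d‖² = 0`.
  set d : ℝ → ℂ := fun x => indC a' b' x * f x - coupleDual a' b' a b f x with hd
  have hdm : MemLp d 2 volume := MemLp.sub m1 m2
  have hds : ∀ x, x ∉ Set.Icc a' b' → d x = 0 := fun x hx => by
    rw [hd]
    simp only [coupleDual, indC_of_notMem hx, psiFun_support _ _ _ _ _ hx, zero_mul, sub_self]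
  have hdi : ∀ x, indC a' b' x * d x = d x := fun x => by
    by_cases hx : x ∈ Set.Icc a' b'
    · rw [indC_of_mem hx, one_mul]
    · rw [hds x hx, mul_zero]
  set g : ℝ → ℂ := fun x => conj (d x) with hg
  have hgm : MemLp g 2 volume := hdm.star
  obtain ⟨v, hv, hvg⟩ := M.exists_mem_orthogonal hμ hgm (fun x hx => by simp [hg, hds x hx])
  have h0 : inner ℂ v f = 0 := (Submodule.mem_orthogonal' _ _).1 hv f hf
  have i1 : Integrable fun x => g x * f x := hgm.integrable_mul (Lp.memLp f)
  have ig := M.integrable_mul_psiFun hgm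
  have jf := integrable_indC_mul a b (Lp.memLp f)
  have hap := apart_couple a' b' a b g f
  have i2 := hap.integrable_mul_cauchyInt (sub_pos.2 M.gap) jf ig
  have i3 := hap.symm.integrable_mul_cauchyInt (sub_pos.2 M.gap) ig jf
  have e1 : inner ℂ v f = (∫ x, g x * f x)
      + ∫ x : ℝ, indC a b x * f x * cauchyInt (fun x => g x * psiFun a' b' a b x) x := by
    rw [inner_eq_integral, ← integral_add i1 i2]
    refine integral_congr_ae ?_
    filter_upwards [hvg] with x hx
    rw [hx, couple]
    ring
  rw [h0, hap.integral_mul_cauchyInt (sub_pos.2 M.gap) jf ig, ← sub_eq_add_neg,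
    ← integral_sub i1 i3] at e1
  have e2 : inner ℂ (hdm.toLp d) (hdm.toLp d) = 0 := by
    rw [inner_eq_integral, e1]
    refine integral_congr_ae ?_
    filter_upwards [hdm.coeFn_toLp] with x hx
    have h1 : conj (indC a' b' x) = indC a' b' x := by rw [indC_eq_ofReal, Complex.conj_ofReal]
    have h2 : indC a' b' x * g x = g x := by rw [← h1, hg, ← map_mul, hdi]
    rw [hx]
    change g x * (indC a' b' x * f x - psiFun a' b' a b x * _) = _
    linear_combination f x * h2
  have e3 : hdm.toLp d = 0 := inner_self_eq_zero.1 e2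
  have e4 := hdm.coeFn_toLp
  rw [e3] at e4
  filter_upwards [e4, Lp.coeFn_zero ℂ 2 (volume : Measure ℝ)] with x h1 h2
  rw [h2, Pi.zero_apply] at h1
  exact sub_eq_zero.1 h1.symm

/-- Indicators of infinitely many disjoint intervals in `I'` each extend to a vector of the
complement. On `I'` these vectors are the indicators themselves, so averaging over the intervals
gives a dual family. -/
theorem Model.infinite_orthogonal (M : Model a' b' a b φ ψ) {B μ : ℂ}
    (hμ : μ ∈ rho (extensionOp φ ψ B)) :
    ¬ FiniteDimensional ℂ (detectableSubspace φ ψ B μ)ᗮ := by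
  intro hfin
  have hL : 0 < b' - a' := sub_pos.2 M.lt'
  -- The intervals `[p n, q n]` shrink towards `a'`; the offsets `2n + 3` and `2n + 2` give `q n < p
  -- m` for `m < n`.
  set p : ℕ → ℝ := fun n => a' + (b' - a') / (2 * n + 3) with hp
  set q : ℕ → ℝ := fun n => a' + (b' - a') / (2 * n + 2) with hq
  have hpq : ∀ n, p n < q n := fun n => by
    have : (b' - a') / (2 * n + 3) < (b' - a') / (2 * n + 2) := by gcongr; norm_num
    simp only [hp, hq]
    linarith
  have hqp : ∀ m n, m < n → q n < p m := fun m n hmn => by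
    have h1 : ((m : ℕ) : ℝ) + 1 ≤ n := by exact_mod_cast hmn
    have : (b' - a') / (2 * n + 2) < (b' - a') / (2 * m + 3) :=
      div_lt_div_of_pos_left hL (by positivity) (by linarith)
    simp only [hp, hq]
    linarith
  have hsub : ∀ n x, x ∈ Set.Icc (p n) (q n) → x ∈ Set.Icc a' b' := fun n x hx => by
    have h1 : 0 < (b' - a') / (2 * (n : ℝ) + 3) := by positivity
    have h2 : (b' - a') / (2 * (n : ℝ) + 2) ≤ b' - a' :=
      div_le_self hL.le (by linarith [Nat.cast_nonneg (α := ℝ) n])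
    simp only [hp, hq] at hx
    exact ⟨by linarith [hx.1], by linarith [hx.2]⟩
  choose v hv hvae using fun n : ℕ => M.exists_mem_orthogonal hμ (memLp_indC (p n) (q n))
    (fun x hx => indC_of_notMem fun h => hx (hsub n x h))
  have hval : ∀ n m, inner ℂ (indicatorVec (p n) (q n)) (v m)
      = ∫ x in Set.Ioc (p n) (q n), indC (p m) (q m) x := fun n m => by
    rw [inner_indicatorVec]
    refine setIntegral_congr_ae measurableSet_Ioc ?_
    filter_upwards [hvae m] with x hx hmem
    have hI : x ∉ Set.Icc a b := fun h =>
      absurd (h.1.trans (hsub n x (Set.Ioc_subset_Icc_self hmem)).2) (not_le.2 M.gap)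
    rw [couple_support _ _ _ _ _ _ hI, add_zero] at hx
    rw [← Complex.conj_conj (v m x), hx, indC_eq_ofReal, Complex.conj_ofReal]
  have hne : ∀ n, ((q n - p n : ℝ) : ℂ) ≠ 0 := fun n =>
    Complex.ofReal_ne_zero.2 (sub_pos.2 (hpq n)).ne'
  have hli : LinearIndependent ℂ v := by
    refine LinearIndependent.of_pairwise_dual_eq_zero_one v
      (fun n => ((q n - p n : ℝ) : ℂ)⁻¹ • (innerSL ℂ (indicatorVec (p n) (q n))).toLinearMap)
      (fun n m hnm => ?_) fun n => ?_
    · change ((q n - p n : ℝ) : ℂ)⁻¹ * inner ℂ (indicatorVec (p n) (q n)) (v m) = 0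
      rw [hval, setIntegral_eq_zero_of_forall_eq_zero, mul_zero]
      refine fun x hx => indC_of_notMem fun h => ?_
      rcases lt_or_gt_of_ne hnm with h1 | h1
      · linarith [hqp n m h1, hx.1, h.2]
      · linarith [hqp m n h1, hx.2, h.1]
    · change ((q n - p n : ℝ) : ℂ)⁻¹ * inner ℂ (indicatorVec (p n) (q n)) (v n) = 1
      have h1 : ∫ x in Set.Ioc (p n) (q n), indC (p n) (q n) x
          = ∫ x in Set.Ioc (p n) (q n), (1 : ℂ) :=
        setIntegral_congr_fun measurableSet_Ioc fun x hx =>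
          indC_of_mem (Set.Ioc_subset_Icc_self hx)
      have h2 : ∫ x in Set.Ioc (p n) (q n), (1 : ℂ) = ((q n - p n : ℝ) : ℂ) := by
        simp [(hpq n).le]
      rw [hval, h1, h2, inv_mul_cancel₀ (hne n)]
  have hli' : LinearIndependent ℂ
      fun n => (⟨v n, hv n⟩ : ((detectableSubspace φ ψ B μ)ᗮ : Submodule ℂ L2)) :=
    LinearIndependent.of_comp (Submodule.subtype _) hli
  exact Module.Finite.not_linearIndependent_of_infinite _ hli'

theorem Model.detectableSubspace_ne_top (M : Model a' b' a b φ ψ) {B μ : ℂ}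
    (hμ : μ ∈ rho (extensionOp φ ψ B)) : detectableSubspace φ ψ B μ ≠ ⊤ := fun h =>
  M.infinite_orthogonal hμ (by rw [h, Submodule.top_orthogonal_eq_bot]; infer_instance)

end Model

/-! ### The bordered resolvent inside `I'` and off `I'`, endpoints of `I` excluded. -/

theorem awayFrom_of_ae_zero {f : ℝ → ℂ} {p q k : ℝ} (hf : ∀ᵐ x, x ∈ Set.Icc p q → f x = 0)
    (hk : k ∈ Set.Ioo p q) : ∃ δ > 0, AwayFrom f k δ := by
  obtain ⟨δ, hδ, hball⟩ := Metric.isOpen_iff.1 isOpen_Ioo k hk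
  refine ⟨δ, hδ, ?_⟩
  filter_upwards [hf] with x hx
  refine or_iff_not_imp_right.2 fun h => hx (Set.Ioo_subset_Icc_self (hball ?_))
  rw [not_le, ← Complex.ofReal_sub, Complex.norm_real] at h
  rwa [Metric.mem_ball, dist_eq_norm]

theorem CauchyIntegrable.tendsto_of_ae_zero {f : ℝ → ℂ} (hf : CauchyIntegrable f) {p q k : ℝ}
    (h : ∀ᵐ x, x ∈ Set.Icc p q → f x = 0) (hk : k ∈ Set.Ioo p q) (ω : ℂ) :
    Tendsto (fun ε : ℝ => cauchyInt f (k + ε * ω)) (𝓝[>] 0) (𝓝 (cauchyInt f k)) := by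
  obtain ⟨δ, hδ, haway⟩ := awayFrom_of_ae_zero h hk
  exact (hf.analyticAt hδ haway).continuousAt.tendsto.comp (tendsto_add_mul ω k)

theorem tendsto_cauchyInt_of_support {f : ℝ → ℂ} (hf : CauchyIntegrable f) {p q k : ℝ}
    (hsupp : ∀ x, x ∉ Set.Icc p q → f x = 0) (hk : k ∉ Set.Icc p q) (ω : ℂ) :
    Tendsto (fun ε : ℝ => cauchyInt f (k + ε * ω)) (𝓝[>] 0) (𝓝 (cauchyInt f k)) :=
  (analyticAt_cauchyInt_of_support hf hsupp hk).continuousAt.tendsto.comp (tendsto_add_mul ω k)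

theorem inner_kreinResolvent (φ ψ w g : L2) (B : ℂ) {z : ℂ} (hz : z.im ≠ 0) :
    inner ℂ w (kreinResolvent φ ψ B z hz g) = cauchyInt (fun x => conj (w x) * g x) z
      - cauchyInt (fun x => conj (φ x) * g x) z * cauchyInt (fun x => conj (w x) * ψ x) z
      - (weylDenom φ ψ B z)⁻¹ * (cauchyInt g z
          - cauchyInt (fun x => conj (φ x) * g x) z * cauchyInt ψ z) * defectPairing φ ψ w z := by
  rw [kreinResolvent_apply, inner_sub_right, inner_sub_right, inner_smul_right, inner_smul_right,
    inner_cauchyOp, inner_cauchyOp, inner_cauchyOp, sourceFunctional_apply, inner_defectVec_eq]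

section Model

variable {a' b' a b k : ℝ} {φ ψ : L2} {B μ₀ μ₁ : ℂ}

/-- The left projection is the identity because the dual detectable subspace is everything. -/
theorem Model.borderedResolvent_apply (M : Model a' b' a b φ ψ)
    (hμ₁ : μ₁ ∈ rho (extensionOp ψ φ (conj B))) (z : ℂ) (v : L2) :
    borderedResolvent φ ψ B μ₀ μ₁ z v = resolventOp (extensionOp φ ψ B) z
      ((detectableSubspace φ ψ B μ₀).starProjection v) := by
  refine Submodule.starProjection_eq_self_iff.2 ?_
  rw [M.detectableSubspace_swap_eq_top hμ₁]
  exact Submodule.mem_top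

theorem Model.borderedResolvent_apply_of_mem (M : Model a' b' a b φ ψ)
    (hμ₁ : μ₁ ∈ rho (extensionOp ψ φ (conj B))) {z : ℂ} (hz : z.im ≠ 0)
    (hm : weylDenom φ ψ B z ≠ 0) {g : L2} (hg : g ∈ detectableSubspace φ ψ B μ₀) :
    borderedResolvent φ ψ B μ₀ μ₁ z g = kreinResolvent φ ψ B z hz g := by
  rw [M.borderedResolvent_apply hμ₁, Submodule.starProjection_eq_self_iff.2 hg,
    M.disjointSupport.resolventOp_eq hz hm]

theorem Model.cauchyInt_conj_left_mul (M : Model a' b' a b φ ψ) (g : L2) (z : ℂ) :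
    cauchyInt (fun x => conj (φ x) * g x) z = cauchyInt (fun x => indC a b x * g x) z := by
  refine cauchyInt_congr ?_ z
  filter_upwards [M.left] with x hx
  rw [hx, indC_eq_ofReal, Complex.conj_ofReal]

theorem Model.cauchyInt_mul_right (M : Model a' b' a b φ ψ) (f : ℝ → ℂ) (z : ℂ) :
    cauchyInt (fun x => f x * ψ x) z = cauchyInt (fun x => f x * psiFun a' b' a b x) z := by
  refine cauchyInt_congr ?_ z
  filter_upwards [M.right] with x hx
  rw [hx]

/-- For detectable `g`, the Cauchy transform of `h g`, corrected by the interaction term, is the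
Cauchy transform of a function that vanishes on `I'`. -/
theorem Model.exists_density (M : Model a' b' a b φ ψ) (hμ₀ : μ₀ ∈ rho (extensionOp φ ψ B)) {g : L2}
    (hg : g ∈ detectableSubspace φ ψ B μ₀) {h : ℝ → ℂ} (hhg : CauchyIntegrable fun x => h x * g x)
    (hh : Integrable fun x => h x * psiFun a' b' a b x) :
    ∃ F : ℝ → ℂ, CauchyIntegrable F ∧ (∀ᵐ x, x ∈ Set.Icc a' b' → F x = 0) ∧
      ∀ z : ℂ, z.im ≠ 0 → cauchyInt (fun x => h x * g x) z
        - cauchyInt (fun x => indC a b x * g x) z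
          * cauchyInt (fun x => h x * psiFun a' b' a b x) z = cauchyInt F z := by
  have hgI := integrable_indC_mul a b (Lp.memLp g)
  have hs1 := indC_mul_support a b g
  have hs2 := mul_psiFun_support a' b' a b h
  have i1 := M.integrable_mul_cauchyInt hgI hh hs1 hs2
  have i2 := M.integrable_mul_cauchyInt' hgI hh hs1 hs2
  have c1 := cauchyIntegrable_of_integrable i1
  have c2 := cauchyIntegrable_of_integrable i2
  refine ⟨_, hhg.sub (c1.add c2), ?_, fun z hz => ?_⟩
  -- On `I'` the density is `h (g - ψ (φg)^)`, and detectability of `g` makes the bracket zero.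
  · filter_upwards [M.ae_eq_of_mem_detectableSubspace hμ₀ hg] with x hx hmem
    have hI : x ∉ Set.Icc a b := fun h1 => absurd (h1.1.trans hmem.2) (not_le.2 M.gap)
    rw [indC_of_mem hmem, one_mul, coupleDual] at hx
    rw [indC_of_notMem hI]
    linear_combination (h x) * hx
  · rw [cauchyInt_sub hhg (c1.add c2) hz, cauchyInt_add c1 c2 hz,
      M.cauchyInt_mul hgI hh hs1 hs2 hz]

/-- Inside `I'` the bordered resolvent has no jump. -/
theorem Model.jumpVanishes (M : Model a' b' a b φ ψ) (hμ₀ : μ₀ ∈ rho (extensionOp φ ψ B))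
    (hμ₁ : μ₁ ∈ rho (extensionOp ψ φ (conj B))) (hk : k ∈ Set.Ioo a' b')
    (hbv : HasBoundaryValues (mFunction φ ψ B) k) :
    JumpVanishes (borderedResolvent φ ψ B μ₀ μ₁) k := by
  intro v w
  set g := (detectableSubspace φ ψ B μ₀).starProjection v with hgdef
  have hg : g ∈ detectableSubspace φ ψ B μ₀ := Submodule.starProjection_apply_mem _ v
  obtain ⟨E, F, hE, hF, -, -, hEF⟩ := M.exists_sideExtension B (M.notMem_endpoints_left hk)
  obtain ⟨⟨p, hp⟩, -⟩ := hbv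
  have hE0 : E k ≠ 0 := right_ne_zero_of_mul_eq_one (hE.mul_eq_one M.nondegenerate I_sign hp)
  have hFE : F k = E k := (sub_eq_zero.1 (hEF hk)).symm
  have hw : MemLp (fun x => conj (w x)) 2 volume := (Lp.memLp w).star
  -- In Krein's formula, `h = conj w` covers the decoupled part of the resolvent and `h = 1` covers
  -- the source functional.
  obtain ⟨F₁, c₁, v₁, e₁⟩ := M.exists_density hμ₀ hg (h := fun x => conj (w x))
    (cauchyIntegrable_conj_mul w g) (M.integrable_mul_psiFun hw)
  obtain ⟨F₂, c₂, v₂, e₂⟩ := M.exists_density hμ₀ hg (h := fun _ => 1)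
    (by simpa using cauchyIntegrable_coe g) (by simpa using M.integrable_psiFun)
  simp only [one_mul] at e₂
  have c₃ : CauchyIntegrable fun x => conj (w x)
      - (couple a' b' a b (fun x => conj (w x)) x + indC a' b' x * conj (w x)) :=
    (cauchyIntegrable_of_memLp hw).sub ((cauchyIntegrable_of_memLp (M.memLp_couple hw)).add
      (cauchyIntegrable_of_memLp (memLp_indC_mul a' b' hw)))
  -- For the pairing `⟨u_z, w⟩` no detectability is needed: its density contains `w - χ_{I'} w`, and
  -- the coupling term lives on `I`.
  have v₃ : ∀ᵐ x, x ∈ Set.Icc a' b' → conj (w x)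
      - (couple a' b' a b (fun x => conj (w x)) x + indC a' b' x * conj (w x)) = 0 := by
    refine Eventually.of_forall fun x hx => ?_
    have hI : x ∉ Set.Icc a b := fun h1 => absurd (h1.1.trans hx.2) (not_le.2 M.gap)
    rw [couple_support _ _ _ _ _ _ hI, indC_of_mem hx]
    ring
  have key : ∀ ω : ℂ, ω = Complex.I ∨ ω = -Complex.I → ∀ G : ℂ → ℂ,
      SideExtension (weylDenom φ ψ B) ω k G → G k = E k →
      Tendsto (fun ε : ℝ => inner ℂ w (borderedResolvent φ ψ B μ₀ μ₁ (k + ε * ω) v)) (𝓝[>] 0)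
        (𝓝 (cauchyInt F₁ k - (E k)⁻¹ * cauchyInt F₂ k * cauchyInt (fun x => conj (w x)
          - (couple a' b' a b (fun x => conj (w x)) x + indC a' b' x * conj (w x))) k)) := by
    intro ω hω G hG hGE
    have hlim := (c₁.tendsto_of_ae_zero v₁ hk ω).sub (((((hG.tendsto hω).inv₀ (by rwa [hGE])).mul
      (c₂.tendsto_of_ae_zero v₂ hk ω))).mul (c₃.tendsto_of_ae_zero v₃ hk ω))
    rw [hGE] at hlim
    refine hlim.congr' ?_
    filter_upwards [hG.eventually_weylDenom_ne_zero M.nondegenerate hω, self_mem_nhdsWithin]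
      with ε hm hε
    have hz := add_mul_im_ne_zero hω k (Set.mem_Ioi.1 hε)
    rw [M.borderedResolvent_apply hμ₁, M.disjointSupport.resolventOp_eq hz hm, ← hgdef,
      inner_kreinResolvent, M.defectPairing_eq w hz, M.cauchyInt_conj_left_mul,
      M.cauchyInt_mul_right, M.cauchyInt_right, e₁ _ hz, e₂ _ hz]
  have hJ := hasJump_of_tendsto (f := fun z => inner ℂ w (borderedResolvent φ ψ B μ₀ μ₁ z v))
    (key _ I_sign E hE rfl) (key _ neg_I_sign F hF hFE)
  rwa [sub_self] at hJ

/-- The indicator function of `[p, q]` as an element of `L²`. -/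
noncomputable def indVec (p q : ℝ) : L2 := (memLp_indC p q).toLp _

theorem indVec_coe (p q : ℝ) : indVec p q =ᵐ[volume] indC p q := (memLp_indC p q).coeFn_toLp

theorem conj_indC (p q x : ℝ) : conj (indC p q x) = indC p q x := by
  rw [indC_eq_ofReal, Complex.conj_ofReal]

theorem Model.cauchyInt_indVec_mul_right (M : Model a' b' a b φ ψ) {p q : ℝ} (hp : b' < p) (z : ℂ) :
    cauchyInt (fun x => conj (indVec p q x) * ψ x) z = 0 := by
  have h : (fun x => conj (indVec p q x) * ψ x) =ᵐ[volume] fun _ => 0 := by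
    filter_upwards [indVec_coe p q, M.right] with x h1 h2
    rw [h1, h2, conj_indC]
    by_cases hx : x ∈ Set.Icc p q
    · rw [psiFun_support _ _ _ _ _ fun h => absurd (hx.1.trans h.2) (not_le.2 hp), mul_zero]
    · rw [indC_of_notMem hx, zero_mul]
  rw [cauchyInt_congr h]
  simp [cauchyInt]

theorem cauchyInt_conj_indVec (p q : ℝ) (z : ℂ) :
    cauchyInt (fun x => conj (indVec p q x)) z = cauchyInt (indC p q) z := by
  refine cauchyInt_congr ?_ z
  filter_upwards [indVec_coe p q] with x h1
  rw [h1, conj_indC]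

theorem Model.defectPairing_indVec (M : Model a' b' a b φ ψ) {p q : ℝ} (hp : b' < p) (z : ℂ) :
    defectPairing φ ψ (indVec p q) z = cauchyInt (indC p q) z := by
  rw [defectPairing, M.cauchyInt_indVec_mul_right hp, mul_zero, sub_zero, cauchyInt_conj_indVec]

/-- Matrix elements of the bordered resolvent at a solution of `Ã* u = μ₀ u`. -/
theorem Model.inner_borderedResolvent_defectVec (M : Model a' b' a b φ ψ)
    (hμ₀ : μ₀ ∈ rho (extensionOp φ ψ B)) (hμ₁ : μ₁ ∈ rho (extensionOp ψ φ (conj B)))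
    (hi : μ₀.im ≠ 0) {p q : ℝ} (hp : b' < p) {z : ℂ} (hz : z.im ≠ 0)
    (hm : weylDenom φ ψ B z ≠ 0) (hne : z ≠ μ₀) :
    inner ℂ (indVec p q) (borderedResolvent φ ψ B μ₀ μ₁ z (defectVec φ ψ μ₀ hi))
      = weylDenom φ ψ B μ₀ / (z - μ₀) * ((weylDenom φ ψ B z)⁻¹ * cauchyInt (indC p q) z
          - (weylDenom φ ψ B μ₀)⁻¹ * cauchyInt (indC p q) μ₀) := by
  have hm₀ := (M.disjointSupport.mem_rho_iff.1 hμ₀).2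
  rw [M.borderedResolvent_apply_of_mem hμ₁ hz hm (M.nondegenerate.defectVec_mem hμ₀ hi),
    M.disjointSupport.kreinResolvent_defectVec hz hi hm hm₀ hne, inner_smul_right, inner_sub_right,
    inner_smul_right, inner_smul_right, inner_defectVec_eq, inner_defectVec_eq,
    M.defectPairing_indVec hp, M.defectPairing_indVec hp]

theorem eventually_add_mul_ne {μ : ℂ} (hμ : μ.im ≠ 0) (ω : ℂ) (k : ℝ) :
    ∀ᶠ ε : ℝ in 𝓝[>] 0, (k : ℂ) + ε * ω ≠ μ :=
  (tendsto_add_mul ω k).eventually_ne fun h => hμ (by rw [← h]; simp)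

theorem tendsto_div_sub {μ : ℂ} (hμ : μ.im ≠ 0) (c ω : ℂ) (k : ℝ) :
    Tendsto (fun ε : ℝ => c / ((k : ℂ) + ε * ω - μ)) (𝓝[>] 0) (𝓝 (c / (k - μ))) :=
  tendsto_const_nhds.div ((tendsto_add_mul ω k).sub_const μ) (ofReal_sub_ne_zero hμ k)

theorem cauchyInt_indC_ofReal_ne_zero {p q : ℝ} (hpq : p < q) (hk : k < p) :
    cauchyInt (indC p q) k ≠ 0 := by
  rw [cauchyInt_indC_ofReal hpq.le]
  exact Complex.ofReal_ne_zero.2 (integral_inv_sub_pos hpq hk).ne'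

/-- For `v = u_{μ₀}` and `w` the indicator of a far interval, the matrix element is `M_B` times a
function continuous and nonzero at `k`, plus a continuous function. Its jump is therefore a nonzero
multiple of `1/E(k) - 1/F(k)`. -/
theorem Model.hasNonzeroJump_of_notMem_endpoints (M : Model a' b' a b φ ψ)
    (hμ₀ : μ₀ ∈ rho (extensionOp φ ψ B)) (hμ₁ : μ₁ ∈ rho (extensionOp ψ φ (conj B)))
    (hk : k ∉ Set.Icc a' b') (hend : k ∉ ({a', b', a, b} : Set ℝ))
    (hbv : HasBoundaryValues (mFunction φ ψ B) k) :
    HasNonzeroJump (borderedResolvent φ ψ B μ₀ μ₁) k := by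
  obtain ⟨E, F, hE, hF, hEF⟩ := M.exists_sideExtension_ne B hend
  obtain ⟨⟨p, hp⟩, q, hq⟩ := hbv
  have hE0 := right_ne_zero_of_mul_eq_one (hE.mul_eq_one M.nondegenerate I_sign hp)
  have hF0 := right_ne_zero_of_mul_eq_one
    (hF.mul_eq_one M.nondegenerate neg_I_sign (hasLowerValue_iff.1 hq))
  obtain ⟨hi, hm₀⟩ := M.disjointSupport.mem_rho_iff.1 hμ₀
  -- The test interval lies to the right of `k`, so its Cauchy transform is continuous and nonzero
  -- at `k`, and to the right of `b'`, so that `ψ` drops out of the pairing.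
  set N : ℝ := max k b' + 1 with hN
  have hkN : k < N := by linarith [le_max_left k b']
  have hbN : b' < N := by linarith [le_max_right k b']
  have hc := cauchyInt_indC_ofReal_ne_zero (q := N + 1) (lt_add_one N) hkN
  set c := cauchyInt (indC N (N + 1)) k with hcdef
  have hkI : k ∉ Set.Icc N (N + 1) := fun h => absurd h.1 (not_le.2 hkN)
  have key : ∀ ω : ℂ, ω = Complex.I ∨ ω = -Complex.I → ∀ G : ℂ → ℂ,
      SideExtension (weylDenom φ ψ B) ω k G → G k ≠ 0 →
      Tendsto (fun ε : ℝ => inner ℂ (indVec N (N + 1))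
        (borderedResolvent φ ψ B μ₀ μ₁ (k + ε * ω) (defectVec φ ψ μ₀ hi))) (𝓝[>] 0)
        (𝓝 (weylDenom φ ψ B μ₀ / (k - μ₀) * ((G k)⁻¹ * c
          - (weylDenom φ ψ B μ₀)⁻¹ * cauchyInt (indC N (N + 1)) μ₀))) := by
    intro ω hω G hG hG0
    refine ((tendsto_div_sub hi _ ω k).mul ((((hG.tendsto hω).inv₀ hG0).mul
      (tendsto_cauchyInt_of_support (cauchyIntegrable_of_integrable (integrable_indC N (N + 1)))
        (indC_support N (N + 1)) hkI ω)).sub_const _)).congr' ?_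
    filter_upwards [hG.eventually_weylDenom_ne_zero M.nondegenerate hω, self_mem_nhdsWithin,
      eventually_add_mul_ne hi ω k] with ε hm hε hne
    exact (M.inner_borderedResolvent_defectVec hμ₀ hμ₁ hi hbN
      (add_mul_im_ne_zero hω k (Set.mem_Ioi.1 hε)) hm hne).symm
  refine ⟨_, _, _, ?_, hasJump_of_tendsto (f := fun z => inner ℂ (indVec N (N + 1))
    (borderedResolvent φ ψ B μ₀ μ₁ z (defectVec φ ψ μ₀ hi))) (key _ I_sign E hE hE0)
    (key _ neg_I_sign F hF hF0)⟩
  rw [← mul_sub, sub_sub_sub_cancel_right, ← sub_mul]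
  refine mul_ne_zero (div_ne_zero hm₀ (ofReal_sub_ne_zero hi k)) (mul_ne_zero ?_ hc)
  rw [sub_ne_zero]
  exact fun h => hEF.2 hk (inv_injective h)

/-- Without boundary values of `M_B` the continued denominators may vanish at `k`, so the matrix
elements may be unbounded. Multiplying their difference by both denominators keeps everything
convergent, and a vanishing jump would force `E(k) = F(k)`. -/
theorem Model.not_jumpVanishes_of_notMem_endpoints (M : Model a' b' a b φ ψ)
    (hμ₀ : μ₀ ∈ rho (extensionOp φ ψ B)) (hμ₁ : μ₁ ∈ rho (extensionOp ψ φ (conj B)))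
    (hk : k ∉ Set.Icc a' b') (hend : k ∉ ({a', b', a, b} : Set ℝ)) :
    ¬ JumpVanishes (borderedResolvent φ ψ B μ₀ μ₁) k := by
  intro hvan
  obtain ⟨E, F, hE, hF, hEF⟩ := M.exists_sideExtension_ne B hend
  obtain ⟨hi, hm₀⟩ := M.disjointSupport.mem_rho_iff.1 hμ₀
  set N : ℝ := max k b' + 1 with hN
  have hkN : k < N := by linarith [le_max_left k b']
  have hbN : b' < N := by linarith [le_max_right k b']
  have hc := cauchyInt_indC_ofReal_ne_zero (q := N + 1) (lt_add_one N) hkN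
  have hkI : k ∉ Set.Icc N (N + 1) := fun h => absurd h.1 (not_le.2 hkN)
  set κ := (weylDenom φ ψ B μ₀)⁻¹ * cauchyInt (indC N (N + 1)) μ₀ with hκ
  set X : ℂ → ℂ := fun z => inner ℂ (indVec N (N + 1))
    (borderedResolvent φ ψ B μ₀ μ₁ z (defectVec φ ψ μ₀ hi)) with hX
  set r : ℂ → ℂ := fun z => weylDenom φ ψ B μ₀ / (z - μ₀) with hr
  set W := weylDenom φ ψ B with hW
  set C := cauchyInt (indC N (N + 1)) with hC
  have hjump : Tendsto (fun ε : ℝ => X (k + ε * Complex.I) - X (k + ε * (-Complex.I))) (𝓝[>] 0)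
      (𝓝 0) := by
    have h := hvan (defectVec φ ψ μ₀ hi) (indVec N (N + 1))
    simp only [HasJump, sub_mul_I] at h
    exact h
  have hrl : ∀ ω : ℂ, Tendsto (fun ε : ℝ => r (k + ε * ω)) (𝓝[>] 0) (𝓝 (r k)) := fun ω =>
    tendsto_div_sub hi _ ω k
  have hCl : ∀ ω : ℂ, Tendsto (fun ε : ℝ => C (k + ε * ω)) (𝓝[>] 0) (𝓝 (C k)) := fun ω =>
    tendsto_cauchyInt_of_support (cauchyIntegrable_of_integrable (integrable_indC N (N + 1)))
      (indC_support N (N + 1)) hkI ω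
  have hid : ∀ ω : ℂ, ω = Complex.I ∨ ω = -Complex.I → ∀ G : ℂ → ℂ, SideExtension W ω k G →
      ∀ᶠ ε : ℝ in 𝓝[>] 0, (X (k + ε * ω) + r (k + ε * ω) * κ) * W (k + ε * ω)
        = r (k + ε * ω) * C (k + ε * ω) := by
    intro ω hω G hG
    filter_upwards [hG.eventually_weylDenom_ne_zero M.nondegenerate hω, self_mem_nhdsWithin,
      eventually_add_mul_ne hi ω k] with ε hm hε hne
    have h1 := M.inner_borderedResolvent_defectVec hμ₀ hμ₁ hi hbN (q := N + 1)
      (add_mul_im_ne_zero hω k (Set.mem_Ioi.1 hε)) hm hne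
    change X _ = r _ * ((W _)⁻¹ * C _ - κ) at h1
    rw [h1]
    have hm' : W (k + ε * ω) ≠ 0 := hm
    field_simp
    ring
  -- Both sides are limits of the same quantity, the difference of the matrix elements (up to a
  -- continuous term) times the product of the two denominators.
  have hL := ((hjump.add (((hrl Complex.I).sub (hrl (-Complex.I))).mul_const κ)).mul
    (hE.tendsto I_sign)).mul (hF.tendsto neg_I_sign)
  have hR := (((hrl Complex.I).mul (hCl Complex.I)).mul (hF.tendsto neg_I_sign)).sub
    (((hrl (-Complex.I)).mul (hCl (-Complex.I))).mul (hE.tendsto I_sign))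
  have heq := tendsto_nhds_unique hL (hR.congr' (by
    filter_upwards [hid _ I_sign E hE, hid _ neg_I_sign F hF] with ε h1 h2
    rw [← h1, ← h2]
    ring))
  have h3 : (r k * C k) * (F k - E k) = 0 := by linear_combination -heq
  have hr0 : r k ≠ 0 := div_ne_zero hm₀ (ofReal_sub_ne_zero hi k)
  exact hEF.2 hk (sub_eq_zero.1 ((mul_eq_zero.1 h3).resolve_left (mul_ne_zero hr0 hc))).symm

end Model

/-! ### The bordered resolvent at the endpoints of `I`. -/

theorem norm_sub_add_mul {ω : ℂ} (hω : ω = Complex.I ∨ ω = -Complex.I) (e : ℝ) {ε : ℝ}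
    (hε : 0 < ε) : ‖(e : ℂ) - (e + ε * ω)‖ = ε := by
  have h1 : ‖ω‖ = 1 := by rcases hω with rfl | rfl <;> simp
  rw [sub_add_cancel_left, norm_neg, norm_mul, h1, Complex.norm_real, mul_one, Real.norm_eq_abs,
    abs_of_pos hε]

theorem tendsto_log_norm_sub {e r : ℝ} (h : r ≠ e) (ω : ℂ) :
    Tendsto (fun ε : ℝ => Real.log ‖(r : ℂ) - (e + ε * ω)‖) (𝓝[>] 0)
      (𝓝 (Real.log ‖(r : ℂ) - e‖)) := by
  have hne : ‖(r : ℂ) - e‖ ≠ 0 := by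
    rw [norm_ne_zero_iff, sub_ne_zero]
    exact fun h' => h (Complex.ofReal_injective h')
  exact (((tendsto_add_mul ω e).const_sub (r : ℂ)).norm).log hne

/-- The Cauchy transform of an indicator function blows up at the endpoints of the interval. -/
theorem tendsto_norm_cauchyInt_indC {p q e : ℝ} (hpq : p < q) (he : e = q ∨ e = p) {ω : ℂ}
    (hω : ω = Complex.I ∨ ω = -Complex.I) :
    Tendsto (fun ε : ℝ => ‖cauchyInt (indC p q) (e + ε * ω)‖) (𝓝[>] 0) atTop := by
  have hre : ∀ᶠ ε : ℝ in 𝓝[>] 0, |Real.log ‖(q : ℂ) - (e + ε * ω)‖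
      - Real.log ‖(p : ℂ) - (e + ε * ω)‖| ≤ ‖cauchyInt (indC p q) (e + ε * ω)‖ := by
    filter_upwards [self_mem_nhdsWithin] with ε hε
    refine le_trans (le_of_eq ?_) (Complex.abs_re_le_norm _)
    rw [cauchyInt_indC_of_im hpq.le (add_mul_im_ne_zero hω e (Set.mem_Ioi.1 hε)), Complex.sub_re,
      Complex.log_re, Complex.log_re]
  refine tendsto_atTop_mono' _ hre ?_
  have hlog : Tendsto (fun ε : ℝ => Real.log ‖(e : ℂ) - (e + ε * ω)‖) (𝓝[>] 0) atBot := by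
    refine Real.tendsto_log_nhdsGT_zero.congr' ?_
    filter_upwards [self_mem_nhdsWithin] with ε hε
    rw [norm_sub_add_mul hω e (Set.mem_Ioi.1 hε)]
  rcases he with rfl | rfl
  · exact tendsto_abs_atBot_atTop.comp
      (hlog.atBot_add (tendsto_log_norm_sub hpq.ne ω).neg)
  · exact tendsto_abs_atTop_atTop.comp
      ((tendsto_log_norm_sub hpq.ne' ω).add_atTop (tendsto_neg_atBot_atTop.comp hlog))

theorem tendsto_arg_sub_of_gt {e r : ℝ} (h : e < r) :
    Tendsto (fun ε : ℝ => Complex.arg ((r : ℂ) - (e + ε * Complex.I))) (𝓝[>] 0) (𝓝 0) := by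
  have h1 : ((r : ℂ) - e).arg = 0 := by
    rw [← Complex.ofReal_sub]
    exact Complex.arg_ofReal_of_nonneg (sub_pos.2 h).le
  have h2 : ContinuousAt Complex.arg ((r : ℂ) - e) := by
    refine Complex.continuousAt_arg (Or.inl ?_)
    simpa using h
  have h3 := h2.tendsto.comp ((tendsto_add_mul Complex.I e).const_sub (r : ℂ))
  rwa [h1] at h3

theorem tendsto_arg_sub_of_lt {e r : ℝ} (h : r < e) :
    Tendsto (fun ε : ℝ => Complex.arg ((r : ℂ) - (e + ε * Complex.I))) (𝓝[>] 0)
      (𝓝 (-Real.pi)) := by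
  refine (Complex.tendsto_arg_nhdsWithin_im_neg_of_re_neg_of_im_zero (z := (r : ℂ) - e)
    (by simpa using h) (by simp)).comp (tendsto_nhdsWithin_iff.2
      ⟨(tendsto_add_mul Complex.I e).const_sub (r : ℂ), ?_⟩)
  filter_upwards [self_mem_nhdsWithin] with ε hε
  simpa using hε

theorem arg_sub_self_add_mul (e : ℝ) {ε : ℝ} (hε : 0 < ε) :
    Complex.arg ((e : ℂ) - (e + ε * Complex.I)) = -(Real.pi / 2) := by
  rw [sub_add_cancel_left, ← mul_neg, Complex.arg_real_mul _ hε, Complex.arg_neg_I]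

/-- The transform is conjugation symmetric, so the difference is `2i` times its imaginary part, a
difference of two arguments. At an endpoint this tends to `π/2`, which gives half of the interior
jump even though the transform itself is unbounded. -/
theorem hasJump_cauchyInt_indC_endpoint {p q e : ℝ} (hpq : p < q) (he : e = q ∨ e = p) :
    HasJump (cauchyInt (indC p q)) e (Real.pi * Complex.I) := by
  have him : Tendsto (fun ε : ℝ => Complex.arg ((q : ℂ) - (e + ε * Complex.I))
      - Complex.arg ((p : ℂ) - (e + ε * Complex.I))) (𝓝[>] 0) (𝓝 (Real.pi / 2)) := by
    have hc : Tendsto (fun ε : ℝ => Complex.arg ((e : ℂ) - (e + ε * Complex.I))) (𝓝[>] 0)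
        (𝓝 (-(Real.pi / 2))) := by
      refine tendsto_const_nhds.congr' ?_
      filter_upwards [self_mem_nhdsWithin] with ε hε
      rw [arg_sub_self_add_mul e (Set.mem_Ioi.1 hε)]
    rcases he with rfl | rfl
    · have h := hc.sub (tendsto_arg_sub_of_lt hpq)
      convert h using 2
      ring
    · have h := (tendsto_arg_sub_of_gt hpq).sub hc
      convert h using 2
      ring
  have h1 := ((Complex.continuous_ofReal.tendsto _).comp (him.const_mul 2)).mul_const Complex.I
  have e1 : ((2 * (Real.pi / 2) : ℝ) : ℂ) * Complex.I = Real.pi * Complex.I := by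
    push_cast
    ring
  rw [e1] at h1
  refine h1.congr' ?_
  filter_upwards [self_mem_nhdsWithin] with ε hε
  have hz := add_mul_im_ne_zero I_sign e (Set.mem_Ioi.1 hε)
  have hconj : (e : ℂ) - ε * Complex.I = conj (e + ε * Complex.I) := by
    simp [sub_eq_add_neg]
  have h2 : cauchyInt (indC p q) (conj ((e : ℂ) + ε * Complex.I))
      = conj (cauchyInt (indC p q) (e + ε * Complex.I)) := by
    rw [indC_eq_ofReal, cauchyInt_ofReal_conj]
  rw [hconj, h2, Complex.sub_conj, cauchyInt_indC_of_im hpq.le hz, Complex.sub_im, Complex.log_im,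
    Complex.log_im]
  rfl

theorem tendsto_cauchyInt_indC_inside {p q e : ℝ} (he : e ∈ Set.Ioo p q) {ω : ℂ}
    (hω : ω = Complex.I ∨ ω = -Complex.I) :
    Tendsto (fun ε : ℝ => cauchyInt (indC p q) (e + ε * ω)) (𝓝[>] 0)
      (𝓝 (logQuot p q e + halfPlaneConst ω)) := by
  refine (((analyticAt_logQuot he).continuousAt.tendsto.comp
    (tendsto_add_mul ω e)).add_const _).congr' ?_
  filter_upwards [self_mem_nhdsWithin] with ε hε
  exact (cauchyInt_indC_eq_logQuot (he.1.trans he.2).le (add_mul_mem_sameSide hω e hε)).symm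

section Model

variable {a' b' a b : ℝ} {φ ψ : L2} {B μ₀ μ₁ : ℂ}

/-- At an endpoint of `I`, the ratio of the Cauchy transform of the indicator function of an
adjacent interval and the denominator of the `M`-function has the same limit from both sides. -/
theorem Model.tendsto_weylDenom_div (M : Model a' b' a b φ ψ) (B : ℂ) {p q e p' q' : ℝ}
    (hpq : p < q) (he : e = q ∨ e = p) (he' : e ∈ Set.Ioo p' q') (hb : b' < e)
    (hsum : ∀ z : ℂ, z.im ≠ 0 →
      cauchyInt (indC p q) z + cauchyInt (indC a b) z = cauchyInt (indC p' q') z)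
    {ω : ℂ} (hω : ω = Complex.I ∨ ω = -Complex.I) :
    Tendsto (fun ε : ℝ => weylDenom φ ψ B (e + ε * ω) / cauchyInt (indC p q) (e + ε * ω)) (𝓝[>] 0)
      (𝓝 (cauchyInt (psiFun a' b' a b) e)) := by
  have hblow := tendsto_norm_cauchyInt_indC hpq he hω
  have hinv : Tendsto (fun ε : ℝ => (cauchyInt (indC p q) (e + ε * ω))⁻¹) (𝓝[>] 0) (𝓝 0) :=
    tendsto_inv₀_cobounded.comp (tendsto_norm_atTop_iff_cobounded.1 hblow)
  have hψ : Tendsto (fun ε : ℝ => cauchyInt (psiFun a' b' a b) (e + ε * ω)) (𝓝[>] 0)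
      (𝓝 (cauchyInt (psiFun a' b' a b) e)) :=
    tendsto_cauchyInt_of_support (cauchyIntegrable_of_integrable M.integrable_psiFun)
      (psiFun_support a' b' a b) (fun h => absurd h.2 (not_le.2 hb)) ω
  -- With `φ̂ = (χ_{[p',q']})^ - (χ_{[p,q]})^`, the quotient is `ψ̂` plus a term whose numerator
  -- converges, as `e` is interior to `[p', q']`, and whose denominator blows up.
  have hlim := (((tendsto_const_nhds (x := halfPlaneConst ω - B)).sub
    ((tendsto_cauchyInt_indC_inside he' hω).mul hψ)).mul hinv).add hψ
  rw [mul_zero, zero_add] at hlim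
  refine hlim.congr' ?_
  filter_upwards [self_mem_nhdsWithin, hblow.eventually_gt_atTop 0] with ε hε hpos
  have hside := add_mul_mem_sameSide hω e hε
  have hne : cauchyInt (indC p q) (e + ε * ω) ≠ 0 := norm_pos_iff.1 hpos
  rw [M.weylDenom_eq, halfPlaneConst_of_mem_sameSide hside,
    ← hsum _ (im_ne_zero_of_mem_sameSide hside)]
  field_simp
  ring

/-- The indicator of an interval adjacent to `I` is detectable and orthogonal to `φ`. Against the
indicator of a window around `e`, the matrix element is `ĝ - ŵ/(D/ĝ)`, where `D/ĝ` tends to `s =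
ψ̂(e)` from both sides. The jump is `πi - 2πi/s = πi(1 - 2/s)`, and `s < 0` makes it nonzero. -/
theorem Model.hasNonzeroJump_of_adjacent (M : Model a' b' a b φ ψ)
    (hμ₀ : μ₀ ∈ rho (extensionOp φ ψ B)) (hμ₁ : μ₁ ∈ rho (extensionOp ψ φ (conj B)))
    {p q e δ p' q' : ℝ} (hpq : p < q) (he : e = q ∨ e = p) (he' : e ∈ Set.Ioo p' q') (hδ : 0 < δ)
    (hb : b' < e - δ) (hsub : Set.Icc p q ⊆ Set.Icc (e - δ) (e + δ))
    (hI : ∀ᵐ x, indC a b x * indC p q x = 0)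
    (hsum : ∀ z : ℂ, z.im ≠ 0 →
      cauchyInt (indC p q) z + cauchyInt (indC a b) z = cauchyInt (indC p' q') z) :
    HasNonzeroJump (borderedResolvent φ ψ B μ₀ μ₁) e := by
  have hbe : b' < e := by linarith
  obtain ⟨s, hs, hs'⟩ := M.cauchyInt_psiFun_neg hbe
  have hg : indVec p q ∈ detectableSubspace φ ψ B μ₀ := by
    refine M.mem_detectableSubspace_of_ae hμ₀ ?_
    filter_upwards [hI, indVec_coe p q] with x h1 h2 hx
    rw [h2]
    rcases hx with hx | hx
    · rwa [indC_of_mem hx, one_mul] at h1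
    · exact indC_of_notMem fun h => by linarith [(hsub h).1, hx.2]
  have hφg : ∀ z, cauchyInt (fun x => conj (φ x) * indVec p q x) z = 0 := fun z => by
    rw [M.cauchyInt_conj_left_mul, cauchyInt_congr (g := fun _ => 0) ?_]
    · simp [cauchyInt]
    · filter_upwards [hI, indVec_coe p q] with x h1 h2
      rw [h2, h1]
  have hwg : ∀ z, cauchyInt (fun x => conj (indVec (e - δ) (e + δ) x) * indVec p q x) z
      = cauchyInt (indC p q) z := fun z => by
    refine cauchyInt_congr ?_ z
    filter_upwards [indVec_coe p q, indVec_coe (e - δ) (e + δ)] with x h1 h2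
    rw [h1, h2, conj_indC]
    by_cases hx : x ∈ Set.Icc p q
    · rw [indC_of_mem (hsub hx), one_mul]
    · rw [indC_of_notMem hx, mul_zero]
  have hg1 : ∀ z, cauchyInt (indVec p q) z = cauchyInt (indC p q) z := fun z =>
    cauchyInt_congr (indVec_coe p q) z
  have hs0 : (s : ℂ) ≠ 0 := Complex.ofReal_ne_zero.2 hs.ne
  have hmid : e ∈ Set.Ioo (e - δ) (e + δ) := ⟨by linarith, by linarith⟩
  -- The window is symmetric about `e`, so the one-sided limits of its transform are exactly `±πi`.
  have hL0 : logQuot (e - δ) (e + δ) e = 0 := by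
    rw [logQuot]
    push_cast
    rw [add_sub_cancel_left, sub_sub_cancel, sub_self]
  set g := cauchyInt (indC p q) with hgdef
  set w := cauchyInt (indC (e - δ) (e + δ)) with hwdef
  set W := weylDenom φ ψ B with hWdef
  have hW : ∀ ω : ℂ, ω = Complex.I ∨ ω = -Complex.I →
      Tendsto (fun ε : ℝ => W (e + ε * ω) / g (e + ε * ω)) (𝓝[>] 0) (𝓝 (s : ℂ)) := by
    intro ω hω
    rw [← hs']
    exact M.tendsto_weylDenom_div B hpq he he' hbe hsum hω
  have hQ : ∀ ω : ℂ, ω = Complex.I ∨ ω = -Complex.I →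
      Tendsto (fun ε : ℝ => (W (e + ε * ω) / g (e + ε * ω))⁻¹ * w (e + ε * ω)) (𝓝[>] 0)
        (𝓝 ((s : ℂ)⁻¹ * halfPlaneConst ω)) := by
    intro ω hω
    have h1 := tendsto_cauchyInt_indC_inside hmid hω
    rw [hL0, zero_add] at h1
    exact ((hW ω hω).inv₀ hs0).mul h1
  have hid : ∀ ω : ℂ, ω = Complex.I ∨ ω = -Complex.I → ∀ᶠ ε : ℝ in 𝓝[>] 0,
      inner ℂ (indVec (e - δ) (e + δ)) (borderedResolvent φ ψ B μ₀ μ₁ (e + ε * ω) (indVec p q))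
        = g (e + ε * ω) - (W (e + ε * ω) / g (e + ε * ω))⁻¹ * w (e + ε * ω) := by
    intro ω hω
    filter_upwards [self_mem_nhdsWithin, (hW ω hω).eventually_ne hs0] with ε hε hne
    have hz := add_mul_im_ne_zero hω e (Set.mem_Ioi.1 hε)
    have hm : weylDenom φ ψ B (e + ε * ω) ≠ 0 := fun h => hne (by rw [hWdef, h, zero_div])
    rw [M.borderedResolvent_apply_of_mem hμ₁ hz hm hg, inner_kreinResolvent, hφg, hwg, hg1,
      M.defectPairing_indVec hb, inv_div, div_eq_inv_mul]
    ring
  have hgj := hasJump_cauchyInt_indC_endpoint hpq he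
  simp only [HasJump, sub_mul_I] at hgj
  refine ⟨indVec p q, indVec (e - δ) (e + δ),
    Real.pi * Complex.I - ((s : ℂ)⁻¹ * halfPlaneConst Complex.I
      - (s : ℂ)⁻¹ * halfPlaneConst (-Complex.I)), ?_, ?_⟩
  · rw [halfPlaneConst_I, halfPlaneConst_neg_I]
    have h1 : (Real.pi * Complex.I : ℂ) - ((s : ℂ)⁻¹ * (Real.pi * Complex.I)
        - (s : ℂ)⁻¹ * -(Real.pi * Complex.I))
        = Real.pi * Complex.I * ((1 - 2 * s⁻¹ : ℝ) : ℂ) := by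
      push_cast
      ring
    rw [h1]
    have h2 : s⁻¹ < 0 := inv_lt_zero.2 hs
    refine mul_ne_zero (mul_ne_zero ?_ Complex.I_ne_zero) ?_
    · exact Complex.ofReal_ne_zero.2 Real.pi_ne_zero
    · refine Complex.ofReal_ne_zero.2 ?_
      linarith
  · simp only [HasJump, sub_mul_I]
    refine (hgj.sub ((hQ _ I_sign).sub (hQ _ neg_I_sign))).congr' ?_
    filter_upwards [hid _ I_sign, hid _ neg_I_sign] with ε h1 h2
    rw [h1, h2]
    ring

theorem Model.hasNonzeroJump_left_endpoint (M : Model a' b' a b φ ψ)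
    (hμ₀ : μ₀ ∈ rho (extensionOp φ ψ B)) (hμ₁ : μ₁ ∈ rho (extensionOp ψ φ (conj B))) :
    HasNonzeroJump (borderedResolvent φ ψ B μ₀ μ₁) a := by
  -- Half the gap keeps the adjacent interval and the window strictly to the right of `I'`.
  have hδ : 0 < (a - b') / 2 := half_pos (sub_pos.2 M.gap)
  have hlt : a - (a - b') / 2 < a := by linarith
  refine M.hasNonzeroJump_of_adjacent hμ₀ hμ₁ (p := a - (a - b') / 2) (q := a) (p' := a - (a - b') / 2)
    (q' := b) hlt (Or.inl rfl) ⟨hlt, M.lt⟩ hδ (by linarith [M.gap])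
    (Set.Icc_subset_Icc le_rfl (by linarith)) ?_ fun z hz => ?_
  · filter_upwards [Measure.ae_ne volume a] with x hx
    by_cases h1 : x ∈ Set.Icc a b
    · rw [indC_of_notMem (p := a - (a - b') / 2) (q := a) fun h2 => hx (le_antisymm h2.2 h1.1), mul_zero]
    · rw [indC_of_notMem h1, zero_mul]
  · rw [cauchyInt_indC_of_im hlt.le hz, cauchyInt_indC_of_im M.lt.le hz,
      cauchyInt_indC_of_im (hlt.trans M.lt).le hz]
    ring

theorem Model.hasNonzeroJump_right_endpoint (M : Model a' b' a b φ ψ)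
    (hμ₀ : μ₀ ∈ rho (extensionOp φ ψ B)) (hμ₁ : μ₁ ∈ rho (extensionOp ψ φ (conj B))) :
    HasNonzeroJump (borderedResolvent φ ψ B μ₀ μ₁) b := by
  -- With this radius the window around `b` starts at `a`, to the right of `I'`.
  have hδ : 0 < b - a := sub_pos.2 M.lt
  have hlt : b < b + (b - a) := by linarith
  refine M.hasNonzeroJump_of_adjacent hμ₀ hμ₁ (p := b) (q := b + (b - a)) (p' := a)
    (q' := b + (b - a)) hlt (Or.inr rfl) ⟨M.lt, hlt⟩ hδ (by linarith [M.gap])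
    (Set.Icc_subset_Icc (by linarith) le_rfl) ?_ fun z hz => ?_
  · filter_upwards [Measure.ae_ne volume b] with x hx
    by_cases h1 : x ∈ Set.Icc a b
    · rw [indC_of_notMem (p := b) (q := b + (b - a)) fun h2 => hx (le_antisymm h1.2 h2.1),
        mul_zero]
    · rw [indC_of_notMem h1, zero_mul]
  · rw [cauchyInt_indC_of_im hlt.le hz, cauchyInt_indC_of_im M.lt.le hz,
      cauchyInt_indC_of_im (M.lt.trans hlt).le hz]
    ring

theorem HasNonzeroJump.not_jumpVanishes {F : ℂ → L2 →L[ℂ] L2} {k : ℝ} (h : HasNonzeroJump F k) :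
    ¬ JumpVanishes F k := by
  obtain ⟨v, w, J, hJ, hlim⟩ := h
  exact fun hvan => hJ (tendsto_nhds_unique hlim (hvan v w))

theorem Model.eq_endpoint_of_mem (M : Model a' b' a b φ ψ) {k : ℝ} (hk : k ∉ Set.Icc a' b')
    (hend : k ∈ ({a', b', a, b} : Set ℝ)) : k = a ∨ k = b := by
  rcases hend with rfl | rfl | h | h
  · exact absurd ⟨le_rfl, M.lt'.le⟩ hk
  · exact absurd ⟨M.lt'.le, le_rfl⟩ hk
  · exact Or.inl h
  · exact Or.inr h

/-- Off `I'` the bordered resolvent has a jump wherever the `M`-function has boundary values. -/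
theorem Model.hasNonzeroJump (M : Model a' b' a b φ ψ)
    (hμ₀ : μ₀ ∈ rho (extensionOp φ ψ B)) (hμ₁ : μ₁ ∈ rho (extensionOp ψ φ (conj B))) {k : ℝ}
    (hk : k ∉ Set.Icc a' b') (hbv : HasBoundaryValues (mFunction φ ψ B) k) :
    HasNonzeroJump (borderedResolvent φ ψ B μ₀ μ₁) k := by
  by_cases hend : k ∈ ({a', b', a, b} : Set ℝ)
  · rcases M.eq_endpoint_of_mem hk hend with rfl | rfl
    · exact M.hasNonzeroJump_left_endpoint hμ₀ hμ₁
    · exact M.hasNonzeroJump_right_endpoint hμ₀ hμ₁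
  · exact M.hasNonzeroJump_of_notMem_endpoints hμ₀ hμ₁ hk hend hbv

/-- Off `I'` the jump of the bordered resolvent does not vanish. -/
theorem Model.not_jumpVanishes (M : Model a' b' a b φ ψ)
    (hμ₀ : μ₀ ∈ rho (extensionOp φ ψ B)) (hμ₁ : μ₁ ∈ rho (extensionOp ψ φ (conj B))) {k : ℝ}
    (hk : k ∉ Set.Icc a' b') : ¬ JumpVanishes (borderedResolvent φ ψ B μ₀ μ₁) k := by
  by_cases hend : k ∈ ({a', b', a, b} : Set ℝ)
  · rcases M.eq_endpoint_of_mem hk hend with rfl | rfl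
    · exact (M.hasNonzeroJump_left_endpoint hμ₀ hμ₁).not_jumpVanishes
    · exact (M.hasNonzeroJump_right_endpoint hμ₀ hμ₁).not_jumpVanishes
  · exact M.not_jumpVanishes_of_notMem_endpoints hμ₀ hμ₁ hk hend

end Model

end Friedrichs

theorem theorem8p8 (a' b' a b : ℝ) (hI' : a' < b') (hleft : b' < a) (hI : a < b)
    (φ ψ : Friedrichs.L2)
    (hφ : φ =ᵐ[volume] (Set.Icc a b).indicator fun _ => (1 : ℂ))
    (hψ : ψ =ᵐ[volume] (Set.Icc a' b').indicator
      fun x => (((∫ t in a..b, 1 / (t - x))⁻¹ : ℝ) : ℂ))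
    (B : ℂ) :
    -- the resolvent sets are non-empty
    (Friedrichs.rho (Friedrichs.extensionOp φ ψ B)).Nonempty ∧
    (Friedrichs.rho (Friedrichs.extensionOp ψ φ (starRingEnd ℂ B))).Nonempty ∧
    -- the detectable subspaces
    (∀ μ₀ ∈ Friedrichs.rho (Friedrichs.extensionOp φ ψ B),
      Friedrichs.detectableSubspace φ ψ B μ₀ ≠ ⊤ ∧
      ¬ FiniteDimensional ℂ (Friedrichs.detectableSubspace φ ψ B μ₀)ᗮ) ∧
    (∀ μ₁ ∈ Friedrichs.rho (Friedrichs.extensionOp ψ φ (starRingEnd ℂ B)),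
      Friedrichs.detectableSubspace ψ φ (starRingEnd ℂ B) μ₁ = ⊤) ∧
    -- the `M`-function is well defined and does not vanish on the resolvent set
    (∀ z ∈ Friedrichs.rho (Friedrichs.extensionOp φ ψ B),
      (∃! m : ℂ, Friedrichs.IsMValue φ ψ B z m) ∧ Friedrichs.mFunction φ ψ B z ≠ 0) ∧
    -- near each real point that is not an endpoint, it is defined on both sides of the axis
    (∀ k : ℝ, k ∉ ({a', b', a, b} : Set ℝ) → ∀ᶠ ε : ℝ in 𝓝[>] 0,
      (k : ℂ) + ε * Complex.I ∈ Friedrichs.rho (Friedrichs.extensionOp φ ψ B) ∧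
      (k : ℂ) - ε * Complex.I ∈ Friedrichs.rho (Friedrichs.extensionOp φ ψ B)) ∧
    -- the jump of `M_B⁻¹`
    (∀ k : ℝ, k ∉ Set.Icc a b ∪ Set.Icc a' b' →
      Friedrichs.HasJump (fun z => (Friedrichs.mFunction φ ψ B z)⁻¹) k
        (2 * Real.pi * Complex.I)) ∧
    (∀ k ∈ Set.Ioo a b,
      Friedrichs.HasJump (fun z => (Friedrichs.mFunction φ ψ B z)⁻¹) k
        (2 * Real.pi * Complex.I * (1 - Friedrichs.cauchyTransform ψ k))) ∧
    (∀ k ∈ Set.Ioo a' b',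
      Friedrichs.HasJump (fun z => (Friedrichs.mFunction φ ψ B z)⁻¹) k 0) ∧
    -- `M_B` has finite boundary values almost everywhere, and jumps exactly off `I'`
    (∀ᵐ k : ℝ, Friedrichs.HasBoundaryValues (Friedrichs.mFunction φ ψ B) k) ∧
    (∀ k : ℝ, k ∉ ({a', b', a, b} : Set ℝ) → ∀ p q : ℂ,
      Friedrichs.HasUpperValue (Friedrichs.mFunction φ ψ B) k p →
      Friedrichs.HasLowerValue (Friedrichs.mFunction φ ψ B) k q →
      (p ≠ q ↔ k ∉ Set.Icc a' b')) ∧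
    -- the bordered resolvent jumps exactly off `I'`
    (∀ μ₀ ∈ Friedrichs.rho (Friedrichs.extensionOp φ ψ B),
      ∀ μ₁ ∈ Friedrichs.rho (Friedrichs.extensionOp ψ φ (starRingEnd ℂ B)),
        (∀ k : ℝ, k ∉ Set.Icc a' b' →
          ¬ Friedrichs.JumpVanishes (Friedrichs.borderedResolvent φ ψ B μ₀ μ₁) k) ∧
        (∀ k : ℝ, k ∉ Set.Icc a' b' →
          Friedrichs.HasBoundaryValues (Friedrichs.mFunction φ ψ B) k →
          Friedrichs.HasNonzeroJump (Friedrichs.borderedResolvent φ ψ B μ₀ μ₁) k) ∧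
        (∀ k ∈ Set.Ioo a' b',
          Friedrichs.HasBoundaryValues (Friedrichs.mFunction φ ψ B) k →
          Friedrichs.JumpVanishes (Friedrichs.borderedResolvent φ ψ B μ₀ μ₁) k)) := by
  have M : Friedrichs.Model a' b' a b φ ψ := ⟨hI', hleft, hI, hφ, by
    filter_upwards [hψ] with x hx
    rw [hx, Friedrichs.psiFun, Friedrichs.weight]
    by_cases h : x ∈ Set.Icc a' b'
    · rw [Set.indicator_of_mem h, Set.indicator_of_mem h]
    · rw [Set.indicator_of_notMem h, Set.indicator_of_notMem h, Complex.ofReal_zero]⟩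
  refine ⟨M.nondegenerate.rho_nonempty B, M.nondegenerate_swap.rho_nonempty _,
    fun μ₀ hμ₀ => ⟨M.detectableSubspace_ne_top hμ₀, M.infinite_orthogonal hμ₀⟩,
    fun μ₁ hμ₁ => M.detectableSubspace_swap_eq_top hμ₁, fun z hz => ?_,
    fun k hk => M.eventually_mem_rho B hk, fun k hk => M.hasJump_gap B hk,
    fun k hk => M.hasJump_right B hk, fun k hk => M.hasJump_left B hk, M.ae_hasBoundaryValues B,
    fun k hk p q hp hq => M.boundaryValues_ne_iff B hk hp hq, fun μ₀ hμ₀ μ₁ hμ₁ =>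
    ⟨fun k hk => M.not_jumpVanishes hμ₀ hμ₁ hk, fun k hk hbv => M.hasNonzeroJump hμ₀ hμ₁ hk hbv,
      fun k hk hbv => M.jumpVanishes hμ₀ hμ₁ hk hbv⟩⟩
  obtain ⟨hi, hm⟩ := M.disjointSupport.mem_rho_iff.1 hz
  refine ⟨M.disjointSupport.existsUnique_isMValue hi hm, ?_⟩
  rw [M.disjointSupport.mFunction_eq hi hm]
  exact inv_ne_zero hm
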